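/- **Setting.** A two-player zero-sum simultaneous-move episodic Markov game consists of a measurable state space $\mathcal S$, a finite action set $\mathcal A$ for both players, a horizon $H\ge 1$, rewards $r_h:\mathcal S\times\mathcal A\times\mathcal A\to[-1,1]$ and transition kernels $\mathbb P_h(\cdot\mid x,a,b)$ on $\mathcal S$, $h=1,\dots,H$. For (measurable, stochastic) policies $\pi=(\pi_h)$, $\nu=(\nu_h)$ of the two players, $V_h^{\pi,\nu}(x)=\mathbb E[\sum_{t=h}^H r_t(x_t,a_t,b_t)\mid x_h=x]$ with $a_t\sim\pi_t(x_t)$, $b_t\sim\nu_t(x_t)$ independent and $x_{t+1}\sim\mathbb P_t(\cdot\mid x_t,a_t,b_t)$; $V_h^{*,\nu}=\sup_\pi V_h^{\pi,\nu}$, $V_h^{\pi,*}=\inf_\nu V_h^{\pi,\nu}$. **Linearity assumption.** There are a known measurable feature map $\phi:\mathcal S\times\mathcal A\times\mathcal A\to\mathbb R^d$ and unknown $\theta_h\in\mathbb R^d$ and vectors $\mu_h=(\mu_h^{(1)},\dots,\mu_h^{(d)})$ of finite signed measures on $\mathcal S$ with $r_h(x,a,b)=\phi(x,a,b)^\top\theta_h$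 and $\mathbb P_h(\cdot\mid x,a,b)=\phi(x,a,b)^\top\mu_h(\cdot)$ for all $(x,a,b)$ and $h\in\{1,\dots,H\}$, where $\|\phi(x,a,b)\|\le1$, $\|\theta_h\|\le\sqrt d$, and $\|\mu_h(B)\|\le\sqrt d$ for every measurable $B\subseteq\mathcal S$ (if the $\mu_h^{(i)}$ are nonnegative, this just says $\|\mu_h(\mathcal S)\|\le\sqrt d$). **Algorithm OMNI-VI**, with bonus parameter $\beta>0$ and accuracy $\epsilon>0$. Let $\Pi_H(u)=\max\{\min\{u,H\},-H\}$. In episode $k=1,\dots,K$ an arbitrary initial state $x_1^k$ is given (possibly depending on the past). Put $\overline V_{H+1}^k=\underline V_{H+1}^k=0$ and, with $\phi_h^\tau:=\phi(x_h^\tau,a_h^\tau,b_h^\tau)$, compute for $h=H,\dots,1$ $$\Lambda_h^k=I+\sum_{\tau<k}\phi_h^\tau(\phi_h^\tau)^\top,\qquad \overline w_h^k=(\Lambda_h^k)^{-1}\sum_{\tau<k}\phi_h^\tau\,[r_h(x_h^\tau,a_h^\tau,b_h^\tau)+\overline V_{h+1}^k(x_{h+1}^\tau)],$$ $\underline w_h^k$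 in the same way with $\underline V_{h+1}^k$, and $$\overline Q_h^k=\Pi_H\{(\overline w_h^k)^\top\phi+\beta\sqrt{\phi^\top(\Lambda_h^k)^{-1}\phi}\},\qquad \underline Q_h^k=\Pi_H\{(\underline w_h^k)^\top\phi-\beta\sqrt{\phi^\top(\Lambda_h^k)^{-1}\phi}\};$$ let $\sigma_h^k(x)=\mathrm{FIND\_CCE}(\overline Q_h^k,\underline Q_h^k,x)$ for each $x$, a distribution on $\mathcal A\times\mathcal A$, and $\overline V_h^k(x)=\mathbb E_{(a,b)\sim\sigma_h^k(x)}\overline Q_h^k(x,a,b)$, $\underline V_h^k(x)=\mathbb E_{(a,b)\sim\sigma_h^k(x)}\underline Q_h^k(x,a,b)$. Then, for $h=1,\dots,H$, the actions $(a_h^k,b_h^k)$ are drawn from $\sigma_h^k(x_h^k)$ and the next state $x_{h+1}^k\sim\mathbb P_h(\cdot\mid x_h^k,a_h^k,b_h^k)$ is observed. **FIND_CCE.** Let $\mathcal Q^k$ be the class of functions $\Pi_H\{\langle w,\phi\rangle+\rho\beta\sqrt{\phi^\top A\phi}\}$ with $\|w\|\le 2H\sqrt{dk}$, $\|A\|_F\le\beta^2\sqrt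 d$, $\phi^\top A\phi\ge0$ on $\mathcal S\times\mathcal A\times\mathcal A$ and $\rho\in\{\pm1\}$. Let $\mathcal Q^k_\epsilon\subseteq\mathcal Q^k$ be a fixed $\epsilon$-covering of $\mathcal Q^k$ in sup norm, of cardinality equal to the covering number of $\mathcal Q^k$ (by subsets of $\mathcal Q^k$). FIND_CCE picks $\widetilde Q,\underset{\sim}{Q}\in\mathcal Q_\epsilon^k$ within $\epsilon$ (in sup norm) of $\overline Q_h^k,\underline Q_h^k$, the same pair for all $x$, and returns, by a fixed rule depending (measurably) on $x$ and on the pair, a coarse correlated equilibrium $\sigma$ of the matrix game $(\widetilde Q(x,\cdot,\cdot),\underset{\sim}{Q}(x,\cdot,\cdot))$: $\mathbb E_{(a,b)\sim\sigma}\widetilde Q(x,a,b)\ge\mathbb E_{(a,b)\sim\sigma}\widetilde Q(x,a',b)$ for all $a'$ and $\mathbb E_{(a,b)\sim\sigma}\underset{\sim}{Q}(x,a,b)\le\mathbb E_{(a,b)\sim\sigma}\underset{\sim}{Q}(x,a,b')$ for all $b'$. Let $\pi_h^k(x)$, $\nu_h^k(x)$ be the first and second marginals of $\sigma_h^k(x)$,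 $T=KH$, and $\mathrm{Gap}(K)=\sum_{k=1}^K[V_1^{*,\nu^k}(x_1^k)-V_1^{\pi^k,*}(x_1^k)]$. **Theorem.** There are universal constants $c,C>0$ such that the following holds for every game satisfying the linearity assumption, every $K\ge1$ and every $p\in(0,1)$. Run OMNI-VI with $\beta=cdH\sqrt\iota$, $\iota=\log(2dT/p)$, and $\epsilon=\frac1{KH}$. Then with probability at least $1-p$ all of the following hold: $$V_1^{*,\nu^k}(x_1^k)-V_1^{\pi^k,*}(x_1^k)\le\overline V_1^k(x_1^k)-\underline V_1^k(x_1^k)+\frac8K\quad\text{for all }k\in\{1,\dots,K\},$$ $$\sum_{k=1}^K\big[\overline V_1^k(x_1^k)-\underline V_1^k(x_1^k)\big]\le C\sqrt{d^3H^3T\iota^2},\qquad \mathrm{Gap}(K)\le C\sqrt{d^3H^3T\iota^2}.$$ -/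

import Mathlib

open MeasureTheory ProbabilityTheory
open scoped Matrix

noncomputable section

/-- Markov kernels from `X` to `Y`. -/
abbrev StochKernel (X Y : Type*) [MeasurableSpace X] [MeasurableSpace Y] :=
  {κ : Kernel X Y // IsMarkovKernel κ}

instance instMarkovStochKernel {X Y : Type*} [MeasurableSpace X] [MeasurableSpace Y]
    (κ : StochKernel X Y) : IsMarkovKernel κ.1 := κ.2

/-- A (stochastic, Markov) policy of one player with actions `A`: one kernel `S → A` for each step
(steps are numbered from `1`). With `A × A` in place of `A` it is a correlated policy of both
players. -/
abbrev Policy (S A : Type*) [MeasurableSpace S] [MeasurableSpace A] := ℕ → StochKernel S A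

/-- A two-player zero-sum simultaneous-move episodic Markov game with state space `S` and common
action set `A`. The steps of an episode are `1, …, horizon`; a point of `S × A × A` is a triple
(state, action of the first player, action of the second player). Values of `reward` and `trans` at
other indices are irrelevant. -/
structure MarkovGame (S A : Type*) [MeasurableSpace S] [MeasurableSpace A] where
  horizon : ℕ
  reward : ℕ → S × A × A → ℝ
  trans : ℕ → StochKernel (S × A × A) S
  measurable_reward : ∀ h, Measurable (reward h)
  abs_reward_le_one : ∀ h s, |reward h s| ≤ 1

section Games

variable {S A : Type*} [MeasurableSpace S] [MeasurableSpace A]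

/-- First marginal of a correlated policy. -/
def Policy.marginalFst (σ : Policy S (A × A)) : Policy S A :=
  fun h => ⟨(σ h).1.fst, inferInstance⟩

/-- Second marginal of a correlated policy. -/
def Policy.marginalSnd (σ : Policy S (A × A)) : Policy S A :=
  fun h => ⟨(σ h).1.snd, inferInstance⟩

namespace MarkovGame

/-- The law of `(x_{n+1}, a_{n+1}, b_{n+1})` given `(x_n, a_n, b_n)`, when the players use `π`, `ν`:
the next state is drawn from the transition kernel, then both actions are drawn independently. -/
def stepKernel (G : MarkovGame S A) (π ν : Policy S A) (n : ℕ) :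
    Kernel (S × A × A) (S × A × A) :=
  (Kernel.id ×ₖ ((π (n + 1)).1 ×ₖ (ν (n + 1)).1)) ∘ₖ (G.trans n).1

instance instMarkovStepKernel (G : MarkovGame S A) (π ν : Policy S A) (n : ℕ) :
    IsMarkovKernel (G.stepKernel π ν n) := by
  unfold stepKernel; infer_instance

/-- `stepKernel` as a kernel that reads the whole history up to time `n`. -/
def histKernel (G : MarkovGame S A) (π ν : Policy S A) (n : ℕ) :
    Kernel ((i : Finset.Iic n) → (fun _ : ℕ => S × A × A) i) (S × A × A) :=
  (G.stepKernel π ν n).comap (fun ω => ω ⟨n, Finset.mem_Iic.2 le_rfl⟩)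
    (measurable_pi_apply _)

instance instMarkovHistKernel (G : MarkovGame S A) (π ν : Policy S A) (n : ℕ) :
    IsMarkovKernel (G.histKernel π ν n) := by
  unfold histKernel; infer_instance

/-- The law of the trajectory `(x_t, a_t, b_t)_t` conditionally on `(x_h, a_h, b_h) = s`, under `π`,
`ν`; only the coordinates `t ≥ h` are meaningful (those with `t < h` are set to `s`). -/
def trajLaw (G : MarkovGame S A) (π ν : Policy S A) (h : ℕ) (s : S × A × A) :
    Measure (ℕ → S × A × A) :=
  Kernel.traj (X := fun _ => S × A × A) (G.histKernel π ν) h (fun _ => s)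

/-- `Q_h^{π,ν}(x,a,b)`: expected total reward of the steps `h, …, H` given `(x_h, a_h, b_h)`. -/
def qValue (G : MarkovGame S A) (π ν : Policy S A) (h : ℕ) (s : S × A × A) : ℝ :=
  ∫ ω, ∑ t ∈ Finset.Icc h G.horizon, G.reward t (ω t) ∂(G.trajLaw π ν h s)

/-- `V_h^{π,ν}(x)`: expected total reward of the steps `h, …, H` given `x_h = x`, the first actions
being drawn independently from `π_h(x)` and `ν_h(x)`. -/
def value (G : MarkovGame S A) (π ν : Policy S A) (h : ℕ) (x : S) : ℝ :=
  ∫ ab, G.qValue π ν h (x, ab) ∂(((π h).1 x).prod ((ν h).1 x))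

/-- `V_h^{*,ν}(x)`: value when the first player best responds to `ν`. -/
def valueBestFst (G : MarkovGame S A) (ν : Policy S A) (h : ℕ) (x : S) : ℝ :=
  ⨆ π : Policy S A, G.value π ν h x

/-- `V_h^{π,*}(x)`: value when the second player best responds to `π`. -/
def valueBestSnd (G : MarkovGame S A) (π : Policy S A) (h : ℕ) (x : S) : ℝ :=
  ⨅ ν : Policy S A, G.value π ν h x

/-- The linear structure: rewards and transitions are linear in the feature map `φ`, with the usual
normalization. The `μ h i` are finite signed measures, and `‖μ h (B)‖ ≤ √d` is required for every
measurable set `B` of states (for nonnegative `μ h i` this is the same as `‖μ h (S)‖ ≤ √d`). -/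
structure IsLinear (G : MarkovGame S A) {d : ℕ} (φ : S × A × A → EuclideanSpace ℝ (Fin d))
    (θ : ℕ → EuclideanSpace ℝ (Fin d)) (μ : ℕ → Fin d → SignedMeasure S) : Prop where
  measurable_feature : Measurable φ
  norm_feature_le : ∀ s, ‖φ s‖ ≤ 1
  reward_eq : ∀ h ∈ Finset.Icc 1 G.horizon, ∀ s, G.reward h s = inner ℝ (φ s) (θ h)
  trans_eq : ∀ h ∈ Finset.Icc 1 G.horizon, ∀ s, ∀ B : Set S, MeasurableSet B →
    ((G.trans h).1 s).real B = ∑ i, φ s i * μ h i B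
  norm_theta_le : ∀ h ∈ Finset.Icc 1 G.horizon, ‖θ h‖ ≤ √d
  norm_mu_le : ∀ h ∈ Finset.Icc 1 G.horizon, ∀ B : Set S, MeasurableSet B →
    ‖WithLp.toLp 2 (fun i => μ h i B)‖ ≤ √d

end MarkovGame

/-- `σ` is a coarse correlated equilibrium of the matrix game with payoffs `u₁` for the first player
(who maximizes) and `u₂` for the second player (who minimizes). -/
def IsCCE (u₁ u₂ : A × A → ℝ) (σ : Measure (A × A)) : Prop :=
  (∀ a' : A, ∫ b, u₁ (a', b) ∂σ.snd ≤ ∫ ab, u₁ ab ∂σ) ∧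
  (∀ b' : A, ∫ ab, u₂ ab ∂σ ≤ ∫ a, u₂ (a, b') ∂σ.fst)

/-- Clipping to `[-H, H]`. -/
def clip (H u : ℝ) : ℝ := max (min u H) (-H)

/-- The function `clip_H(⟨w, φ⟩ + ρ β √(φᵀ M φ))`. -/
def linBonus {d : ℕ} (φ : S × A × A → EuclideanSpace ℝ (Fin d)) (H β : ℝ)
    (w : EuclideanSpace ℝ (Fin d)) (M : Matrix (Fin d) (Fin d) ℝ) (ρ : ℝ) (s : S × A × A) : ℝ :=
  clip H (inner ℝ w (φ s) + ρ * β * √((φ s).ofLp ⬝ᵥ M *ᵥ (φ s).ofLp))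

/-- The class of functions `clip_H(⟨w, φ⟩ + ρ β √(φᵀ M φ))` with `‖w‖ ≤ 2H√(dk)`,
`‖M‖_F ≤ β²√d` and `ρ = ±1`, the quadratic form under the root being nonnegative. -/
def qClass {d : ℕ} (φ : S × A × A → EuclideanSpace ℝ (Fin d)) (H β : ℝ) (k : ℕ) :
    Set (S × A × A → ℝ) :=
  {q | ∃ (w : EuclideanSpace ℝ (Fin d)) (M : Matrix (Fin d) (Fin d) ℝ) (ρ : ℝ),
    ‖w‖ ≤ 2 * H * √(d * k) ∧ √(∑ i, ∑ j, M i j ^ 2) ≤ β ^ 2 * √d ∧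
    (∀ s, 0 ≤ (φ s).ofLp ⬝ᵥ M *ᵥ (φ s).ofLp) ∧ (ρ = 1 ∨ ρ = -1) ∧
    q = linBonus φ H β w M ρ}

/-- `N ⊆ 𝒬` is an `ε`-covering of `𝒬` for the sup distance. -/
def IsSupCover {X : Type*} (𝒬 : Set (X → ℝ)) (ε : ℝ) (N : Set (X → ℝ)) : Prop :=
  N ⊆ 𝒬 ∧ ∀ q ∈ 𝒬, ∃ q' ∈ N, ∀ s, |q' s - q s| ≤ ε

/-- `N` is an `ε`-covering of `𝒬` whose cardinality is the `ε`-covering number of `𝒬`. -/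
def IsMinSupCover {X : Type*} (𝒬 : Set (X → ℝ)) (ε : ℝ) (N : Set (X → ℝ)) : Prop :=
  IsSupCover 𝒬 ε N ∧ ∀ N', IsSupCover 𝒬 ε N' → N.encard ≤ N'.encard

/-- `κ` is a possible output, as a function of the state, of the rounding procedure with net `N`,
accuracy `ε` and equilibrium rule `cce` on the input `(Qup, Qlow)`: pick `q`, `q'` in the net within
`ε` of `Qup`, `Qlow` and return, at each state, the chosen equilibrium of the game `(q, q')`. -/
def IsFindCCE (N : Set (S × A × A → ℝ)) (ε : ℝ)
    (cce : (S × A × A → ℝ) → (S × A × A → ℝ) → StochKernel S (A × A))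
    (Qup Qlow : S × A × A → ℝ) (κ : StochKernel S (A × A)) : Prop :=
  ∃ q ∈ N, ∃ q' ∈ N, (∀ s, |q s - Qup s| ≤ ε) ∧ (∀ s, |q' s - Qlow s| ≤ ε) ∧ κ = cce q q'

/-- `cce` selects, for any two payoff functions of the net `N` and any state, a coarse correlated
equilibrium of the resulting matrix game. -/
def IsCCERule (N : Set (S × A × A → ℝ))
    (cce : (S × A × A → ℝ) → (S × A × A → ℝ) → StochKernel S (A × A)) : Prop :=
  ∀ q ∈ N, ∀ q' ∈ N, ∀ x, IsCCE (fun ab => q (x, ab)) (fun ab => q' (x, ab)) ((cce q q').1 x)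

section Estimates

variable {d : ℕ} (G : MarkovGame S A) (φ : S × A × A → EuclideanSpace ℝ (Fin d)) (β : ℝ)

/-- Regularized Gram matrix of the triples `z 1, …, z (k-1)`. -/
def gram (z : ℕ → S × A × A) (k : ℕ) : Matrix (Fin d) (Fin d) ℝ :=
  ∑ τ ∈ Finset.Ico 1 k, Matrix.vecMulVec (φ (z τ)).ofLp (φ (z τ)).ofLp + 1

/-- Ridge regression of the targets `r (z τ) + V (y τ)`, `τ = 1, …, k-1`, on the features. -/
def ridge (z : ℕ → S × A × A) (y : ℕ → S) (k : ℕ) (r : S × A × A → ℝ) (V : S → ℝ) :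
    EuclideanSpace ℝ (Fin d) :=
  WithLp.toLp 2 ((gram φ z k)⁻¹ *ᵥ
    ∑ τ ∈ Finset.Ico 1 k, (r (z τ) + V (y τ)) • (φ (z τ)).ofLp)

/-- The upper (`ρ = 1`) or lower (`ρ = -1`) estimate of the step-`h` Q function in episode `k`,
computed from the data of the episodes `1, …, k-1` and the estimate `V` of the value at step
`h + 1`. Here `x τ h` and `act τ h` are the state and the pair of actions at step `h` of
episode `τ`. -/
def qStep (x : ℕ → ℕ → S) (act : ℕ → ℕ → A × A) (k : ℕ) (ρ : ℝ) (h : ℕ) (V : S → ℝ) :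
    S × A × A → ℝ :=
  linBonus φ G.horizon β
    (ridge φ (fun τ => (x τ h, act τ h)) (fun τ => x τ (h + 1)) k (G.reward h) V)
    (gram φ (fun τ => (x τ h, act τ h)) k)⁻¹ ρ

/-- Backward recursion for the value estimates of episode `k`, when `σ` is the correlated policy of
that episode; the argument `n` is the number of remaining steps, so that the step is `H - n + 1`. -/
def vRec (x : ℕ → ℕ → S) (act : ℕ → ℕ → A × A) (k : ℕ) (ρ : ℝ) (σ : Policy S (A × A)) :
    ℕ → S → ℝ
  | 0 => fun _ => 0
  | n + 1 => fun s => ∫ ab, qStep G φ β x act k ρ (G.horizon - n)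
      (vRec x act k ρ σ n) (s, ab) ∂((σ (G.horizon - n)).1 s)

/-- Upper (`ρ = 1`) and lower (`ρ = -1`) confidence bound for the value function at step `h`. -/
def vEst (x : ℕ → ℕ → S) (act : ℕ → ℕ → A × A) (k : ℕ) (ρ : ℝ) (σ : Policy S (A × A)) (h : ℕ) :
    S → ℝ :=
  vRec G φ β x act k ρ σ (G.horizon + 1 - h)

/-- Upper (`ρ = 1`) and lower (`ρ = -1`) confidence bound for the Q function at step `h`. -/
def qEst (x : ℕ → ℕ → S) (act : ℕ → ℕ → A × A) (k : ℕ) (ρ : ℝ) (σ : Policy S (A × A)) (h : ℕ) :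
    S × A × A → ℝ :=
  qStep G φ β x act k ρ h (vEst G φ β x act k ρ σ (h + 1))

end Estimates

section Run

variable {Ω : Type*}

/-- The information available when step `h` of episode `k` begins, the current state included: all
states and actions of the episodes `1, …, k-1`, and, in episode `k`, the states up to step `h` and
the actions before step `h`. -/
abbrev preInfo (H : ℕ) (x : ℕ → ℕ → Ω → S) (act : ℕ → ℕ → Ω → A × A) (k h : ℕ) :
    MeasurableSpace Ω :=
  (⨆ j ∈ Set.Ico 1 k,
    ((⨆ t ∈ Set.Icc 1 (H + 1), MeasurableSpace.comap (x j t) inferInstance) ⊔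
      (⨆ t ∈ Set.Icc 1 H, MeasurableSpace.comap (act j t) inferInstance))) ⊔
  (⨆ t ∈ Set.Icc 1 h, MeasurableSpace.comap (x k t) inferInstance) ⊔
  (⨆ t ∈ Set.Ico 1 h, MeasurableSpace.comap (act k t) inferInstance)

/-- The information available just after the actions of step `h` of episode `k` were drawn. -/
abbrev postInfo (H : ℕ) (x : ℕ → ℕ → Ω → S) (act : ℕ → ℕ → Ω → A × A) (k h : ℕ) :
    MeasurableSpace Ω :=
  preInfo H x act k h ⊔ MeasurableSpace.comap (act k h) inferInstance

/-- A run of OMNI-VI (simultaneous moves, offline) for `K` episodes, with bonus parameter `β`,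
accuracy `ε`, nets `N k` and equilibrium rule `cce`. `x k h`, `act k h` are the state and the
actions at step `h` of episode `k`, and `σ k ω` is the correlated policy of episode `k`. The initial
states `x k 1` are arbitrary (they may depend on the past and on further randomness). -/
structure IsOmniRun {d : ℕ} [MeasurableSpace Ω] (P : Measure Ω) (G : MarkovGame S A)
    (φ : S × A × A → EuclideanSpace ℝ (Fin d)) (β ε : ℝ) (K : ℕ) (N : ℕ → Set (S × A × A → ℝ))
    (cce : (S × A × A → ℝ) → (S × A × A → ℝ) → StochKernel S (A × A))
    (x : ℕ → ℕ → Ω → S) (act : ℕ → ℕ → Ω → A × A) (σ : ℕ → Ω → Policy S (A × A)) : Prop where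
  measurable_state : ∀ k h, Measurable (x k h)
  measurable_act : ∀ k h, Measurable (act k h)
  /-- At each step of the backward pass the policy is returned by the rounding procedure. -/
  policy_eq : ∀ k ∈ Finset.Icc 1 K, ∀ h ∈ Finset.Icc 1 G.horizon, ∀ ω,
    IsFindCCE (N k) ε cce
      (qEst G φ β (fun τ t => x τ t ω) (fun τ t => act τ t ω) k 1 (σ k ω) h)
      (qEst G φ β (fun τ t => x τ t ω) (fun τ t => act τ t ω) k (-1) (σ k ω) h) (σ k ω h)
  /-- The policy of episode `k` is decided by the past episodes and the initial state. -/
  policy_measurable : ∀ k ∈ Finset.Icc 1 K, ∀ h ∈ Finset.Icc 1 G.horizon,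
    ∀ κ : StochKernel S (A × A),
      MeasurableSet[preInfo G.horizon x act k 1] {ω | σ k ω h = κ}
  /-- Given the past and the current state, the actions are drawn from the policy. -/
  act_law : ∀ k ∈ Finset.Icc 1 K, ∀ h ∈ Finset.Icc 1 G.horizon, ∀ ab : A × A,
    P[Set.indicator {ω | act k h ω = ab} (fun _ => (1 : ℝ)) | preInfo G.horizon x act k h]
      =ᵐ[P] fun ω => ((σ k ω h).1 (x k h ω)).real {ab}
  /-- Given the past, the current state and actions, the next state follows the transition. -/
  state_law : ∀ k ∈ Finset.Icc 1 K, ∀ h ∈ Finset.Icc 1 G.horizon,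
    ∀ B : Set S, MeasurableSet B →
    P[Set.indicator {ω | x k (h + 1) ω ∈ B} (fun _ => (1 : ℝ)) | postInfo G.horizon x act k h]
      =ᵐ[P] fun ω => ((G.trans h).1 (x k h ω, act k h ω)).real B

/-- The total duality gap `Gap(K)` of the marginal policies. -/
def totalGap (G : MarkovGame S A) (K : ℕ) (x₁ : ℕ → S) (σ : ℕ → Policy S (A × A)) : ℝ :=
  ∑ k ∈ Finset.Icc 1 K, (G.valueBestFst (σ k).marginalSnd 1 (x₁ k) -
    G.valueBestSnd (σ k).marginalFst 1 (x₁ k))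

end Run

end Games

end

/-!
The proof is optimism under uniform concentration.

**Optimism.** Let `Λ` be the Gram matrix of the data of one step and `√(φᵀ Λ⁻¹ φ)` the elliptical
norm of a feature vector (`ellNorm`). For a linear game, reward plus expected next value is linear
in the features (`MarkovGame.IsLinear.exists_integral_trans_eq`), so the error of the ridge estimate
consists of a regularization term and a self-normalized noise term, both multiples of the elliptical
norm (`abs_inner_ridge_sub_le`). If `β` is at least the sum of the two factors, the bonus
dominates the error at every triple (`BonusDominates`). Backward induction through the
Bellman equation `MarkovGame.qValue_eq` and the equilibrium inequalities then gives
`V^{*,ν} - V^{π,*} ≤ upper estimate - lower estimate + 4 H ε` at the first step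
(`valueBest_sub_le`); each step loses `2 ε` per player because the equilibrium is computed for the
rounded functions. With `ε = 1 / (K H)` this is `4 / K ≤ 8 / K`.

**Why bonuses dominate.** The regression targets depend on the past, so concentration must hold
uniformly over all targets. Away from rounding, a target is `y ↦ ∫ q₃ d(cce q₁ q₂)(y)`
(`netValue`) with `q₁`, `q₂`, `q₃` in the minimal net: the policy depends on two net functions only,
and the estimate being averaged is within `ε` of a third. A minimal net has at most `L ^ (49 d²)`
elements, `L = 2 d K H / p` (`LogFactor.exists_finset_net`). For a fixed target the noise in a fixed
direction `u` has the supermartingale bound `IsOmniRun.measure_noise_gt_le`; the self-normalized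
norm of the noise vector follows from a finite net of directions (`self_normalized_le_of_net`),
which is enough at the scale `d H √ι` and needs no Gaussian mixture. The union bound over triples of
net functions, directions, steps and episodes costs `O(d² ι)` in the exponent, where `ι = log L`.
This is where `β = c d H √ι` comes from (`bonusDominates_of_noise_le`).

**Regret.** The width of the confidence interval at the first step unfolds into action noise,
transition noise and `O(β)` times the elliptical norms along the run (`vGap_one_le`). For each step
`h`, the two noise sums over the episodes are sums of bounded martingale differences and stay below
`O(H √(K ι))`. The bonuses are summed by Cauchy–Schwarz and the elliptical potential bound
(`sum_ellNorm_le`). The sum over `h` is of order `H² √(K ι) + d H² √ι √(d K ι)`, hence of order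
`√(d³ H³ T ι²)` with `T = K H` (`sum_vGap_le`).
-/

noncomputable section

/-! ### Gram matrices -/

section Gram

variable {S A : Type*} {d : ℕ}
  (φ : S × A × A → EuclideanSpace ℝ (Fin d)) (z : ℕ → S × A × A)

theorem gram_one : gram φ z 1 = 1 := by simp [gram]

theorem gram_succ {k : ℕ} (hk : 1 ≤ k) :
    gram φ z (k + 1) = gram φ z k + Matrix.vecMulVec (φ (z k)).ofLp (φ (z k)).ofLp := by
  unfold gram
  rw [Finset.sum_Ico_succ_top hk]
  abel

theorem dotProduct_gram_mulVec (k : ℕ) (u v : Fin d → ℝ) :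
    u ⬝ᵥ gram φ z k *ᵥ v =
      ∑ τ ∈ Finset.Ico 1 k, (u ⬝ᵥ (φ (z τ)).ofLp) * (v ⬝ᵥ (φ (z τ)).ofLp) + u ⬝ᵥ v := by
  unfold gram
  rw [Matrix.add_mulVec, dotProduct_add, Matrix.one_mulVec, Matrix.sum_mulVec, dotProduct_sum]
  congr 1
  refine Finset.sum_congr rfl fun τ _ => ?_
  rw [Matrix.vecMulVec_mulVec, dotProduct_comm v]
  simp [dotProduct_smul, mul_comm]

theorem gram_posDef (k : ℕ) : (gram φ z k).PosDef := by
  unfold gram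
  refine Matrix.PosDef.posSemidef_add ?_ Matrix.PosDef.one
  refine Matrix.posSemidef_sum _ fun τ _ => ?_
  simpa using Matrix.posSemidef_vecMulVec_self_star (φ (z τ)).ofLp

theorem gram_inv_posSemidef (k : ℕ) : ((gram φ z k)⁻¹).PosSemidef :=
  (gram_posDef φ z k).inv.posSemidef

theorem gram_mulVec_inv_mulVec (k : ℕ) (v : Fin d → ℝ) :
    gram φ z k *ᵥ ((gram φ z k)⁻¹ *ᵥ v) = v := by
  have h : IsUnit (gram φ z k).det := (gram_posDef φ z k).det_pos.ne'.isUnit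
  rw [Matrix.mulVec_mulVec, Matrix.mul_nonsing_inv _ h, Matrix.one_mulVec]

theorem gram_inv_mulVec_mulVec (k : ℕ) (v : Fin d → ℝ) :
    (gram φ z k)⁻¹ *ᵥ (gram φ z k *ᵥ v) = v := by
  have h : IsUnit (gram φ z k).det := (gram_posDef φ z k).det_pos.ne'.isUnit
  rw [Matrix.mulVec_mulVec, Matrix.nonsing_inv_mul _ h, Matrix.one_mulVec]

theorem dotProduct_mulVec_comm_of_symm {M : Matrix (Fin d) (Fin d) ℝ} (hM : M.IsHermitian)
    (x y : Fin d → ℝ) : x ⬝ᵥ M *ᵥ y = y ⬝ᵥ M *ᵥ x := by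
  have h : Mᵀ = M := by
    rw [← Matrix.conjTranspose_eq_transpose_of_trivial]; exact hM
  rw [Matrix.dotProduct_mulVec, dotProduct_comm, ← Matrix.mulVec_transpose, h]

theorem Matrix.PosSemidef.quad_nonneg {M : Matrix (Fin d) (Fin d) ℝ} (hM : M.PosSemidef)
    (x : Fin d → ℝ) : 0 ≤ x ⬝ᵥ M *ᵥ x := by
  simpa using hM.dotProduct_mulVec_nonneg x

/-- Cauchy–Schwarz inequality for the semi-inner product of a positive semidefinite matrix. -/
theorem Matrix.PosSemidef.abs_dotProduct_mulVec_le {M : Matrix (Fin d) (Fin d) ℝ}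
    (hM : M.PosSemidef) (x y : Fin d → ℝ) :
    |x ⬝ᵥ M *ᵥ y| ≤ √(x ⬝ᵥ M *ᵥ x) * √(y ⬝ᵥ M *ᵥ y) := by
  have key : ∀ t : ℝ, 0 ≤ (y ⬝ᵥ M *ᵥ y) * (t * t) + (2 * (x ⬝ᵥ M *ᵥ y)) * t + x ⬝ᵥ M *ᵥ x := by
    intro t
    have h := hM.quad_nonneg (x + t • y)
    rw [Matrix.mulVec_add, Matrix.mulVec_smul, dotProduct_add, add_dotProduct, add_dotProduct,
      dotProduct_smul, dotProduct_smul, smul_dotProduct, smul_dotProduct,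
      dotProduct_mulVec_comm_of_symm hM.1 y x] at h
    simp only [smul_eq_mul] at h
    linarith
  have h := discrim_le_zero key
  unfold discrim at h
  rw [← Real.sqrt_mul (hM.quad_nonneg x)]
  apply Real.abs_le_sqrt
  linarith

/-- As the Gram matrix dominates the identity, its inverse is dominated by the identity. -/
theorem gram_inv_quad_le (k : ℕ) (y : Fin d → ℝ) : y ⬝ᵥ (gram φ z k)⁻¹ *ᵥ y ≤ y ⬝ᵥ y := by
  set v := (gram φ z k)⁻¹ *ᵥ y with hv
  have hy : gram φ z k *ᵥ v = y := gram_mulVec_inv_mulVec φ z k y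
  have h1 : v ⬝ᵥ y = ∑ τ ∈ Finset.Ico 1 k, (v ⬝ᵥ (φ (z τ)).ofLp) * (v ⬝ᵥ (φ (z τ)).ofLp) +
      v ⬝ᵥ v := by
    rw [← dotProduct_gram_mulVec, hy]
  have h2 : 0 ≤ ∑ τ ∈ Finset.Ico 1 k, (v ⬝ᵥ (φ (z τ)).ofLp) * (v ⬝ᵥ (φ (z τ)).ofLp) :=
    Finset.sum_nonneg fun τ _ => mul_self_nonneg _
  have h3 : 0 ≤ (y - v) ⬝ᵥ (y - v) := by
    simp only [dotProduct]
    exact Finset.sum_nonneg fun i _ => mul_self_nonneg _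
  rw [sub_dotProduct, dotProduct_sub, dotProduct_sub, dotProduct_comm y v] at h3
  rw [dotProduct_comm y v]
  linarith

theorem dotProduct_self_eq_norm_sq (v : EuclideanSpace ℝ (Fin d)) :
    v.ofLp ⬝ᵥ v.ofLp = ‖v‖ ^ 2 := by
  rw [EuclideanSpace.norm_sq_eq]
  simp [dotProduct, sq]

theorem inner_eq_dotProduct (v w : EuclideanSpace ℝ (Fin d)) :
    inner ℝ v w = v.ofLp ⬝ᵥ w.ofLp := by
  rw [EuclideanSpace.inner_eq_star_dotProduct, dotProduct_comm]
  simp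

theorem det_gram_succ {k : ℕ} (hk : 1 ≤ k) :
    (gram φ z (k + 1)).det = (gram φ z k).det *
      (1 + (φ (z k)).ofLp ⬝ᵥ (gram φ z k)⁻¹ *ᵥ (φ (z k)).ofLp) := by
  have h : IsUnit (gram φ z k).det := (gram_posDef φ z k).det_pos.ne'.isUnit
  rw [gram_succ φ z hk, Matrix.vecMulVec_eq Unit, Matrix.det_add_replicateCol_mul_replicateRow h]
  congr 2
  rw [Matrix.mul_assoc, ← Matrix.replicateCol_mulVec]
  simp

theorem det_gram_le (hφ : ∀ s, ‖φ s‖ ≤ 1) (K : ℕ) : (gram φ z (K + 1)).det ≤ (1 + K : ℝ) ^ d := by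
  have hpd := gram_posDef φ z (K + 1)
  rw [hpd.1.det_eq_prod_eigenvalues]
  have : ∀ i ∈ (Finset.univ : Finset (Fin d)), (hpd.1.eigenvalues i : ℝ) ≤ 1 + K := by
    intro i _
    rw [hpd.1.eigenvalues_eq]
    set v := hpd.1.eigenvectorBasis i
    have hv : ‖v‖ = 1 := hpd.1.eigenvectorBasis.orthonormal.1 i
    simp only [star_trivial, RCLike.re_to_real]
    rw [dotProduct_gram_mulVec, dotProduct_self_eq_norm_sq, hv]
    have : ∑ τ ∈ Finset.Ico 1 (K + 1), v.ofLp ⬝ᵥ (φ (z τ)).ofLp * v.ofLp ⬝ᵥ (φ (z τ)).ofLp ≤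
        ∑ τ ∈ Finset.Ico 1 (K + 1), (1 : ℝ) := by
      refine Finset.sum_le_sum fun τ _ => ?_
      have h1 := abs_real_inner_le_norm v (φ (z τ))
      rw [hv, one_mul, inner_eq_dotProduct] at h1
      have h2 := h1.trans (hφ _)
      rw [← sq, ← sq_abs]
      exact pow_le_one₀ (abs_nonneg _) h2
    simp at this
    linarith
  calc ∏ i, (hpd.1.eigenvalues i : ℝ) ≤ ∏ i : Fin d, (1 + K : ℝ) :=
        Finset.prod_le_prod (fun i _ => hpd.eigenvalues_pos i |>.le) this
    _ = _ := by simp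

/-- Elliptical potential lemma: each new feature multiplies the determinant of the Gram matrix by
`1 + ‖φ‖²` in the norm of the inverse, and the determinant grows only polynomially. -/
theorem sum_gram_inv_quad_le (hφ : ∀ s, ‖φ s‖ ≤ 1) (K : ℕ) :
    ∑ k ∈ Finset.Icc 1 K, (φ (z k)).ofLp ⬝ᵥ (gram φ z k)⁻¹ *ᵥ (φ (z k)).ofLp ≤
      2 * (d * Real.log (1 + K)) := by
  have hlog : ∀ K : ℕ, ∑ k ∈ Finset.Icc 1 K,
      (φ (z k)).ofLp ⬝ᵥ (gram φ z k)⁻¹ *ᵥ (φ (z k)).ofLp ≤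
      2 * Real.log (gram φ z (K + 1)).det := by
    intro K
    induction K with
    | zero => simp [gram_one]
    | succ k ih =>
      rw [Finset.sum_Icc_succ_top (by omega), det_gram_succ φ z (by omega : 1 ≤ k + 1)]
      set q := (φ (z (k + 1))).ofLp ⬝ᵥ (gram φ z (k + 1))⁻¹ *ᵥ (φ (z (k + 1))).ofLp
      have hq0 : 0 ≤ q := (gram_inv_posSemidef φ z (k + 1)).quad_nonneg _
      have hq1 : q ≤ 1 := by
        refine (gram_inv_quad_le φ z (k + 1) _).trans ?_
        rw [dotProduct_self_eq_norm_sq]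
        exact pow_le_one₀ (norm_nonneg _) (hφ _)
      rw [Real.log_mul (gram_posDef φ z _).det_pos.ne' (by linarith)]
      have : q / 2 ≤ Real.log (1 + q) := by
        have h := Real.one_sub_inv_le_log_of_pos (by linarith : 0 < 1 + q)
        refine le_trans ?_ h
        rw [div_le_iff₀ (by norm_num), ← sub_nonneg]
        have : (1 - (1 + q)⁻¹) * 2 - q = q * (1 - q) / (1 + q) := by
          field_simp
          ring
        rw [this]
        apply div_nonneg (mul_nonneg hq0 (by linarith)) (by linarith)
      linarith
  refine (hlog K).trans ?_
  have h := Real.log_le_log (gram_posDef φ z (K + 1)).det_pos (det_gram_le φ z hφ K)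
  rw [Real.log_pow] at h
  linarith

/-- Bound on a self-normalized sum from one-directional bounds: if the deviation inequality
`⟪u, ∑ e φ⟫ - H²/2 ∑ ⟪u, φ⟫² ≤ Γ` holds for a point `u` of a fine net near
`Λ⁻¹ (∑ e φ) / (4 H²)`, then `∑ e φ` has small norm with respect to the inverse Gram matrix. -/
theorem self_normalized_le_of_net (hφ : ∀ s, ‖φ s‖ ≤ 1) {K k : ℕ} (hk : 1 ≤ k) (hkK : k ≤ K)
    {H Γ : ℝ} (hH : 1 ≤ H) (e : ℕ → ℝ) (he : ∀ τ, |e τ| ≤ 2 * H) (U : Set (Fin d → ℝ))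
    (hnet : ∀ v : Fin d → ℝ, (∀ i, |v i| ≤ K) → ∃ u ∈ U, ∀ i, |v i - u i| ≤ 1 / (4 * d * K * H))
    (hU : ∀ u ∈ U, ∑ τ ∈ Finset.Ico 1 k, ((u ⬝ᵥ (φ (z τ)).ofLp) * e τ -
      H ^ 2 / 2 * (u ⬝ᵥ (φ (z τ)).ofLp) ^ 2) ≤ Γ) :
    (∑ τ ∈ Finset.Ico 1 k, e τ • (φ (z τ)).ofLp) ⬝ᵥ (gram φ z k)⁻¹ *ᵥ
      (∑ τ ∈ Finset.Ico 1 k, e τ • (φ (z τ)).ofLp) ≤ 6 * H ^ 2 * (Γ + 1) := by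
  have hK : (1 : ℝ) ≤ K := by exact_mod_cast hk.trans hkK
  set s : EuclideanSpace ℝ (Fin d) := ∑ τ ∈ Finset.Ico 1 k, e τ • φ (z τ) with hs
  have hs' : ∑ τ ∈ Finset.Ico 1 k, e τ • (φ (z τ)).ofLp = s.ofLp := by
    rw [hs]; simp
  rw [hs']
  have hsn : ‖s‖ ≤ 2 * H * K := by
    calc ‖s‖ ≤ ∑ τ ∈ Finset.Ico 1 k, ‖e τ • φ (z τ)‖ := norm_sum_le _ _
      _ ≤ ∑ τ ∈ Finset.Ico 1 k, 2 * H := by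
          refine Finset.sum_le_sum fun τ _ => ?_
          rw [norm_smul, Real.norm_eq_abs]
          calc |e τ| * ‖φ (z τ)‖ ≤ 2 * H * 1 :=
                mul_le_mul (he τ) (hφ _) (norm_nonneg _) (by linarith)
            _ = _ := mul_one _
      _ = (k - 1 : ℕ) * (2 * H) := by simp
      _ ≤ K * (2 * H) := by
          gcongr
          omega
      _ = _ := by ring
  set M := (gram φ z k)⁻¹
  set q := s.ofLp ⬝ᵥ M *ᵥ s.ofLp with hq
  have hq0 : 0 ≤ q := (gram_inv_posSemidef φ z k).quad_nonneg _
  set w : EuclideanSpace ℝ (Fin d) := WithLp.toLp 2 (M *ᵥ s.ofLp) with hw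
  have hwq : w.ofLp ⬝ᵥ gram φ z k *ᵥ w.ofLp = q := by
    rw [hw]
    simp only
    rw [gram_mulVec_inv_mulVec, dotProduct_comm]
  have hquad : ∑ τ ∈ Finset.Ico 1 k, (w.ofLp ⬝ᵥ (φ (z τ)).ofLp) ^ 2 + ‖w‖ ^ 2 = q := by
    rw [← hwq, dotProduct_gram_mulVec, dotProduct_self_eq_norm_sq]
    congr 1
    exact Finset.sum_congr rfl fun τ _ => sq _
  have hwn : ‖w‖ ≤ ‖s‖ := by
    have h1 : q ≤ ‖s‖ * ‖w‖ := by
      have := real_inner_le_norm s w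
      rwa [inner_eq_dotProduct] at this
    have h2 : 0 ≤ ∑ τ ∈ Finset.Ico 1 k, (w.ofLp ⬝ᵥ (φ (z τ)).ofLp) ^ 2 :=
      Finset.sum_nonneg fun τ _ => sq_nonneg _
    by_contra! h
    nlinarith [norm_nonneg s, norm_nonneg w]
  -- `v = c • w` has linear term `c q`, to dominate the quadratic term, which is at most `H² c² q`
  -- up to a constant; hence `c` is a small multiple of `H⁻²`
  set v : EuclideanSpace ℝ (Fin d) := (1 / (4 * H ^ 2)) • w with hv
  have hvn : ‖v‖ ≤ K := by
    rw [hv, norm_smul, Real.norm_of_nonneg (by positivity)]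
    rw [div_mul_eq_mul_div, one_mul, div_le_iff₀ (by positivity)]
    have : 2 * H * K ≤ K * (4 * H ^ 2) := by
      nlinarith [mul_nonneg (by linarith : (0 : ℝ) ≤ K) (by nlinarith : (0 : ℝ) ≤ H * H - H)]
    linarith
  obtain ⟨u, huU, hu⟩ := hnet v.ofLp fun i => by
    have := PiLp.norm_apply_le v i
    rw [Real.norm_eq_abs] at this
    exact this.trans hvn
  set δ : EuclideanSpace ℝ (Fin d) := v - WithLp.toLp 2 u with hδ
  have hδn : ‖δ‖ ≤ 1 / (4 * K * H) := by
    have h1 : ‖δ‖ ≤ ∑ i : Fin d, |δ i| := by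
      rw [EuclideanSpace.norm_eq]
      apply Real.sqrt_le_iff.2 ⟨Finset.sum_nonneg fun _ _ => abs_nonneg _, ?_⟩
      simp only [Real.norm_eq_abs]
      exact Finset.sum_sq_le_sq_sum_of_nonneg fun _ _ => abs_nonneg _
    have h2 : ∑ i : Fin d, |δ i| ≤ ∑ i : Fin d, 1 / (4 * d * K * H) :=
      Finset.sum_le_sum fun i _ => by simpa [hδ] using hu i
    refine (h1.trans h2).trans ?_
    rw [Finset.sum_const, Finset.card_univ, Fintype.card_fin, nsmul_eq_mul]
    rcases Nat.eq_zero_or_pos d with h0 | h0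
    · rw [h0]; simp; positivity
    · have : (0 : ℝ) < d := by exact_mod_cast h0
      apply le_of_eq
      field_simp
  have hfu := hU u huU
  have husplit : ∀ y : EuclideanSpace ℝ (Fin d), u ⬝ᵥ y.ofLp = v.ofLp ⬝ᵥ y.ofLp - inner ℝ δ y := by
    intro y
    rw [inner_eq_dotProduct, ← sub_dotProduct, hδ]
    congr 1
    ext i; simp
  -- the quadratic term of the net point is at most twice that of `v` plus a small error
  have hquadu : ∑ τ ∈ Finset.Ico 1 k, (u ⬝ᵥ (φ (z τ)).ofLp) ^ 2 ≤
      q / (8 * H ^ 4) + 2 * (K * (1 / (4 * K * H)) ^ 2) := by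
    have h1 : ∑ τ ∈ Finset.Ico 1 k, (u ⬝ᵥ (φ (z τ)).ofLp) ^ 2 ≤
        ∑ τ ∈ Finset.Ico 1 k, (2 * (1 / (4 * H ^ 2)) ^ 2 * (w.ofLp ⬝ᵥ (φ (z τ)).ofLp) ^ 2 +
          2 * (1 / (4 * K * H)) ^ 2) := by
      refine Finset.sum_le_sum fun τ _ => ?_
      rw [husplit]
      have h2 : |inner ℝ δ (φ (z τ))| ≤ 1 / (4 * K * H) := by
        refine (abs_real_inner_le_norm _ _).trans ?_
        calc ‖δ‖ * ‖φ (z τ)‖ ≤ (1 / (4 * K * H)) * 1 :=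
              mul_le_mul hδn (hφ _) (norm_nonneg _) (by positivity)
          _ = _ := mul_one _
      have h3 : (inner ℝ δ (φ (z τ))) ^ 2 ≤ (1 / (4 * K * H)) ^ 2 := by
        rw [← sq_abs]; gcongr
      have h4 : v.ofLp ⬝ᵥ (φ (z τ)).ofLp = 1 / (4 * H ^ 2) * (w.ofLp ⬝ᵥ (φ (z τ)).ofLp) := by
        rw [hv]; simp [smul_dotProduct]
      rw [h4]
      nlinarith [sq_nonneg (1 / (4 * H ^ 2) * (w.ofLp ⬝ᵥ (φ (z τ)).ofLp) + inner ℝ δ (φ (z τ)))]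
    refine h1.trans ?_
    rw [Finset.sum_add_distrib, ← Finset.mul_sum, Finset.sum_const, nsmul_eq_mul, Nat.card_Ico]
    have h5 : ∑ τ ∈ Finset.Ico 1 k, (w.ofLp ⬝ᵥ (φ (z τ)).ofLp) ^ 2 ≤ q := by
      nlinarith [sq_nonneg ‖w‖]
    have h6 : ((k - 1 : ℕ) : ℝ) ≤ K := by exact_mod_cast (by omega)
    have h7 : 2 * (1 / (4 * H ^ 2)) ^ 2 * q = q / (8 * H ^ 4) := by
      field_simp; ring
    rw [← h7]
    have h8 : 0 ≤ 2 * (1 / (4 * (K:ℝ) * H)) ^ 2 := by positivity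
    have h9 := mul_le_mul_of_nonneg_right h6 h8
    have h10 := mul_le_mul_of_nonneg_left h5 (by positivity : 0 ≤ 2 * (1 / (4 * H ^ 2)) ^ 2)
    linarith
  have hlin : ∑ τ ∈ Finset.Ico 1 k, (u ⬝ᵥ (φ (z τ)).ofLp) * e τ = u ⬝ᵥ s.ofLp := by
    rw [← hs', dotProduct_sum]
    exact Finset.sum_congr rfl fun τ _ => by rw [dotProduct_smul, smul_eq_mul, mul_comm]
  rw [Finset.sum_sub_distrib, ← Finset.mul_sum, hlin, husplit] at hfu
  have hvs : v.ofLp ⬝ᵥ s.ofLp = q / (4 * H ^ 2) := by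
    have : v.ofLp ⬝ᵥ s.ofLp = 1 / (4 * H ^ 2) * (w.ofLp ⬝ᵥ s.ofLp) := by
      rw [hv]; simp [smul_dotProduct]
    rw [this, hw, dotProduct_comm]
    simp only
    rw [← hq]; ring
  have hδs : inner ℝ δ s ≤ 1 / 2 := by
    refine (real_inner_le_norm _ _).trans ?_
    calc ‖δ‖ * ‖s‖ ≤ 1 / (4 * K * H) * (2 * H * K) :=
          mul_le_mul hδn hsn (norm_nonneg _) (by positivity)
      _ = 1 / 2 := by field_simp; norm_num
  have hA : H ^ 2 / 2 * ∑ τ ∈ Finset.Ico 1 k, (u ⬝ᵥ (φ (z τ)).ofLp) ^ 2 ≤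
      q / (16 * H ^ 2) + 1 / 16 := by
    calc H ^ 2 / 2 * ∑ τ ∈ Finset.Ico 1 k, (u ⬝ᵥ (φ (z τ)).ofLp) ^ 2
        ≤ H ^ 2 / 2 * (q / (8 * H ^ 4) + 2 * (K * (1 / (4 * K * H)) ^ 2)) := by gcongr
      _ = q / (16 * H ^ 2) + 1 / (16 * K) := by field_simp; ring
      _ ≤ _ := by
          gcongr
          linarith
  rw [hvs] at hfu
  have hB : q / (4 * H ^ 2) = 4 * (q / (16 * H ^ 2)) := by field_simp; norm_num
  have hC : q / (16 * H ^ 2) ≤ (Γ + 1) / 3 := by linarith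
  rw [div_le_iff₀ (by positivity)] at hC
  nlinarith

end Gram

/-! ### Exponential supermartingales -/

section Concentration

/-- Hoeffding's lemma as a bound on a Lebesgue integral. -/
theorem lintegral_exp_centered_le_one {E : Type*} [MeasurableSpace E] (ν : Measure E)
    [IsProbabilityMeasure ν] {f : E → ℝ} (hf : Measurable f) {B : ℝ} (hB : ∀ y, |f y| ≤ B)
    (t : ℝ) :
    ∫⁻ y, ENNReal.ofReal (Real.exp (t * (f y - ∫ y, f y ∂ν) - t ^ 2 * B ^ 2 / 2)) ∂ν ≤ 1 := by
  have hB0 : 0 ≤ B := by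
    obtain ⟨y⟩ : Nonempty E := nonempty_of_isProbabilityMeasure ν
    exact (abs_nonneg _).trans (hB y)
  have h := hasSubgaussianMGF_of_mem_Icc (μ := ν) (a := -B) (b := B) hf.aemeasurable
    (Filter.Eventually.of_forall fun y => abs_le.1 (hB y))
  have hc : (((‖B - -B‖₊ / 2) ^ 2 : NNReal) : ℝ) = B ^ 2 := by
    push_cast
    rw [Real.norm_eq_abs, div_pow, sq_abs]
    ring
  have h1 := h.mgf_le t
  rw [hc, mgf] at h1
  have h2 := h.integrable_exp_mul t
  have h3 : ∀ y, Real.exp (t * (f y - ∫ y, f y ∂ν) - t ^ 2 * B ^ 2 / 2) =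
      Real.exp (t * (f y - ∫ y, f y ∂ν)) * Real.exp (- (t ^ 2 * B ^ 2 / 2)) := by
    intro y; rw [← Real.exp_add]; congr 1
  simp_rw [h3]
  rw [← ofReal_integral_eq_lintegral_ofReal (h2.mul_const _)
    (Filter.Eventually.of_forall fun y => by positivity), integral_mul_const]
  rw [ENNReal.ofReal_le_one]
  calc _ ≤ Real.exp (B ^ 2 * t ^ 2 / 2) * Real.exp (- (t ^ 2 * B ^ 2 / 2)) := by gcongr
    _ = 1 := by
      rw [← Real.exp_add]
      convert Real.exp_zero using 2
      ring

variable {Ω E : Type*} {m0 : MeasurableSpace Ω} [MeasurableSpace E]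

theorem lintegral_disintegration {Ω' : Type*} [MeasurableSpace Ω'] (P : Measure Ω)
    [IsProbabilityMeasure P] {g : Ω → Ω'} (hg : Measurable g) {X : Ω → E} (hX : Measurable X)
    (κ : Kernel Ω' E) [IsMarkovKernel κ]
    (hlaw : ∀ C B, MeasurableSet C → MeasurableSet B →
      P (g ⁻¹' C ∩ X ⁻¹' B) = ∫⁻ ω in g ⁻¹' C, κ (g ω) B ∂P)
    {f : Ω' × E → ENNReal} (hf : Measurable f) :
    ∫⁻ ω, f (g ω, X ω) ∂P = ∫⁻ ω, ∫⁻ y, f (g ω, y) ∂(κ (g ω)) ∂P := by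
  have : IsProbabilityMeasure (P.map g) := Measure.isProbabilityMeasure_map hg.aemeasurable
  have heq : P.map (fun ω => (g ω, X ω)) = (P.map g) ⊗ₘ κ := by
    have : IsProbabilityMeasure (P.map (fun ω => (g ω, X ω))) :=
      Measure.isProbabilityMeasure_map (hg.prodMk hX).aemeasurable
    refine Measure.ext_prod fun {C B} hC hB => ?_
    rw [Measure.compProd_apply_prod hC hB, setLIntegral_map hC (κ.measurable_coe hB) hg,
      ← hlaw C B hC hB,
      Measure.map_apply (hg.prodMk hX) (hC.prod hB)]
    rfl
  rw [← lintegral_map hf (hg.prodMk hX), heq, Measure.lintegral_compProd hf,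
    lintegral_map hf.lintegral_kernel_prod_right' hg]

/-- If `κ` is the conditional law of `X` given the sub-σ-algebra `m`, then `X` can be integrated
out against `κ` in any jointly measurable function that depends on the rest through `m` only. -/
theorem lintegral_of_condLaw (P : Measure Ω) [IsProbabilityMeasure P]
    {X : Ω → E} (hX : Measurable X) {m : MeasurableSpace Ω} (hm : m ≤ m0)
    (κ : @Kernel Ω E m _) [@IsMarkovKernel Ω E m _ κ]
    (hlaw : ∀ B, MeasurableSet B → P[Set.indicator (X ⁻¹' B) (fun _ => (1 : ℝ)) | m] =ᵐ[P]
      fun ω => (κ ω).real B)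
    {f : Ω × E → ENNReal} (hf : @Measurable _ _ (m.prod inferInstance) _ f) :
    ∫⁻ ω, f (ω, X ω) ∂P = ∫⁻ ω, ∫⁻ y, f (ω, y) ∂(κ ω) ∂P := by
  refine @lintegral_disintegration Ω E m0 _ Ω m P _ id (measurable_id'' hm) X hX κ _ ?_ f hf
  intro C B hC hB
  have hκ : ∀ ω, IsProbabilityMeasure (κ ω) := fun ω => inferInstance
  have hmeas : Measurable[m] (fun ω => κ ω B) := by
    exact @Kernel.measurable_coe Ω E m _ κ B hB
  have hXB : MeasurableSet[m0] (X ⁻¹' B) := hX hB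
  have hC0 : MeasurableSet[m0] C := hm _ hC
  have hint : Integrable (Set.indicator (X ⁻¹' B) (fun _ => (1 : ℝ))) P :=
    (integrable_const 1).indicator hXB
  have h1 := setIntegral_condExp hm hint hC
  rw [setIntegral_congr_ae hC0 ((hlaw B hB).mono fun ω h _ => h), setIntegral_indicator hXB] at h1
  simp only [integral_const, MeasurableSet.univ, measureReal_restrict_apply, Set.univ_inter,
    smul_eq_mul, mul_one] at h1
  have h2 : ∫⁻ ω in C, κ ω B ∂P = ENNReal.ofReal (∫ ω in C, (κ ω).real B ∂P) := by
    have hmeas0 : Measurable[m0] (fun ω => κ ω B) := hmeas.mono hm le_rfl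
    rw [ofReal_integral_eq_lintegral_ofReal]
    · refine lintegral_congr fun ω => ?_
      rw [ofReal_measureReal]
    · refine Integrable.of_bound (C := 1)
        (Measurable.aestronglyMeasurable (m := m0) hmeas0.ennreal_toReal) ?_
      refine Filter.Eventually.of_forall fun ω => ?_
      rw [Real.norm_of_nonneg measureReal_nonneg]
      exact measureReal_le_one
    · exact Filter.Eventually.of_forall fun ω => measureReal_nonneg
  change P (C ∩ X ⁻¹' B) = ∫⁻ ω in C, κ ω B ∂P
  rw [h2, h1, ofReal_measureReal]

/-- One step of an exponential supermartingale: if the conditional law of `X` given `m` makes the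
conditional expectation of `exp f` at most one, then `exp f` does not increase integrals of
nonnegative `m`-measurable weights. -/
theorem lintegral_mul_exp_le (P : Measure Ω) [IsProbabilityMeasure P]
    {X : Ω → E} (hX : Measurable X) {m : MeasurableSpace Ω} (hm : m ≤ m0)
    (κ : @Kernel Ω E m _) [@IsMarkovKernel Ω E m _ κ]
    (hlaw : ∀ B, MeasurableSet B → P[Set.indicator (X ⁻¹' B) (fun _ => (1 : ℝ)) | m] =ᵐ[P]
      fun ω => (κ ω).real B)
    {f : Ω × E → ℝ} (hf : @Measurable _ _ (m.prod inferInstance) _ f)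
    (hle : ∀ ω, ∫⁻ y, ENNReal.ofReal (Real.exp (f (ω, y))) ∂(κ ω) ≤ 1)
    {W : Ω → ENNReal} (hW : Measurable[m] W) :
    ∫⁻ ω, W ω * ENNReal.ofReal (Real.exp (f (ω, X ω))) ∂P ≤ ∫⁻ ω, W ω ∂P := by
  have hfe : @Measurable _ _ (m.prod inferInstance) _
      (fun q : Ω × E => ENNReal.ofReal (Real.exp (f q))) :=
    ENNReal.measurable_ofReal.comp (Real.measurable_exp.comp hf)
  have hg : @Measurable _ _ (m.prod inferInstance) _
      (fun q : Ω × E => W q.1 * ENNReal.ofReal (Real.exp (f q))) :=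
    (hW.comp (@measurable_fst Ω E m _)).mul hfe
  rw [lintegral_of_condLaw P hX hm κ hlaw hg]
  refine lintegral_mono fun ω => ?_
  have hs : Measurable (fun y => ENNReal.ofReal (Real.exp (f (ω, y)))) :=
    hfe.comp (@measurable_prodMk_left Ω E m _ ω)
  simp only
  rw [lintegral_const_mul _ hs]
  calc W ω * _ ≤ W ω * 1 := by gcongr; exact hle ω
    _ = W ω := mul_one _

theorem lintegral_exp_sum_le_one (P : Measure Ω) [IsProbabilityMeasure P]
    (ℱ : ℕ → MeasurableSpace Ω) (hmono : ∀ τ, 1 ≤ τ → ℱ τ ≤ ℱ (τ + 1)) (Y : ℕ → Ω → ℝ) (n : ℕ)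
    (hmeas : ∀ τ ∈ Finset.Ico 1 n, Measurable[ℱ (τ + 1)] (Y τ))
    (hstep : ∀ τ ∈ Finset.Ico 1 n, ∀ W : Ω → ENNReal, Measurable[ℱ τ] W →
      ∫⁻ ω, W ω * ENNReal.ofReal (Real.exp (Y τ ω)) ∂P ≤ ∫⁻ ω, W ω ∂P) :
    ∫⁻ ω, ENNReal.ofReal (Real.exp (∑ τ ∈ Finset.Ico 1 n, Y τ ω)) ∂P ≤ 1 := by
  suffices h : ∀ k, 1 ≤ k → k ≤ n →
      Measurable[ℱ k] (fun ω => ∑ τ ∈ Finset.Ico 1 k, Y τ ω) ∧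
      ∫⁻ ω, ENNReal.ofReal (Real.exp (∑ τ ∈ Finset.Ico 1 k, Y τ ω)) ∂P ≤ 1 by
    rcases Nat.lt_or_ge n 1 with h0 | h0
    · have : n = 0 := by omega
      subst this
      simp
    · exact (h n h0 le_rfl).2
  intro k hk
  induction k, hk using Nat.le_induction with
  | base =>
    intro _
    simp
  | succ k hk ih =>
    intro hkn
    obtain ⟨h1, h2⟩ := ih (by omega)
    have hmem : k ∈ Finset.Ico 1 n := by simp; omega
    simp_rw [Finset.sum_Ico_succ_top hk]
    refine ⟨(h1.mono (hmono k hk) le_rfl).add (hmeas k hmem), ?_⟩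
    simp_rw [Real.exp_add, ENNReal.ofReal_mul (Real.exp_pos _).le]
    refine (hstep k hmem _ ?_).trans h2
    exact ENNReal.measurable_ofReal.comp (Real.measurable_exp.comp h1)

/-- Chernoff bound for a sum of increments that form an exponential supermartingale. -/
theorem measure_sum_gt_le (P : Measure Ω) [IsProbabilityMeasure P]
    (ℱ : ℕ → MeasurableSpace Ω) (hle : ∀ τ, ℱ τ ≤ m0) (hmono : ∀ τ, 1 ≤ τ → ℱ τ ≤ ℱ (τ + 1))
    (Y : ℕ → Ω → ℝ) (n : ℕ)
    (hmeas : ∀ τ ∈ Finset.Ico 1 n, Measurable[ℱ (τ + 1)] (Y τ))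
    (hstep : ∀ τ ∈ Finset.Ico 1 n, ∀ W : Ω → ENNReal, Measurable[ℱ τ] W →
      ∫⁻ ω, W ω * ENNReal.ofReal (Real.exp (Y τ ω)) ∂P ≤ ∫⁻ ω, W ω ∂P) (Γ : ℝ) :
    P {ω | Γ < ∑ τ ∈ Finset.Ico 1 n, Y τ ω} ≤ ENNReal.ofReal (Real.exp (-Γ)) := by
  have h := lintegral_exp_sum_le_one P ℱ hmono Y n hmeas hstep
  have hm : Measurable (fun ω => ∑ τ ∈ Finset.Ico 1 n, Y τ ω) :=
    Finset.measurable_sum _ fun τ hτ => (hmeas τ hτ).mono (hle _) le_rfl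
  have hm' := ENNReal.measurable_ofReal.comp (Real.measurable_exp.comp hm)
  have h1 := mul_meas_ge_le_lintegral (μ := P) hm' (ENNReal.ofReal (Real.exp Γ))
  have h2 : P {ω | Γ < ∑ τ ∈ Finset.Ico 1 n, Y τ ω} ≤
      P {ω | ENNReal.ofReal (Real.exp Γ) ≤
        (ENNReal.ofReal ∘ Real.exp ∘ fun ω => ∑ τ ∈ Finset.Ico 1 n, Y τ ω) ω} := by
    refine measure_mono fun ω hω => ?_
    exact ENNReal.ofReal_le_ofReal (Real.exp_le_exp.2 (le_of_lt hω))
  rw [Real.exp_neg, ENNReal.ofReal_inv_of_pos (Real.exp_pos _)]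
  rw [← one_div, ENNReal.le_div_iff_mul_le (Or.inl (by simpa using Real.exp_pos Γ))
    (Or.inl ENNReal.ofReal_ne_top), mul_comm]
  refine (mul_le_mul_right h2 _).trans (h1.trans ?_)
  exact h

end Concentration

/-! ### Nets and the covering number of the Q-function class -/

section Covering

/-- Grid net of a box for the sup distance. -/
theorem exists_box_net {I : Type*} [Fintype I] {R η : ℝ} (hη : 0 < η) {m : ℕ}
    (hm : R ≤ η * m) :
    ∃ U : Finset (I → ℝ), U.card ≤ (2 * m + 1) ^ Fintype.card I ∧
      ∀ v : I → ℝ, (∀ i, |v i| ≤ R) → ∃ u ∈ U, ∀ i, |v i - u i| ≤ η := by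
  classical
  refine ⟨Fintype.piFinset fun _ => (Finset.Icc (-(m : ℤ)) m).image fun n : ℤ => η * n, ?_, ?_⟩
  · rw [Fintype.card_piFinset, Finset.prod_const, Finset.card_univ]
    gcongr
    refine Finset.card_image_le.trans ?_
    rw [Int.card_Icc]
    omega
  · intro v hv
    refine ⟨fun i => η * (round (v i / η) : ℤ), ?_, ?_⟩
    · rw [Fintype.mem_piFinset]
      intro i
      refine Finset.mem_image_of_mem _ ?_
      rw [Finset.mem_Icc]
      have h1 : |v i / η| ≤ m := by
        rw [abs_div, abs_of_pos hη, div_le_iff₀ hη, mul_comm]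
        exact (hv i).trans hm
      obtain ⟨h2, h3⟩ := abs_le.1 h1
      have h4 := abs_sub_round (v i / η)
      obtain ⟨h5, h6⟩ := abs_le.1 h4
      constructor
      · have : (-(m : ℤ) - 1 : ℝ) < (round (v i / η) : ℤ) := by push_cast; linarith
        have : -(m : ℤ) - 1 < round (v i / η) := by exact_mod_cast this
        omega
      · have : ((round (v i / η) : ℤ) : ℝ) < ((m : ℤ) + 1 : ℤ) := by push_cast; linarith
        have : round (v i / η) < (m : ℤ) + 1 := by exact_mod_cast this
        omega
    · intro i
      have h4 := abs_sub_round (v i / η)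
      have h5 : v i - η * (round (v i / η) : ℤ) = η * (v i / η - round (v i / η)) := by
        field_simp
      rw [h5, abs_mul, abs_of_pos hη]
      nlinarith

/-- A class of functions that is parametrized by finitely many cells of small diameter has a small
covering by its own members. -/
theorem exists_isSupCover_of_cells {X L : Type*} (𝒬 : Set (X → ℝ)) (ε : ℝ) (cells : Finset L)
    (r : (X → ℝ) → L → Prop) (hr : ∀ q ∈ 𝒬, ∃ l ∈ cells, r q l)
    (hclose : ∀ q ∈ 𝒬, ∀ q' ∈ 𝒬, ∀ l, r q l → r q' l → ∀ s, |q' s - q s| ≤ ε) :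
    ∃ N, IsSupCover 𝒬 ε N ∧ N.encard ≤ cells.card := by
  classical
  rcases 𝒬.eq_empty_or_nonempty with h0 | ⟨q0, hq0⟩
  · refine ⟨∅, ⟨by simp, by simp [h0]⟩, by simp⟩
  let f : L → (X → ℝ) := fun l =>
    if h : ∃ q ∈ 𝒬, r q l then h.choose else q0
  have hf : ∀ l, f l ∈ 𝒬 := by
    intro l
    by_cases h : ∃ q ∈ 𝒬, r q l
    · simp only [f, dif_pos h]; exact h.choose_spec.1
    · simp only [f, dif_neg h]; exact hq0
  refine ⟨f '' cells, ⟨?_, ?_⟩, ?_⟩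
  · rintro _ ⟨l, _, rfl⟩; exact hf l
  · intro q hq
    obtain ⟨l, hl, hrl⟩ := hr q hq
    refine ⟨f l, ⟨l, hl, rfl⟩, ?_⟩
    have h : ∃ q ∈ 𝒬, r q l := ⟨q, hq, hrl⟩
    refine hclose q hq (f l) (hf l) l hrl ?_
    simp only [f, dif_pos h]; exact h.choose_spec.2
  · refine (Set.encard_image_le _ _).trans ?_
    rw [Set.encard_coe_eq_coe_finsetCard]

theorem abs_clip_sub_clip_le (H u v : ℝ) : |clip H u - clip H v| ≤ |u - v| := by
  unfold clip
  calc _ ≤ |min u H - min v H| := by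
        simpa using abs_max_sub_max_le_abs (min u H) (min v H) (-H)
    _ ≤ _ := by
        have := abs_min_sub_min_le_max u H v H
        simpa using this

theorem abs_sqrt_sub_sqrt_le {a b : ℝ} (ha : 0 ≤ a) (hb : 0 ≤ b) : |√a - √b| ≤ √|a - b| := by
  apply Real.abs_le_sqrt
  rw [sub_sq, Real.sq_sqrt ha, Real.sq_sqrt hb]
  rcases le_total a b with h | h
  · rw [abs_of_nonpos (by linarith)]
    have : a ≤ √a * √b := by
      calc a = √a * √a := (Real.mul_self_sqrt ha).symm
        _ ≤ _ := by gcongr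
    linarith
  · rw [abs_of_nonneg (by linarith)]
    have : b ≤ √a * √b := by
      calc b = √b * √b := (Real.mul_self_sqrt hb).symm
        _ ≤ _ := by gcongr
    linarith

variable {S A : Type*} {d : ℕ} {φ : S × A × A → EuclideanSpace ℝ (Fin d)}

theorem abs_feature_le_one (hφ : ∀ s, ‖φ s‖ ≤ 1) (s : S × A × A) (i : Fin d) : |φ s i| ≤ 1 := by
  have := PiLp.norm_apply_le (φ s) i
  rw [Real.norm_eq_abs] at this
  exact this.trans (hφ s)

theorem abs_inner_sub_le (hφ : ∀ s, ‖φ s‖ ≤ 1) {w w' : EuclideanSpace ℝ (Fin d)} {η : ℝ}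
    (h : ∀ i, |w i - w' i| ≤ η) (s : S × A × A) :
    |inner ℝ w (φ s) - inner ℝ w' (φ s)| ≤ d * η := by
  rw [← inner_sub_left, inner_eq_dotProduct]
  simp only [dotProduct]
  calc _ ≤ ∑ i, |(w - w').ofLp i * φ s i| := Finset.abs_sum_le_sum_abs _ _
    _ ≤ ∑ _i : Fin d, η := by
        refine Finset.sum_le_sum fun i _ => ?_
        rw [abs_mul]
        have h1 := h i
        have h2 := abs_feature_le_one hφ s i
        have h3 : |(w - w').ofLp i| ≤ η := by simpa using h1
        nlinarith [abs_nonneg ((w - w').ofLp i), abs_nonneg (φ s i)]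
    _ = _ := by simp

theorem abs_quad_sub_le (hφ : ∀ s, ‖φ s‖ ≤ 1) {M M' : Matrix (Fin d) (Fin d) ℝ} {η : ℝ}
    (h : ∀ i j, |M i j - M' i j| ≤ η) (s : S × A × A) :
    |(φ s).ofLp ⬝ᵥ M *ᵥ (φ s).ofLp - (φ s).ofLp ⬝ᵥ M' *ᵥ (φ s).ofLp| ≤ (d : ℝ) ^ 2 * η := by
  rw [← dotProduct_sub, ← Matrix.sub_mulVec]
  simp only [dotProduct, Matrix.mulVec, Finset.mul_sum]
  calc _ ≤ ∑ i, |∑ j, φ s i * ((M - M') i j * φ s j)| := Finset.abs_sum_le_sum_abs _ _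
    _ ≤ ∑ i, ∑ j, |φ s i * ((M - M') i j * φ s j)| :=
        Finset.sum_le_sum fun i _ => Finset.abs_sum_le_sum_abs _ _
    _ ≤ ∑ _i : Fin d, ∑ _j : Fin d, η := by
        refine Finset.sum_le_sum fun i _ => Finset.sum_le_sum fun j _ => ?_
        rw [abs_mul, abs_mul]
        have h1 : |(M - M') i j| ≤ η := by simpa using h i j
        have h2 := abs_feature_le_one hφ s i
        have h3 := abs_feature_le_one hφ s j
        have h4 : |(M - M') i j| * |φ s j| ≤ η := by
          nlinarith [abs_nonneg ((M - M') i j), abs_nonneg (φ s j)]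
        have h5 : 0 ≤ |(M - M') i j| * |φ s j| := by positivity
        nlinarith [abs_nonneg (φ s i)]
    _ = _ := by simp; ring

theorem abs_linBonus_sub_le (hφ : ∀ s, ‖φ s‖ ≤ 1) {H β : ℝ} (hβ : 0 ≤ β)
    {w w' : EuclideanSpace ℝ (Fin d)} {M M' : Matrix (Fin d) (Fin d) ℝ} {ρ η η' : ℝ}
    (hρ : ρ = 1 ∨ ρ = -1) (hw : ∀ i, |w i - w' i| ≤ η) (hM : ∀ i j, |M i j - M' i j| ≤ η')
    (h0 : ∀ s, 0 ≤ (φ s).ofLp ⬝ᵥ M *ᵥ (φ s).ofLp) (h0' : ∀ s, 0 ≤ (φ s).ofLp ⬝ᵥ M' *ᵥ (φ s).ofLp)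
    (s : S × A × A) :
    |linBonus φ H β w M ρ s - linBonus φ H β w' M' ρ s| ≤ d * η + β * √((d : ℝ) ^ 2 * η') := by
  unfold linBonus
  refine (abs_clip_sub_clip_le _ _ _).trans ?_
  set a := (φ s).ofLp ⬝ᵥ M *ᵥ (φ s).ofLp
  set b := (φ s).ofLp ⬝ᵥ M' *ᵥ (φ s).ofLp
  have h1 : inner ℝ w (φ s) + ρ * β * √a - (inner ℝ w' (φ s) + ρ * β * √b) =
      (inner ℝ w (φ s) - inner ℝ w' (φ s)) + ρ * (β * (√a - √b)) := by ring
  rw [h1]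
  refine (abs_add_le _ _).trans (add_le_add (abs_inner_sub_le hφ hw s) ?_)
  have hρ1 : |ρ| = 1 := by rcases hρ with h | h <;> simp [h]
  rw [abs_mul, hρ1, one_mul, abs_mul, abs_of_nonneg hβ]
  gcongr
  exact (abs_sqrt_sub_sqrt_le (h0 s) (h0' s)).trans (Real.sqrt_le_sqrt (abs_quad_sub_le hφ hM s))

/-- The covering number of the Q-function class is bounded by the number of cells of a grid in the
space of parameters `(w, M, ρ)`. -/
theorem encard_qClass_cover_le (hφ : ∀ s, ‖φ s‖ ≤ 1) {H β ε : ℝ} (hβ : 0 ≤ β) {k : ℕ}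
    {N : Set (S × A × A → ℝ)} (hN : IsMinSupCover (qClass φ H β k) ε N)
    {η η' : ℝ} (hη : 0 < η) (hη' : 0 < η')
    (hε : d * (2 * η) + β * √((d : ℝ) ^ 2 * (2 * η')) ≤ ε) {m m' : ℕ}
    (hm : 2 * H * √(d * k) ≤ η * m) (hm' : β ^ 2 * √d ≤ η' * m') :
    N.encard ≤ (2 * ((2 * m + 1) ^ d * (2 * m' + 1) ^ (d * d)) : ℕ) := by
  classical
  obtain ⟨U, hU, hnU⟩ := exists_box_net (I := Fin d) hη hm
  obtain ⟨U', hU', hnU'⟩ := exists_box_net (I := Fin d × Fin d) hη' hm'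
  rw [Fintype.card_fin] at hU
  rw [Fintype.card_prod, Fintype.card_fin] at hU'
  let cells : Finset (Bool × (Fin d → ℝ) × (Fin d × Fin d → ℝ)) := Finset.univ ×ˢ U ×ˢ U'
  have hcov : ∃ N', IsSupCover (qClass φ H β k) ε N' ∧ N'.encard ≤ cells.card := by
    refine exists_isSupCover_of_cells (qClass φ H β k) ε cells
      (fun q l => ∃ (w : EuclideanSpace ℝ (Fin d)) (M : Matrix (Fin d) (Fin d) ℝ),
        (∀ s, 0 ≤ (φ s).ofLp ⬝ᵥ M *ᵥ (φ s).ofLp) ∧ (∀ i, |w i - l.2.1 i| ≤ η) ∧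
        (∀ i j, |M i j - l.2.2 (i, j)| ≤ η') ∧
        q = linBonus φ H β w M (if l.1 then 1 else -1)) ?_ ?_
    · rintro q ⟨w, M, ρ, hw, hM, h0, hρ, rfl⟩
      obtain ⟨u, hu, hwu⟩ := hnU w.ofLp fun i => by
        have := PiLp.norm_apply_le w i
        rw [Real.norm_eq_abs] at this
        exact this.trans hw
      obtain ⟨u', hu', hMu⟩ := hnU' (fun p => M p.1 p.2) fun p => by
        refine le_trans ?_ hM
        apply Real.abs_le_sqrt
        calc M p.1 p.2 ^ 2 ≤ ∑ j, M p.1 j ^ 2 :=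
              Finset.single_le_sum (f := fun j => M p.1 j ^ 2) (fun _ _ => sq_nonneg _)
                (Finset.mem_univ p.2)
          _ ≤ _ := Finset.single_le_sum (f := fun i => ∑ j, M i j ^ 2)
                (fun _ _ => Finset.sum_nonneg fun _ _ => sq_nonneg _) (Finset.mem_univ p.1)
      refine ⟨(decide (ρ = 1), u, u'), by simp [cells, hu, hu', em], w, M, h0, hwu,
        fun i j => hMu (i, j), ?_⟩
      rcases hρ with h | h
      · simp [h]
      · rw [h]; norm_num
    · rintro q _ q' _ l ⟨w, M, h0, hw, hM, rfl⟩ ⟨w', M', h0', hw', hM', rfl⟩ s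
      refine (abs_linBonus_sub_le hφ hβ ?_ (η := 2 * η) (η' := 2 * η') ?_ ?_ h0' h0 s).trans hε
      · by_cases h : l.1 <;> simp [h]
      · intro i
        have h1 := abs_le.1 (hw i)
        have h2 := abs_le.1 (hw' i)
        rw [abs_le]
        constructor <;> linarith
      · intro i j
        have h1 := abs_le.1 (hM i j)
        have h2 := abs_le.1 (hM' i j)
        rw [abs_le]
        constructor <;> linarith
  obtain ⟨N', hN', hcard⟩ := hcov
  refine (hN.2 N' hN').trans (hcard.trans ?_)
  simp only [cells]
  rw [Finset.card_product, Finset.card_product]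
  simp only [Finset.card_univ, Fintype.card_bool]
  gcongr

end Covering

/-! ### The Bellman equation -/

section Bellman

variable {S A : Type*} [MeasurableSpace S] [MeasurableSpace A]

namespace MarkovGame

variable (G : MarkovGame S A) (π ν : Policy S A)

/-- The law of the triple at step `h + n` given the triple at step `h`. -/
def iterKernel (h : ℕ) : ℕ → Kernel (S × A × A) (S × A × A)
  | 0 => Kernel.id
  | n + 1 => G.stepKernel π ν (h + n) ∘ₖ iterKernel h n

instance instMarkovIterKernel (h n : ℕ) : IsMarkovKernel (G.iterKernel π ν h n) := by
  induction n with
  | zero => unfold iterKernel; infer_instance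
  | succ n ih => unfold iterKernel; infer_instance

theorem iterKernel_succ' (h n : ℕ) :
    G.iterKernel π ν h (n + 1) = G.iterKernel π ν (h + 1) n ∘ₖ G.stepKernel π ν h := by
  induction n with
  | zero => simp [iterKernel, Kernel.comp_id, Kernel.id_comp]
  | succ n ih =>
    rw [iterKernel, ih, ← Kernel.comp_assoc, iterKernel]
    congr 2
    congr 1
    omega

/-- The marginals of the trajectory law are the iterated step kernels. -/
theorem trajLaw_map_eval (h n : ℕ) (s : S × A × A) :
    (G.trajLaw π ν h s).map (fun ω => ω (h + n)) = G.iterKernel π ν h n s := by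
  unfold trajLaw
  let ev : (m : ℕ) → ((i : Finset.Iic m) → (fun _ : ℕ => S × A × A) i) → S × A × A :=
    fun m ω => ω ⟨m, Finset.mem_Iic.2 le_rfl⟩
  have hev : ∀ m, Measurable (ev m) := fun m => measurable_pi_apply _
  have key : (Kernel.traj (X := fun _ => S × A × A) (G.histKernel π ν) h).map
      (fun ω => ω (h + n)) = (G.iterKernel π ν h n).comap (ev h) (hev h) := by
    have h1 : ∀ m, (Kernel.traj (X := fun _ => S × A × A) (G.histKernel π ν) h).map
        (fun ω => ω m) =
          (Kernel.partialTraj (X := fun _ => S × A × A) (G.histKernel π ν) h m).map (ev m) := by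
      intro m
      rw [← Kernel.traj_map_frestrictLe, ← Kernel.map_comp_right _
        (Preorder.measurable_frestrictLe m) (hev m)]
      rfl
    induction n with
    | zero =>
      rw [h1, iterKernel]
      change (Kernel.partialTraj (X := fun _ => S × A × A) (G.histKernel π ν) h h).map (ev h) = _
      ext x B hB
      rw [Kernel.map_apply' _ (hev _) _ hB, Kernel.comap_apply]
      rw [Kernel.partialTraj_self, Kernel.id_apply, Kernel.id_apply, Measure.dirac_apply' _ hB,
        Measure.dirac_apply' _ (hev _ hB)]
      rfl
    | succ n ih =>
      rw [h1] at ih ⊢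
      rw [← add_assoc]
      have h3 : (Kernel.partialTraj (X := fun _ => S × A × A) (G.histKernel π ν) (h + n)
          (h + n + 1)).map (ev (h + n + 1)) = G.histKernel π ν (h + n) :=
        Kernel.map_partialTraj_succ_self (h + n)
      rw [Kernel.partialTraj_succ_eq_comp (by omega), Kernel.map_comp, h3, iterKernel]
      ext x B hB
      rw [Kernel.comp_apply' _ _ _ hB, Kernel.comap_apply, Kernel.comp_apply' _ _ _ hB]
      rw [← Kernel.comap_apply (G.iterKernel π ν h n) (hev h) x, ← ih,
        Kernel.map_apply _ (hev _), lintegral_map (Kernel.measurable_coe _ hB) (hev _)]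
      rfl
  have h2 := congrArg (fun κ => κ (fun _ => s)) key
  simp only at h2
  rw [Kernel.map_apply _ (measurable_pi_apply _), Kernel.comap_apply] at h2
  exact h2

instance instProbTrajLaw (h : ℕ) (s : S × A × A) : IsProbabilityMeasure (G.trajLaw π ν h s) := by
  unfold trajLaw; infer_instance

theorem integrable_reward {α : Type*} [MeasurableSpace α] (m : Measure α) [IsFiniteMeasure m]
    (t : ℕ) {f : α → S × A × A} (hf : Measurable f) :
    Integrable (fun x => G.reward t (f x)) m :=
  Integrable.of_bound (C := 1) ((G.measurable_reward t).comp hf).aestronglyMeasurable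
    (Filter.Eventually.of_forall fun x => by simpa using G.abs_reward_le_one t (f x))

theorem qValue_eq_sum (h : ℕ) (s : S × A × A) :
    G.qValue π ν h s = ∑ n ∈ Finset.range (G.horizon + 1 - h),
      ∫ y, G.reward (h + n) y ∂(G.iterKernel π ν h n s) := by
  unfold qValue
  rw [integral_finsetSum _ fun t _ => G.integrable_reward _ t (measurable_pi_apply t)]
  rw [← Finset.Ico_add_one_right_eq_Icc, Finset.sum_Ico_eq_sum_range]
  refine Finset.sum_congr rfl fun n _ => ?_
  rw [← trajLaw_map_eval, integral_map (measurable_pi_apply _).aemeasurable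
    (G.measurable_reward _).aestronglyMeasurable]

theorem measurable_qValue (h : ℕ) : Measurable (G.qValue π ν h) := by
  have : G.qValue π ν h = fun s => ∑ n ∈ Finset.range (G.horizon + 1 - h),
      ∫ y, G.reward (h + n) y ∂(G.iterKernel π ν h n s) := funext (G.qValue_eq_sum π ν h)
  rw [this]
  refine Finset.measurable_sum _ fun n _ => ?_
  exact ((G.measurable_reward _).stronglyMeasurable.integral_kernel).measurable

theorem abs_qValue_le (h : ℕ) (s : S × A × A) :
    |G.qValue π ν h s| ≤ ((G.horizon + 1 - h : ℕ) : ℝ) := by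
  rw [qValue_eq_sum]
  refine (Finset.abs_sum_le_sum_abs _ _).trans ?_
  calc _ ≤ ∑ n ∈ Finset.range (G.horizon + 1 - h), (1 : ℝ) := by
        refine Finset.sum_le_sum fun n _ => ?_
        have := norm_integral_le_of_norm_le_const (μ := G.iterKernel π ν h n s)
          (f := G.reward (h + n)) (C := 1)
          (Filter.Eventually.of_forall fun x => by simpa using G.abs_reward_le_one _ x)
        simpa using this
    _ = _ := by simp

theorem integrable_qValue {α : Type*} [MeasurableSpace α] (m : Measure α) [IsFiniteMeasure m]
    (h : ℕ) {f : α → S × A × A} (hf : Measurable f) :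
    Integrable (fun x => G.qValue π ν h (f x)) m :=
  Integrable.of_bound (C := ((G.horizon + 1 - h : ℕ) : ℝ))
    ((G.measurable_qValue π ν h).comp hf).aestronglyMeasurable
    (Filter.Eventually.of_forall fun x => by simpa using G.abs_qValue_le π ν h (f x))

theorem value_eq_integral_prod_kernel (h : ℕ) (x : S) :
    G.value π ν h x = ∫ ab, G.qValue π ν h (x, ab) ∂(((π h).1 ×ₖ (ν h).1) x) := by
  rw [value, Kernel.prod_apply]

theorem measurable_value (h : ℕ) : Measurable (G.value π ν h) := by
  have : G.value π ν h = fun x => ∫ ab, G.qValue π ν h (x, ab) ∂(((π h).1 ×ₖ (ν h).1) x) :=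
    funext (G.value_eq_integral_prod_kernel π ν h)
  rw [this]
  exact ((G.measurable_qValue π ν h).stronglyMeasurable.integral_kernel_prod_right').measurable

theorem abs_value_le (h : ℕ) (x : S) : |G.value π ν h x| ≤ ((G.horizon + 1 - h : ℕ) : ℝ) := by
  have := norm_integral_le_of_norm_le_const (μ := ((π h).1 x).prod ((ν h).1 x))
    (f := fun ab => G.qValue π ν h (x, ab)) (C := ((G.horizon + 1 - h : ℕ) : ℝ))
    (Filter.Eventually.of_forall fun ab => by simpa using G.abs_qValue_le π ν h (x, ab))
  simpa [value] using this

theorem integral_stepKernel (h : ℕ) (s : S × A × A) :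
    ∫ y, G.qValue π ν (h + 1) y ∂(G.stepKernel π ν h s) =
      ∫ x, G.value π ν (h + 1) x ∂((G.trans h).1 s) := by
  unfold stepKernel
  rw [Kernel.integral_comp]
  · refine integral_congr_ae (Filter.Eventually.of_forall fun x => ?_)
    simp only
    rw [Kernel.prod_apply, Kernel.id_apply]
    rw [integral_prod (G.qValue π ν (h + 1)) (G.integrable_qValue π ν _ _ measurable_id)]
    rw [integral_dirac', value_eq_integral_prod_kernel]
    exact ((G.measurable_qValue π ν _).stronglyMeasurable.integral_prod_right')
  · exact G.integrable_qValue π ν _ _ measurable_id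

/-- Bellman equation. -/
theorem qValue_eq (h : ℕ) (hh : h ≤ G.horizon) (s : S × A × A) :
    G.qValue π ν h s = G.reward h s + ∫ x, G.value π ν (h + 1) x ∂((G.trans h).1 s) := by
  rw [← integral_stepKernel, qValue_eq_sum]
  have : G.horizon + 1 - h = (G.horizon + 1 - (h + 1)) + 1 := by omega
  rw [this, Finset.sum_range_succ', add_comm]
  congr 1
  · simp only [add_zero, iterKernel]
    rw [Kernel.id_apply, integral_dirac' _ _ (G.measurable_reward h).stronglyMeasurable]
  · simp_rw [qValue_eq_sum]
    rw [integral_finsetSum]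
    · refine Finset.sum_congr rfl fun n _ => ?_
      rw [iterKernel_succ', Kernel.integral_comp]
      · congr 2
        ext1 y
        have : h + (n + 1) = h + 1 + n := by ring
        rw [this]
      · exact G.integrable_reward _ _ measurable_id
    · intro n _
      refine Integrable.of_bound (C := 1)
        ((G.measurable_reward _).stronglyMeasurable.integral_kernel).aestronglyMeasurable
        (Filter.Eventually.of_forall fun x => ?_)
      have := norm_integral_le_of_norm_le_const (μ := G.iterKernel π ν (h + 1) n x)
        (f := G.reward (h + 1 + n)) (C := 1)
        (Filter.Eventually.of_forall fun x => by simpa using G.abs_reward_le_one _ x)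
      simpa using this

theorem value_horizon_succ (x : S) : G.value π ν (G.horizon + 1) x = 0 := by
  have := G.abs_value_le π ν (G.horizon + 1) x
  simpa using this

end MarkovGame
end Bellman

/-! ### Linearity of the transition operator -/

section LinearTransition

/-- Integrals inherit a linear relation between measures. The coefficients may have both signs, so
the relation becomes an equality of measures only after the negative terms change sides. -/
theorem integral_eq_sum_of_measureReal_eq_sum {S J : Type*} [MeasurableSpace S] [Fintype J]
    (ρ : Measure S) [IsFiniteMeasure ρ] (ν : J → Measure S) [hν : ∀ j, IsFiniteMeasure (ν j)]
    (c : J → ℝ) (h : ∀ B, MeasurableSet B → ρ.real B = ∑ j, c j * (ν j).real B)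
    {V : S → ℝ} (hV : ∀ m : Measure S, IsFiniteMeasure m → Integrable V m) :
    ∫ x, V x ∂ρ = ∑ j, c j * ∫ x, V x ∂(ν j) := by
  have heq : ρ + ∑ j, (-c j).toNNReal • ν j = ∑ j, (c j).toNNReal • ν j := by
    ext B hB
    have h1 : ∀ m : Measure S, IsFiniteMeasure m → m B = ENNReal.ofReal (m.real B) :=
      fun m _ => by rw [ofReal_measureReal]
    have hfin : ∀ c : J → NNReal, IsFiniteMeasure (∑ j, c j • ν j) := fun c => inferInstance
    rw [h1 _ inferInstance, h1 _ (hfin _)]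
    congr 1
    have h2 : ∀ c : J → NNReal, (∑ j, c j • ν j : Measure S).real B =
        ∑ j, (c j : ℝ) * (ν j).real B := by
      intro c
      rw [measureReal_def, Measure.finsetSum_apply, ENNReal.toReal_sum]
      · refine Finset.sum_congr rfl fun j _ => ?_
        rw [Measure.smul_apply, ENNReal.smul_def, smul_eq_mul, ENNReal.toReal_mul]
        rfl
      · intro j _
        rw [Measure.smul_apply, ENNReal.smul_def, smul_eq_mul]
        exact ENNReal.mul_ne_top ENNReal.coe_ne_top (measure_ne_top _ _)
    rw [measureReal_add_apply, h2, h2, h B hB, ← Finset.sum_add_distrib]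
    refine Finset.sum_congr rfl fun j _ => ?_
    have := max_zero_sub_max_neg_zero_eq_self (c j)
    rw [Real.coe_toNNReal', Real.coe_toNNReal']
    linear_combination (-(ν j).real B) * this
  have h3 : ∀ c : J → NNReal, ∫ x, V x ∂(∑ j, c j • ν j) = ∑ j, (c j : ℝ) * ∫ x, V x ∂(ν j) := by
    intro c
    rw [integral_finsetSum_measure fun j _ => hV _ inferInstance]
    refine Finset.sum_congr rfl fun j _ => ?_
    rw [integral_smul_nnreal_measure]
    rfl
  have h4 := congrArg (fun m => ∫ x, V x ∂m) heq
  rw [integral_add_measure (hV _ inferInstance) (hV _ inferInstance), h3, h3] at h4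
  rw [← sub_eq_iff_eq_add.2 h4.symm, ← Finset.sum_sub_distrib]
  refine Finset.sum_congr rfl fun j _ => ?_
  have := max_zero_sub_max_neg_zero_eq_self (c j)
  rw [Real.coe_toNNReal', Real.coe_toNNReal', ← sub_mul, this]

theorem integrable_of_abs_le {α : Type*} [MeasurableSpace α] {V : α → ℝ} (hV : Measurable V)
    {B : ℝ} (hB : ∀ x, |V x| ≤ B) (m : Measure α) [IsFiniteMeasure m] : Integrable V m :=
  Integrable.of_bound (C := B) hV.aestronglyMeasurable (Filter.Eventually.of_forall fun x => hB x)

theorem abs_integral_le_of_abs_le {α : Type*} [MeasurableSpace α] {V : α → ℝ} {B : ℝ}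
    (hB : ∀ x, |V x| ≤ B) (m : Measure α) [IsFiniteMeasure m] :
    |∫ x, V x ∂m| ≤ B * m.real Set.univ :=
  norm_integral_le_of_norm_le_const (f := V) (Filter.Eventually.of_forall fun x => hB x)

theorem abs_integral_le_of_abs_le' {α : Type*} [MeasurableSpace α] {V : α → ℝ} {B : ℝ}
    (hB : ∀ x, |V x| ≤ B) (m : Measure α) [IsProbabilityMeasure m] : |∫ x, V x ∂m| ≤ B := by
  simpa using abs_integral_le_of_abs_le hB m

variable {S A : Type*} [MeasurableSpace S] [MeasurableSpace A] {G : MarkovGame S A} {d : ℕ}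
  {φ : S × A × A → EuclideanSpace ℝ (Fin d)} {θ : ℕ → EuclideanSpace ℝ (Fin d)}
  {μ : ℕ → Fin d → SignedMeasure S}

/-- Expected next values are linear in the features. The norm bound comes from the Jordan
decompositions: both parts of `μ h i` have mass at most `√d`, because each mass is `|μ h i B|` for a
set `B` of the Hahn decomposition. -/
theorem MarkovGame.IsLinear.exists_integral_trans_eq (hG : G.IsLinear φ θ μ) {h : ℕ}
    (hh : h ∈ Finset.Icc 1 G.horizon) {V : S → ℝ} (hV : Measurable V) {B : ℝ}
    (hB : ∀ x, |V x| ≤ B) (hB0 : 0 ≤ B) :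
    ∃ w : EuclideanSpace ℝ (Fin d), ‖w‖ ≤ 2 * d * B ∧
      ∀ s, ∫ x, V x ∂((G.trans h).1 s) = inner ℝ w (φ s) := by
  have hJ : ∀ i, ∃ pos neg : Measure S, IsFiniteMeasure pos ∧ IsFiniteMeasure neg ∧
      (∀ B, MeasurableSet B → μ h i B = pos.real B - neg.real B) ∧
      pos.real Set.univ ≤ √d ∧ neg.real Set.univ ≤ √d := by
    intro i
    set j := (μ h i).toJordanDecomposition with hj
    have hμ : ∀ B, MeasurableSet B → μ h i B = j.posPart.real B - j.negPart.real B := by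
      intro B hB
      conv_lhs => rw [← (μ h i).toSignedMeasure_toJordanDecomposition]
      rw [JordanDecomposition.toSignedMeasure, sub_apply,
        Measure.toSignedMeasure_apply_measurable hB, Measure.toSignedMeasure_apply_measurable hB]
    have hle : ∀ B, MeasurableSet B → |μ h i B| ≤ √d := by
      intro B hB
      refine le_trans ?_ (hG.norm_mu_le h hh B hB)
      have := PiLp.norm_apply_le (WithLp.toLp 2 (fun i => μ h i B)) i
      simpa using this
    refine ⟨j.posPart, j.negPart, inferInstance, inferInstance, hμ, ?_, ?_⟩
    · obtain ⟨t, ht, h1, h2⟩ := j.mutuallySingular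
      have h3 := hμ tᶜ ht.compl
      rw [measureReal_def j.negPart, h2] at h3
      have h4 := measureReal_add_measureReal_compl (μ := j.posPart) ht
      rw [measureReal_def j.posPart t, h1] at h4
      have h5 := (abs_le.1 (hle _ ht.compl)).2
      simp at h3 h4
      linarith
    · obtain ⟨t, ht, h1, h2⟩ := j.mutuallySingular
      have h3 := hμ t ht
      rw [measureReal_def j.posPart, h1] at h3
      have h4 := measureReal_add_measureReal_compl (μ := j.negPart) ht
      rw [measureReal_def j.negPart tᶜ, h2] at h4
      have h5 := (abs_le.1 (hle _ ht)).1
      simp at h3 h4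
      linarith
  choose pos neg hpos hneg hμ hp hn using hJ
  refine ⟨WithLp.toLp 2 fun i => ∫ x, V x ∂(pos i) - ∫ x, V x ∂(neg i), ?_, ?_⟩
  · rw [EuclideanSpace.norm_eq]
    apply Real.sqrt_le_iff.2 ⟨by positivity, ?_⟩
    have h1 : ∀ i ∈ (Finset.univ : Finset (Fin d)),
        ‖∫ x, V x ∂(pos i) - ∫ x, V x ∂(neg i)‖ ^ 2 ≤ (2 * B * √d) ^ 2 := by
      intro i _
      have h2 := abs_integral_le_of_abs_le hB (pos i)
      have h3 := abs_integral_le_of_abs_le hB (neg i)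
      have h4 := mul_le_mul_of_nonneg_left (hp i) hB0
      have h5 := mul_le_mul_of_nonneg_left (hn i) hB0
      have h6 := norm_sub_le (∫ x, V x ∂(pos i)) (∫ x, V x ∂(neg i))
      rw [Real.norm_eq_abs, Real.norm_eq_abs, Real.norm_eq_abs] at h6
      rw [Real.norm_eq_abs]
      gcongr
      linarith
    refine (Finset.sum_le_sum h1).trans (le_of_eq ?_)
    rw [Finset.sum_const, Finset.card_univ, Fintype.card_fin, nsmul_eq_mul, mul_pow,
      Real.sq_sqrt (by positivity)]
    ring
  · intro s
    have h1 := integral_eq_sum_of_measureReal_eq_sum (J := Fin d ⊕ Fin d) ((G.trans h).1 s)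
      (Sum.elim pos neg) (hν := by rintro (i | i) <;> simp <;> infer_instance)
      (Sum.elim (fun i => φ s i) (fun i => - φ s i)) ?_ (V := V)
      (fun m _ => integrable_of_abs_le hV hB m)
    · rw [h1, Fintype.sum_sum_type, inner_eq_dotProduct]
      simp only [Sum.elim_inl, Sum.elim_inr, dotProduct]
      rw [← Finset.sum_add_distrib]
      refine Finset.sum_congr rfl fun i _ => ?_
      ring
    · intro C hC
      rw [hG.trans_eq h hh s C hC, Fintype.sum_sum_type]
      simp only [Sum.elim_inl, Sum.elim_inr]
      rw [← Finset.sum_add_distrib]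
      refine Finset.sum_congr rfl fun i _ => ?_
      rw [hμ i C hC]
      ring

/-- Transition probabilities sum to `1`, hence the feature space is not zero. -/
theorem MarkovGame.IsLinear.dim_pos (hG : G.IsLinear φ θ μ) (hH : 1 ≤ G.horizon) (s : S × A × A) :
    1 ≤ d := by
  rcases Nat.eq_zero_or_pos d with h0 | h0
  · subst h0
    have h1 := hG.trans_eq 1 (by simp; omega) s Set.univ MeasurableSet.univ
    simp at h1
  · exact h0

end LinearTransition

/-! ### Measurability of the estimates -/

section Measurability

theorem measurable_det {α : Type*} [MeasurableSpace α] {n : ℕ} {M : α → Matrix (Fin n) (Fin n) ℝ}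
    (hM : ∀ i j, Measurable fun a => M a i j) : Measurable fun a => (M a).det := by
  simp_rw [Matrix.det_apply]
  refine Finset.measurable_sum _ fun τ _ => ?_
  exact (Finset.measurable_prod _ fun i _ => hM _ _).const_smul _

theorem measurable_matrix_inv {α : Type*} [MeasurableSpace α] {n : ℕ}
    {M : α → Matrix (Fin n) (Fin n) ℝ} (hM : ∀ i j, Measurable fun a => M a i j) (i j : Fin n) :
    Measurable fun a => (M a)⁻¹ i j := by
  simp_rw [Matrix.inv_def, Ring.inverse_eq_inv', Matrix.smul_apply, Matrix.adjugate_apply,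
    smul_eq_mul]
  refine (measurable_det hM).inv.mul (measurable_det fun i' j' => ?_)
  by_cases h : i' = j
  · subst h; simp
  · simp only [Matrix.updateRow_ne h]; exact hM _ _

variable {S A : Type*} [MeasurableSpace S] [MeasurableSpace A] {d : ℕ}
  {φ : S × A × A → EuclideanSpace ℝ (Fin d)}

theorem measurable_feature_apply (hφ : Measurable φ) (i : Fin d) :
    Measurable fun s => φ s i :=
  (EuclideanSpace.proj (𝕜 := ℝ) i).continuous.measurable.comp hφ

theorem measurable_clip (H : ℝ) : Measurable (clip H) := by
  unfold clip
  fun_prop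

theorem measurable_linBonus {α : Type*} [MeasurableSpace α] (hφ : Measurable φ) (H β ρ : ℝ)
    {w : α → EuclideanSpace ℝ (Fin d)} {M : α → Matrix (Fin d) (Fin d) ℝ} {f : α → S × A × A}
    (hw : ∀ i, Measurable fun a => w a i) (hM : ∀ i j, Measurable fun a => M a i j)
    (hf : Measurable f) : Measurable fun a => linBonus φ H β (w a) (M a) ρ (f a) := by
  unfold linBonus
  have h1 : ∀ i, Measurable fun a => φ (f a) i := fun i => (measurable_feature_apply hφ i).comp hf
  refine (measurable_clip H).comp ?_
  simp_rw [inner_eq_dotProduct, dotProduct, Matrix.mulVec, dotProduct]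
  refine (Finset.measurable_sum _ fun i _ => (hw i).mul (h1 i)).add (Measurable.const_mul ?_ _)
  refine Real.continuous_sqrt.measurable.comp ?_
  exact Finset.measurable_sum _ fun i _ =>
    (h1 i).mul (Finset.measurable_sum _ fun j _ => (hM i j).mul (h1 j))

theorem measurable_gram {α : Type*} [MeasurableSpace α] (hφ : Measurable φ) {k : ℕ}
    {z : α → ℕ → S × A × A} (hz : ∀ τ ∈ Finset.Ico 1 k, Measurable fun a => z a τ) (i j : Fin d) :
    Measurable fun a => gram φ (z a) k i j := by
  unfold gram
  simp only [Matrix.add_apply, Matrix.sum_apply, Matrix.vecMulVec_apply]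
  refine (Finset.measurable_sum _ fun τ hτ => ?_).add_const _
  exact ((measurable_feature_apply hφ i).comp (hz τ hτ)).mul
    ((measurable_feature_apply hφ j).comp (hz τ hτ))

theorem measurable_ridge {α : Type*} [MeasurableSpace α] (hφ : Measurable φ) {k : ℕ}
    {z : α → ℕ → S × A × A} {y : α → ℕ → S} {r : S × A × A → ℝ} {V : α → S → ℝ}
    (hz : ∀ τ ∈ Finset.Ico 1 k, Measurable fun a => z a τ)
    (hy : ∀ τ ∈ Finset.Ico 1 k, Measurable fun a => y a τ)
    (hr : Measurable r) (hV : Measurable fun p : α × S => V p.1 p.2) (i : Fin d) :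
    Measurable fun a => ridge φ (z a) (y a) k r (V a) i := by
  unfold ridge
  simp only [Matrix.mulVec, dotProduct, Finset.sum_apply, Pi.smul_apply, smul_eq_mul]
  refine Finset.measurable_sum _ fun j _ =>
    (measurable_matrix_inv (measurable_gram hφ hz) i j).mul
      (Finset.measurable_sum _ fun τ hτ => ?_)
  exact ((hr.comp (hz τ hτ)).add (hV.comp (measurable_id.prodMk (hy τ hτ)))).mul
    ((measurable_feature_apply hφ j).comp (hz τ hτ))

variable (G : MarkovGame S A) (β : ℝ) {α : Type*} [MeasurableSpace α]
  {x : ℕ → ℕ → α → S} {act : ℕ → ℕ → α → A × A} {k : ℕ} (ρ : ℝ)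

theorem measurable_qStep (hφ : Measurable φ)
    (hx : ∀ τ ∈ Finset.Ico 1 k, ∀ t ∈ Finset.Icc 1 (G.horizon + 1), Measurable (x τ t))
    (hact : ∀ τ ∈ Finset.Ico 1 k, ∀ t ∈ Finset.Icc 1 G.horizon, Measurable (act τ t))
    {h : ℕ} (hh : h ∈ Finset.Icc 1 G.horizon) {V : α → S → ℝ}
    (hV : Measurable fun p : α × S => V p.1 p.2) :
    Measurable fun p : α × (S × A × A) =>
      qStep G φ β (fun τ t => x τ t p.1) (fun τ t => act τ t p.1) k ρ h (V p.1) p.2 := by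
  rw [Finset.mem_Icc] at hh
  unfold qStep
  have hz : ∀ τ ∈ Finset.Ico 1 k,
      Measurable fun p : α × (S × A × A) => (x τ h p.1, act τ h p.1) := fun τ hτ =>
    ((hx τ hτ h (by simp; omega)).comp measurable_fst).prodMk
      ((hact τ hτ h (by simp; omega)).comp measurable_fst)
  have hy : ∀ τ ∈ Finset.Ico 1 k,
      Measurable fun p : α × (S × A × A) => x τ (h + 1) p.1 := fun τ hτ =>
    (hx τ hτ (h + 1) (by simp; omega)).comp measurable_fst
  have hV' : Measurable fun p : (α × (S × A × A)) × S => V p.1.1 p.2 :=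
    hV.comp ((measurable_fst.comp measurable_fst).prodMk measurable_snd)
  exact measurable_linBonus hφ _ β ρ
    (measurable_ridge hφ (z := fun p : α × (S × A × A) => fun τ => (x τ h p.1, act τ h p.1))
      (y := fun p τ => x τ (h + 1) p.1) (V := fun p => V p.1) hz hy (G.measurable_reward h) hV')
    (measurable_matrix_inv (measurable_gram hφ hz)) measurable_snd

variable [DiscreteMeasurableSpace A] [Finite A] {σ : α → Policy S (A × A)}

/-- The value estimates are jointly measurable in the data and the state. -/
theorem measurable_vRec (hφ : Measurable φ)
    (hx : ∀ τ ∈ Finset.Ico 1 k, ∀ t ∈ Finset.Icc 1 (G.horizon + 1), Measurable (x τ t))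
    (hact : ∀ τ ∈ Finset.Ico 1 k, ∀ t ∈ Finset.Icc 1 G.horizon, Measurable (act τ t))
    (hσ : ∀ h ∈ Finset.Icc 1 G.horizon, ∀ ab,
      Measurable fun p : α × S => ((σ p.1 h).1 p.2).real {ab}) (n : ℕ) (hn : n ≤ G.horizon) :
    Measurable fun p : α × S =>
      vRec G φ β (fun τ t => x τ t p.1) (fun τ t => act τ t p.1) k ρ (σ p.1) n p.2 := by
  have := Fintype.ofFinite A
  induction n with
  | zero => simp [vRec]
  | succ n ih =>
    have h1 := ih (by omega)
    simp only [vRec]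
    have hh : G.horizon - n ∈ Finset.Icc 1 G.horizon := by simp; omega
    have h2 := measurable_qStep G β ρ hφ hx hact hh (V := fun a =>
      vRec G φ β (fun τ t => x τ t a) (fun τ t => act τ t a) k ρ (σ a) n) h1
    simp_rw [integral_fintype (Integrable.of_finite), smul_eq_mul]
    refine Finset.measurable_sum _ fun ab _ => (hσ _ hh ab).mul ?_
    have h3 : Measurable fun p : α × S => (p.1, (p.2, ab)) := by fun_prop
    have h4 := h2.comp h3
    simp only [Function.comp_def] at h4
    exact h4

theorem measurable_vEst_joint (hφ : Measurable φ)
    (hx : ∀ τ ∈ Finset.Ico 1 k, ∀ t ∈ Finset.Icc 1 (G.horizon + 1), Measurable (x τ t))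
    (hact : ∀ τ ∈ Finset.Ico 1 k, ∀ t ∈ Finset.Icc 1 G.horizon, Measurable (act τ t))
    (hσ : ∀ h ∈ Finset.Icc 1 G.horizon, ∀ ab,
      Measurable fun p : α × S => ((σ p.1 h).1 p.2).real {ab}) {h : ℕ} (hh : 1 ≤ h) :
    Measurable fun p : α × S =>
      vEst G φ β (fun τ t => x τ t p.1) (fun τ t => act τ t p.1) k ρ (σ p.1) h p.2 :=
  measurable_vRec G β ρ hφ hx hact hσ _ (by omega)

theorem measurable_qEst_joint (hφ : Measurable φ)
    (hx : ∀ τ ∈ Finset.Ico 1 k, ∀ t ∈ Finset.Icc 1 (G.horizon + 1), Measurable (x τ t))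
    (hact : ∀ τ ∈ Finset.Ico 1 k, ∀ t ∈ Finset.Icc 1 G.horizon, Measurable (act τ t))
    (hσ : ∀ h ∈ Finset.Icc 1 G.horizon, ∀ ab,
      Measurable fun p : α × S => ((σ p.1 h).1 p.2).real {ab})
    {h : ℕ} (hh : h ∈ Finset.Icc 1 G.horizon) :
    Measurable fun p : α × (S × A × A) =>
      qEst G φ β (fun τ t => x τ t p.1) (fun τ t => act τ t p.1) k ρ (σ p.1) h p.2 :=
  measurable_qStep G β ρ hφ hx hact hh (V := fun a =>
      vEst G φ β (fun τ t => x τ t a) (fun τ t => act τ t a) k ρ (σ a) (h + 1))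
    (measurable_vEst_joint G β ρ hφ hx hact hσ (by omega))

theorem StochKernel.measurable_real_singleton (κ : StochKernel S (A × A)) (ab : A × A) :
    Measurable fun s => (κ.1 s).real {ab} :=
  (κ.1.measurable_coe (measurableSet_singleton ab)).ennreal_toReal

theorem measurable_vEst (hφ : Measurable φ) (x : ℕ → ℕ → S) (act : ℕ → ℕ → A × A) (k : ℕ)
    (σ : Policy S (A × A)) {h : ℕ} (hh : 1 ≤ h) :
    Measurable (vEst G φ β x act k ρ σ h) :=
  (measurable_vEst_joint G β ρ (α := Unit) (x := fun τ t _ => x τ t) (act := fun τ t _ => act τ t)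
    (σ := fun _ => σ) hφ (fun _ _ _ _ => measurable_const) (fun _ _ _ _ => measurable_const)
    (fun h _ ab => ((σ h).measurable_real_singleton ab).comp measurable_snd) hh).comp
    (measurable_prodMk_left (x := ()))

end Measurability

/-! ### Optimism -/

section Optimism

theorem abs_clip_le {H : ℝ} (hH : 0 ≤ H) (u : ℝ) : |clip H u| ≤ H := by
  unfold clip
  rw [abs_le]
  exact ⟨le_max_right _ _, max_le (min_le_right _ _) (by linarith)⟩

theorem clip_mono (H : ℝ) : Monotone (clip H) := fun _ _ h =>
  max_le_max (min_le_min h le_rfl) le_rfl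

theorem clip_of_abs_le {H u : ℝ} (h : |u| ≤ H) : clip H u = u := by
  unfold clip
  rw [min_eq_left (abs_le.1 h).2, max_eq_left (abs_le.1 h).1]

theorem le_clip_add {H a u e : ℝ} (ha : |a| ≤ H) (h : a ≤ u + e) (he : 0 ≤ e) :
    a ≤ clip H u + e := by
  have h1 := clip_mono H (show a - e ≤ u by linarith)
  have h2 := abs_clip_sub_clip_le H a (a - e)
  rw [clip_of_abs_le ha] at h2
  have h3 : |a - (a - e)| = e := by rw [sub_sub_cancel, abs_of_nonneg he]
  rw [h3] at h2
  linarith [(abs_le.1 h2).2]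

theorem clip_sub_le {H a u e : ℝ} (ha : |a| ≤ H) (h : u - e ≤ a) (he : 0 ≤ e) :
    clip H u - e ≤ a := by
  have h1 := clip_mono H (show u ≤ a + e by linarith)
  have h2 := abs_clip_sub_clip_le H (a + e) a
  rw [clip_of_abs_le ha] at h2
  have h3 : |(a + e) - a| = e := by rw [add_sub_cancel_left, abs_of_nonneg he]
  rw [h3] at h2
  linarith [(abs_le.1 h2).2]

variable {S A : Type*} [MeasurableSpace S] [MeasurableSpace A] {d : ℕ}
  (G : MarkovGame S A) (φ : S × A × A → EuclideanSpace ℝ (Fin d)) (β : ℝ)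
  (x : ℕ → ℕ → S) (act : ℕ → ℕ → A × A) (k : ℕ) (σ : Policy S (A × A))

/-- The elliptical norm `√(φᵀ Λ⁻¹ φ)` of the feature of a triple, `Λ` being the Gram matrix of
step `h` at the beginning of episode `k`. -/
def ellNorm (h : ℕ) (s : S × A × A) : ℝ :=
  √((φ s).ofLp ⬝ᵥ (gram φ (fun τ => (x τ h, act τ h)) k)⁻¹ *ᵥ (φ s).ofLp)

/-- The unclipped, bonus-free regression estimate of the step-`h` Q function. -/
def ridgeValue (ρ : ℝ) (h : ℕ) (s : S × A × A) : ℝ :=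
  inner ℝ (ridge φ (fun τ => (x τ h, act τ h)) (fun τ => x τ (h + 1)) k (G.reward h)
    (vEst G φ β x act k ρ σ (h + 1))) (φ s)

/-- The event that every regression estimate of an episode is within one bonus of its target. -/
def BonusDominates : Prop :=
  ∀ ρ : ℝ, (ρ = 1 ∨ ρ = -1) → ∀ h ∈ Finset.Icc 1 G.horizon, ∀ s,
    |ridgeValue G φ β x act k σ ρ h s -
      (G.reward h s + ∫ y, vEst G φ β x act k ρ σ (h + 1) y ∂((G.trans h).1 s))| ≤
      β * ellNorm φ x act k h s

theorem qEst_eq (ρ : ℝ) (h : ℕ) (s : S × A × A) :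
    qEst G φ β x act k ρ σ h s =
      clip G.horizon (ridgeValue G φ β x act k σ ρ h s + ρ * β * ellNorm φ x act k h s) := rfl

theorem ellNorm_nonneg {S A : Type*} {d : ℕ} (φ : S × A × A → EuclideanSpace ℝ (Fin d))
    (x : ℕ → ℕ → S) (act : ℕ → ℕ → A × A) (k h : ℕ) (s : S × A × A) :
    0 ≤ ellNorm φ x act k h s := Real.sqrt_nonneg _

theorem abs_qEst_le (ρ : ℝ) (h : ℕ) (s : S × A × A) :
    |qEst G φ β x act k ρ σ h s| ≤ G.horizon := abs_clip_le (by positivity) _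

theorem vEst_horizon_succ (ρ : ℝ) : vEst G φ β x act k ρ σ (G.horizon + 1) = fun _ => 0 := by
  unfold vEst
  rw [Nat.sub_self]
  rfl

theorem vEst_eq (ρ : ℝ) {h : ℕ} (hh : h ∈ Finset.Icc 1 G.horizon) (s : S) :
    vEst G φ β x act k ρ σ h s =
      ∫ ab, qEst G φ β x act k ρ σ h (s, ab) ∂((σ h).1 s) := by
  rw [Finset.mem_Icc] at hh
  unfold vEst qEst vEst
  have h1 : G.horizon + 1 - h = (G.horizon - h) + 1 := by omega
  have h2 : G.horizon - (G.horizon - h) = h := by omega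
  have h3 : G.horizon + 1 - (h + 1) = G.horizon - h := by omega
  rw [h1, vRec, h2, h3]

theorem abs_vEst_le (ρ : ℝ) {h : ℕ} (hh : h ∈ Finset.Icc 1 (G.horizon + 1)) (s : S) :
    |vEst G φ β x act k ρ σ h s| ≤ G.horizon := by
  rw [Finset.mem_Icc] at hh
  rcases Nat.lt_or_ge h (G.horizon + 1) with h1 | h1
  · rw [vEst_eq G φ β x act k σ ρ (by simp; omega)]
    exact abs_integral_le_of_abs_le' (fun ab => abs_qEst_le G φ β x act k σ ρ h (s, ab)) _
  · have : h = G.horizon + 1 := by omega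
    rw [this, vEst_horizon_succ]
    simp

variable {G φ β x act k σ} [DiscreteMeasurableSpace A] [Finite A]
  {θ : ℕ → EuclideanSpace ℝ (Fin d)} {μ : ℕ → Fin d → SignedMeasure S}
  {N : Set (S × A × A → ℝ)} {ε : ℝ}
  {cce : (S × A × A → ℝ) → (S × A × A → ℝ) → StochKernel S (A × A)}

/-- A best response of the first player to the second marginal of `σ` gains at most `2 ε` over `σ`
in the upper payoff. -/
theorem integral_prod_marginalSnd_le {Qup Qlow : S × A × A → ℝ} {h : ℕ} {y : S}
    (hσ : IsFindCCE N ε cce Qup Qlow (σ h)) (hcce : IsCCERule N cce) (π : Policy S A) :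
    ∫ ab, Qup (y, ab) ∂(((π h).1 y).prod ((σ.marginalSnd h).1 y)) ≤
      ∫ ab, Qup (y, ab) ∂((σ h).1 y) + 2 * ε := by
  obtain ⟨q, hq, q', hq', h1, h2, h3⟩ := hσ
  have hC := (hcce q hq q' hq' y).1
  rw [← h3] at hC
  have hsnd : (σ.marginalSnd h).1 y = ((σ h).1 y).snd := by
    simp only [Policy.marginalSnd]
    rw [Kernel.snd_apply]
    rfl
  rw [hsnd]
  have i1 : ∀ (m : Measure (A × A)) [IsFiniteMeasure m] (f : A × A → ℝ), Integrable f m :=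
    fun m _ f => Integrable.of_finite
  have i2 : ∀ (m : Measure A) [IsFiniteMeasure m] (f : A → ℝ), Integrable f m :=
    fun m _ f => Integrable.of_finite
  have a1 : ∫ ab, Qup (y, ab) ∂(((π h).1 y).prod (((σ h).1 y).snd)) ≤
      ∫ ab, (q (y, ab) + ε) ∂(((π h).1 y).prod (((σ h).1 y).snd)) :=
    integral_mono (i1 _ _) (i1 _ _) fun ab => by
      have := (abs_le.1 (h1 (y, ab))).1
      simp only
      linarith
  have a2 : ∫ ab, q (y, ab) ∂((σ h).1 y) ≤ ∫ ab, (Qup (y, ab) + ε) ∂((σ h).1 y) :=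
    integral_mono (i1 _ _) (i1 _ _) fun ab => by
      have := (abs_le.1 (h1 (y, ab))).2
      simp only
      linarith
  rw [integral_add (i1 _ _) (i1 _ _)] at a1 a2
  rw [integral_prod (fun ab => q (y, ab)) (i1 _ _)] at a1
  have a3 : ∫ a, ∫ b, q (y, a, b) ∂(((σ h).1 y).snd) ∂((π h).1 y) ≤
      ∫ _a, ∫ ab, q (y, ab) ∂((σ h).1 y) ∂((π h).1 y) :=
    integral_mono (i2 _ _) (i2 _ _) hC
  simp at a1 a2 a3
  linarith

/-- A best response of the second player to the first marginal of `σ` gains at most `2 ε` over `σ`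
in the lower payoff. -/
theorem le_integral_marginalFst_prod {Qup Qlow : S × A × A → ℝ} {h : ℕ} {y : S}
    (hσ : IsFindCCE N ε cce Qup Qlow (σ h)) (hcce : IsCCERule N cce) (ν : Policy S A) :
    ∫ ab, Qlow (y, ab) ∂((σ h).1 y) - 2 * ε ≤
      ∫ ab, Qlow (y, ab) ∂(((σ.marginalFst h).1 y).prod ((ν h).1 y)) := by
  obtain ⟨q, hq, q', hq', h1, h2, h3⟩ := hσ
  have hC := (hcce q hq q' hq' y).2
  rw [← h3] at hC
  have hfst : (σ.marginalFst h).1 y = ((σ h).1 y).fst := by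
    simp only [Policy.marginalFst]
    rw [Kernel.fst_apply]
    rfl
  rw [hfst]
  have i1 : ∀ (m : Measure (A × A)) [IsFiniteMeasure m] (f : A × A → ℝ), Integrable f m :=
    fun m _ f => Integrable.of_finite
  have i2 : ∀ (m : Measure A) [IsFiniteMeasure m] (f : A → ℝ), Integrable f m :=
    fun m _ f => Integrable.of_finite
  have a1 : ∫ ab, q' (y, ab) ∂((((σ h).1 y).fst).prod ((ν h).1 y)) ≤
      ∫ ab, (Qlow (y, ab) + ε) ∂((((σ h).1 y).fst).prod ((ν h).1 y)) :=
    integral_mono (i1 _ _) (i1 _ _) fun ab => by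
      have := (abs_le.1 (h2 (y, ab))).2
      simp only
      linarith
  have a2 : ∫ ab, Qlow (y, ab) ∂((σ h).1 y) ≤ ∫ ab, (q' (y, ab) + ε) ∂((σ h).1 y) :=
    integral_mono (i1 _ _) (i1 _ _) fun ab => by
      have := (abs_le.1 (h2 (y, ab))).1
      simp only
      linarith
  rw [integral_add (i1 _ _) (i1 _ _)] at a1 a2
  rw [integral_prod_symm (fun ab => q' (y, ab)) (i1 _ _)] at a1
  have a3 : ∫ _b, ∫ ab, q' (y, ab) ∂((σ h).1 y) ∂((ν h).1 y) ≤
      ∫ b, ∫ a, q' (y, a, b) ∂(((σ h).1 y).fst) ∂((ν h).1 y) :=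
    integral_mono (i2 _ _) (i2 _ _) hC
  simp at a1 a2 a3
  linarith

/-- Optimism: the upper estimate bounds the value of every response of the first player to the
second marginal, up to the rounding error of each step. -/
theorem value_le_vEst (hφ : Measurable φ) (hβ : BonusDominates G φ β x act k σ) (hε : 0 ≤ ε)
    (hcce : IsCCERule N cce)
    (hσ : ∀ h ∈ Finset.Icc 1 G.horizon, IsFindCCE N ε cce (qEst G φ β x act k 1 σ h)
      (qEst G φ β x act k (-1) σ h) (σ h)) (π : Policy S A) (n : ℕ) (hn : n ≤ G.horizon) (y : S) :
    G.value π σ.marginalSnd (G.horizon + 1 - n) y ≤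
      vEst G φ β x act k 1 σ (G.horizon + 1 - n) y + 2 * n * ε := by
  induction n generalizing y with
  | zero =>
    simp [G.value_horizon_succ, vEst_horizon_succ G φ β x act k σ]
  | succ n ih =>
    have h0 := ih (by omega)
    set h := G.horizon + 1 - (n + 1) with hdef
    have hh : h ∈ Finset.Icc 1 G.horizon := by simp; omega
    have hs : G.horizon + 1 - n = h + 1 := by omega
    rw [hs] at h0
    have hq : ∀ s, G.qValue π σ.marginalSnd h s ≤ qEst G φ β x act k 1 σ h s + 2 * n * ε := by
      intro s
      rw [qEst_eq]
      refine le_clip_add ?_ ?_ (by positivity)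
      · refine (G.abs_qValue_le _ _ _ _).trans ?_
        exact_mod_cast (by omega)
      · rw [G.qValue_eq _ _ _ (Finset.mem_Icc.1 hh).2]
        have h1 := (abs_le.1 (hβ 1 (Or.inl rfl) h hh s)).1
        have hb : ∀ y, |vEst G φ β x act k 1 σ (h + 1) y| ≤ G.horizon :=
          abs_vEst_le G φ β x act k σ 1 (by simp; omega)
        have iv := integrable_of_abs_le (measurable_vEst G β 1 hφ x act k σ (h := h + 1) (by omega))
          hb ((G.trans h).1 s)
        have h2 : ∫ y, G.value π σ.marginalSnd (h + 1) y ∂((G.trans h).1 s) ≤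
            ∫ y, (vEst G φ β x act k 1 σ (h + 1) y + 2 * n * ε) ∂((G.trans h).1 s) :=
          integral_mono (integrable_of_abs_le (G.measurable_value _ _ _) (G.abs_value_le _ _ _) _)
            (iv.add (integrable_const _)) h0
        rw [integral_add iv (integrable_const _)] at h2
        simp at h2
        linarith
    rw [vEst_eq G φ β x act k σ 1 hh, MarkovGame.value]
    have h3 := integral_prod_marginalSnd_le (y := y) (hσ h hh) hcce π
    have h4 : ∫ ab, G.qValue π σ.marginalSnd h (y, ab)
          ∂(((π h).1 y).prod ((σ.marginalSnd h).1 y)) ≤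
        ∫ ab, (qEst G φ β x act k 1 σ h (y, ab) + 2 * n * ε)
          ∂(((π h).1 y).prod ((σ.marginalSnd h).1 y)) :=
      integral_mono Integrable.of_finite Integrable.of_finite fun ab => hq (y, ab)
    rw [integral_add Integrable.of_finite Integrable.of_finite] at h4
    simp at h4
    push_cast
    linarith

/-- Optimism for the second player: the lower estimate bounds the value of every response to the
first marginal from below, up to the rounding error of each step. -/
theorem vEst_le_value (hφ : Measurable φ) (hβ : BonusDominates G φ β x act k σ) (hε : 0 ≤ ε)
    (hcce : IsCCERule N cce)
    (hσ : ∀ h ∈ Finset.Icc 1 G.horizon, IsFindCCE N ε cce (qEst G φ β x act k 1 σ h)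
      (qEst G φ β x act k (-1) σ h) (σ h)) (ν : Policy S A) (n : ℕ) (hn : n ≤ G.horizon) (y : S) :
    vEst G φ β x act k (-1) σ (G.horizon + 1 - n) y - 2 * n * ε ≤
      G.value σ.marginalFst ν (G.horizon + 1 - n) y := by
  induction n generalizing y with
  | zero =>
    simp [G.value_horizon_succ, vEst_horizon_succ G φ β x act k σ]
  | succ n ih =>
    have h0 := ih (by omega)
    set h := G.horizon + 1 - (n + 1) with hdef
    have hh : h ∈ Finset.Icc 1 G.horizon := by simp; omega
    have hs : G.horizon + 1 - n = h + 1 := by omega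
    rw [hs] at h0
    have hq : ∀ s, qEst G φ β x act k (-1) σ h s - 2 * n * ε ≤ G.qValue σ.marginalFst ν h s := by
      intro s
      rw [qEst_eq]
      refine clip_sub_le ?_ ?_ (by positivity)
      · refine (G.abs_qValue_le _ _ _ _).trans ?_
        exact_mod_cast (by omega)
      · rw [G.qValue_eq _ _ _ (Finset.mem_Icc.1 hh).2]
        have h1 := (abs_le.1 (hβ (-1) (Or.inr rfl) h hh s)).2
        have hb : ∀ y, |vEst G φ β x act k (-1) σ (h + 1) y| ≤ G.horizon :=
          abs_vEst_le G φ β x act k σ (-1) (by simp; omega)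
        have iv := integrable_of_abs_le
          (measurable_vEst G β (-1) hφ x act k σ (h := h + 1) (by omega)) hb ((G.trans h).1 s)
        have h2 : ∫ y, (vEst G φ β x act k (-1) σ (h + 1) y - 2 * n * ε) ∂((G.trans h).1 s) ≤
            ∫ y, G.value σ.marginalFst ν (h + 1) y ∂((G.trans h).1 s) :=
          integral_mono (iv.sub (integrable_const _))
            (integrable_of_abs_le (G.measurable_value _ _ _) (G.abs_value_le _ _ _) _) h0
        rw [integral_sub iv (integrable_const _)] at h2
        simp at h2
        linarith
    rw [vEst_eq G φ β x act k σ (-1) hh, MarkovGame.value]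
    have h3 := le_integral_marginalFst_prod (y := y) (hσ h hh) hcce ν
    have h4 : ∫ ab, (qEst G φ β x act k (-1) σ h (y, ab) - 2 * n * ε)
          ∂(((σ.marginalFst h).1 y).prod ((ν h).1 y)) ≤
        ∫ ab, G.qValue σ.marginalFst ν h (y, ab)
          ∂(((σ.marginalFst h).1 y).prod ((ν h).1 y)) :=
      integral_mono Integrable.of_finite Integrable.of_finite fun ab => hq (y, ab)
    rw [integral_sub Integrable.of_finite Integrable.of_finite] at h4
    simp at h4
    push_cast
    linarith

/-- The duality gap is bounded by the width of the confidence interval up to rounding. -/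
theorem valueBest_sub_le (hφ : Measurable φ) (hβ : BonusDominates G φ β x act k σ) (hε : 0 ≤ ε)
    (hcce : IsCCERule N cce)
    (hσ : ∀ h ∈ Finset.Icc 1 G.horizon, IsFindCCE N ε cce (qEst G φ β x act k 1 σ h)
      (qEst G φ β x act k (-1) σ h) (σ h)) (y : S) :
    G.valueBestFst σ.marginalSnd 1 y - G.valueBestSnd σ.marginalFst 1 y ≤
      vEst G φ β x act k 1 σ 1 y - vEst G φ β x act k (-1) σ 1 y + 4 * G.horizon * ε := by
  have hne : Nonempty (Policy S A) := ⟨σ.marginalFst⟩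
  have h1 : G.valueBestFst σ.marginalSnd 1 y ≤
      vEst G φ β x act k 1 σ 1 y + 2 * G.horizon * ε := by
    refine ciSup_le fun π => ?_
    have := value_le_vEst hφ hβ hε hcce hσ π G.horizon le_rfl y
    rwa [Nat.add_sub_cancel_left] at this
  have h2 : vEst G φ β x act k (-1) σ 1 y - 2 * G.horizon * ε ≤
      G.valueBestSnd σ.marginalFst 1 y := by
    refine le_ciInf fun ν => ?_
    have := vEst_le_value hφ hβ hε hcce hσ ν G.horizon le_rfl y
    rwa [Nat.add_sub_cancel_left] at this
  linarith

/-- The lower estimates are below the upper ones. -/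
theorem vEst_neg_le_vEst (hφ : Measurable φ) (hβ : BonusDominates G φ β x act k σ) (n : ℕ)
    (hn : n ≤ G.horizon) (y : S) :
    vEst G φ β x act k (-1) σ (G.horizon + 1 - n) y ≤
      vEst G φ β x act k 1 σ (G.horizon + 1 - n) y := by
  induction n generalizing y with
  | zero => simp [vEst_horizon_succ G φ β x act k σ]
  | succ n ih =>
    have h0 := ih (by omega)
    set h := G.horizon + 1 - (n + 1) with hdef
    have hh : h ∈ Finset.Icc 1 G.horizon := by simp; omega
    have hs : G.horizon + 1 - n = h + 1 := by omega
    rw [hs] at h0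
    rw [vEst_eq G φ β x act k σ (-1) hh, vEst_eq G φ β x act k σ 1 hh]
    refine integral_mono Integrable.of_finite Integrable.of_finite fun ab => ?_
    simp only [qEst_eq]
    refine clip_mono _ ?_
    have h1 := (abs_le.1 (hβ 1 (Or.inl rfl) h hh (y, ab))).1
    have h2 := (abs_le.1 (hβ (-1) (Or.inr rfl) h hh (y, ab))).2
    have hb : ∀ ρ y, |vEst G φ β x act k ρ σ (h + 1) y| ≤ G.horizon := fun ρ =>
      abs_vEst_le G φ β x act k σ ρ (by simp; omega)
    have iv := fun ρ => integrable_of_abs_le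
      (measurable_vEst G β ρ hφ x act k σ (h := h + 1) (by omega)) (hb ρ) ((G.trans h).1 (y, ab))
    have h3 := integral_mono (iv (-1)) (iv 1) h0
    linarith

/-- The width of the confidence interval of the Q function is at most the expected width at the
next step plus four bonuses. -/
theorem qEst_sub_le (hφ : Measurable φ) (hβ0 : 0 ≤ β) (hβ : BonusDominates G φ β x act k σ)
    {h : ℕ} (hh : h ∈ Finset.Icc 1 G.horizon) (s : S × A × A) :
    qEst G φ β x act k 1 σ h s - qEst G φ β x act k (-1) σ h s ≤
      ∫ y, (vEst G φ β x act k 1 σ (h + 1) y - vEst G φ β x act k (-1) σ (h + 1) y)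
        ∂((G.trans h).1 s) + 4 * β * ellNorm φ x act k h s := by
  have hh' := Finset.mem_Icc.1 hh
  have h0 := vEst_neg_le_vEst hφ hβ (G.horizon - h) (by omega)
  have hs : G.horizon + 1 - (G.horizon - h) = h + 1 := by omega
  rw [hs] at h0
  obtain ⟨h1, h1'⟩ := abs_le.1 (hβ 1 (Or.inl rfl) h hh s)
  obtain ⟨h2, h2'⟩ := abs_le.1 (hβ (-1) (Or.inr rfl) h hh s)
  have hb : ∀ ρ y, |vEst G φ β x act k ρ σ (h + 1) y| ≤ G.horizon := fun ρ =>
    abs_vEst_le G φ β x act k σ ρ (by simp; omega)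
  have iv := fun ρ => integrable_of_abs_le
    (measurable_vEst G β ρ hφ x act k σ (h := h + 1) (by omega)) (hb ρ) ((G.trans h).1 s)
  have h3 := integral_mono (iv (-1)) (iv 1) h0
  have hn := mul_nonneg hβ0 (ellNorm_nonneg φ x act k h s)
  rw [integral_sub (iv 1) (iv (-1)), qEst_eq, qEst_eq]
  have h4 := abs_clip_sub_clip_le G.horizon
    (ridgeValue G φ β x act k σ 1 h s + 1 * β * ellNorm φ x act k h s)
    (ridgeValue G φ β x act k σ (-1) h s + -1 * β * ellNorm φ x act k h s)
  refine (le_abs_self _).trans (h4.trans ?_)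
  rw [abs_le]
  constructor <;> linarith

end Optimism

/-! ### Regression error -/

section Regression

variable {S A : Type*} [MeasurableSpace S] [MeasurableSpace A] {d : ℕ}
  {G : MarkovGame S A} {φ : S × A × A → EuclideanSpace ℝ (Fin d)}
  {θ : ℕ → EuclideanSpace ℝ (Fin d)} {μ : ℕ → Fin d → SignedMeasure S}

theorem gram_mulVec {S A : Type*} (φ : S × A × A → EuclideanSpace ℝ (Fin d))
    (z : ℕ → S × A × A) (k : ℕ) (v : Fin d → ℝ) :
    gram φ z k *ᵥ v = ∑ τ ∈ Finset.Ico 1 k, (v ⬝ᵥ (φ (z τ)).ofLp) • (φ (z τ)).ofLp + v := by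
  unfold gram
  rw [Matrix.add_mulVec, Matrix.one_mulVec, Matrix.sum_mulVec]
  congr 1
  refine Finset.sum_congr rfl fun τ _ => ?_
  rw [Matrix.vecMulVec_mulVec, dotProduct_comm v]
  simp

/-- The regression error in terms of the self-normalized noise of a nearby value function `W`,
the distance to `W`, and the bias of the regularization. -/
theorem abs_inner_ridge_sub_le (hG : G.IsLinear φ θ μ) {h : ℕ} (hh : h ∈ Finset.Icc 1 G.horizon)
    (z : ℕ → S × A × A) (y : ℕ → S) {k : ℕ} (hk : 1 ≤ k) {V W : S → ℝ} (hV : Measurable V)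
    (hW : Measurable W) {B ε R : ℝ} (hVB : ∀ y, |V y| ≤ B) (hWB : ∀ y, |W y| ≤ B)
    (hVW : ∀ y, |V y - W y| ≤ ε) (hε : 0 ≤ ε) (hR : 0 ≤ R)
    (hnoise : (∑ τ ∈ Finset.Ico 1 k, (W (y τ) - ∫ y, W y ∂((G.trans h).1 (z τ))) • (φ (z τ)).ofLp)
      ⬝ᵥ (gram φ z k)⁻¹ *ᵥ (∑ τ ∈ Finset.Ico 1 k,
        (W (y τ) - ∫ y, W y ∂((G.trans h).1 (z τ))) • (φ (z τ)).ofLp) ≤ R ^ 2)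
    (s : S × A × A) :
    |inner ℝ (ridge φ z y k (G.reward h) V) (φ s) -
      (G.reward h s + ∫ y, V y ∂((G.trans h).1 s))| ≤
      (R + 2 * ε * k + √d + 2 * d * B) * √((φ s).ofLp ⬝ᵥ (gram φ z k)⁻¹ *ᵥ (φ s).ofLp) := by
  have hB0 : 0 ≤ B := (abs_nonneg _).trans (hVB s.1)
  obtain ⟨w₀, hw₀, hPV⟩ := hG.exists_integral_trans_eq hh hV hVB hB0
  set w := θ h + w₀ with hw
  have hwn : ‖w‖ ≤ √d + 2 * d * B :=
    (norm_add_le _ _).trans (add_le_add (hG.norm_theta_le h hh) hw₀)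
  have htarget : ∀ s, G.reward h s + ∫ y, V y ∂((G.trans h).1 s) = w.ofLp ⬝ᵥ (φ s).ofLp := by
    intro s
    rw [hG.reward_eq h hh, hPV, real_inner_comm, ← inner_add_left, inner_eq_dotProduct]
  rw [htarget]
  set M := (gram φ z k)⁻¹ with hM
  have hMs := gram_inv_posSemidef φ z k
  set e : ℕ → ℝ := fun τ => W (y τ) - ∫ y, W y ∂((G.trans h).1 (z τ)) with he
  set δ : ℕ → ℝ := fun τ => (V (y τ) - ∫ y, V y ∂((G.trans h).1 (z τ))) - e τ with hδ
  set E := ∑ τ ∈ Finset.Ico 1 k, e τ • (φ (z τ)).ofLp with hE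
  have hδb : ∀ τ, |δ τ| ≤ 2 * ε := by
    intro τ
    have h1 : δ τ = (V (y τ) - W (y τ)) - ∫ y, (V y - W y) ∂((G.trans h).1 (z τ)) := by
      rw [integral_sub (integrable_of_abs_le hV hVB _) (integrable_of_abs_le hW hWB _)]
      simp only [hδ, he]
      ring
    rw [h1]
    have h2 := abs_integral_le_of_abs_le' hVW ((G.trans h).1 (z τ))
    have h3 := abs_sub (V (y τ) - W (y τ)) (∫ y, (V y - W y) ∂((G.trans h).1 (z τ)))
    linarith [hVW (y τ)]
  have hsum : ∑ τ ∈ Finset.Ico 1 k, (G.reward h (z τ) + V (y τ)) • (φ (z τ)).ofLp =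
      gram φ z k *ᵥ w.ofLp + (E + ∑ τ ∈ Finset.Ico 1 k, δ τ • (φ (z τ)).ofLp - w.ofLp) := by
    rw [gram_mulVec, hE, ← Finset.sum_add_distrib]
    have : ∀ τ ∈ Finset.Ico 1 k, (G.reward h (z τ) + V (y τ)) • (φ (z τ)).ofLp =
        (w.ofLp ⬝ᵥ (φ (z τ)).ofLp) • (φ (z τ)).ofLp +
          (e τ • (φ (z τ)).ofLp + δ τ • (φ (z τ)).ofLp) := by
      intro τ _
      rw [← htarget, ← add_smul, ← add_smul]
      congr 1
      simp only [hδ]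
      ring
    rw [Finset.sum_congr rfl this, Finset.sum_add_distrib]
    abel
  have hridge : inner ℝ (ridge φ z y k (G.reward h) V) (φ s) - w.ofLp ⬝ᵥ (φ s).ofLp =
      (φ s).ofLp ⬝ᵥ M *ᵥ E + ∑ τ ∈ Finset.Ico 1 k, δ τ * ((φ s).ofLp ⬝ᵥ M *ᵥ (φ (z τ)).ofLp) -
        (φ s).ofLp ⬝ᵥ M *ᵥ w.ofLp := by
    rw [inner_eq_dotProduct, ridge, hsum]
    simp only
    rw [Matrix.mulVec_add, gram_inv_mulVec_mulVec, add_dotProduct, add_sub_cancel_left,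
      dotProduct_comm, Matrix.mulVec_sub, dotProduct_sub, Matrix.mulVec_add, dotProduct_add]
    congr 2
    rw [Matrix.mulVec_sum, dotProduct_sum]
    refine Finset.sum_congr rfl fun τ _ => ?_
    rw [Matrix.mulVec_smul, dotProduct_smul, smul_eq_mul]
  rw [hridge]
  set b := √((φ s).ofLp ⬝ᵥ M *ᵥ (φ s).ofLp) with hb
  have hb0 : 0 ≤ b := Real.sqrt_nonneg _
  have t1 : |(φ s).ofLp ⬝ᵥ M *ᵥ E| ≤ R * b := by
    refine (hMs.abs_dotProduct_mulVec_le _ _).trans ?_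
    rw [mul_comm]
    gcongr
    exact Real.sqrt_le_iff.2 ⟨hR, hnoise⟩
  have hle : ∀ v : EuclideanSpace ℝ (Fin d), |(φ s).ofLp ⬝ᵥ M *ᵥ v.ofLp| ≤ ‖v‖ * b := by
    intro v
    refine (hMs.abs_dotProduct_mulVec_le _ _).trans ?_
    rw [mul_comm]
    gcongr
    refine Real.sqrt_le_iff.2 ⟨norm_nonneg _, ?_⟩
    rw [← dotProduct_self_eq_norm_sq]
    exact gram_inv_quad_le φ z k _
  have t2 : |∑ τ ∈ Finset.Ico 1 k, δ τ * ((φ s).ofLp ⬝ᵥ M *ᵥ (φ (z τ)).ofLp)| ≤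
      2 * ε * k * b := by
    refine (Finset.abs_sum_le_sum_abs _ _).trans ?_
    calc _ ≤ ∑ τ ∈ Finset.Ico 1 k, 2 * ε * b := by
          refine Finset.sum_le_sum fun τ _ => ?_
          rw [abs_mul]
          refine mul_le_mul (hδb τ) ?_ (abs_nonneg _) (by positivity)
          refine (hle (φ (z τ))).trans ?_
          exact mul_le_of_le_one_left hb0 (hG.norm_feature_le _)
      _ = ((k - 1 : ℕ) : ℝ) * (2 * ε * b) := by simp
      _ ≤ k * (2 * ε * b) := by
          gcongr
          omega
      _ = _ := by ring
  have t3 : |(φ s).ofLp ⬝ᵥ M *ᵥ w.ofLp| ≤ (√d + 2 * d * B) * b :=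
    (hle w).trans (by gcongr)
  have t4 := abs_sub ((φ s).ofLp ⬝ᵥ M *ᵥ E +
    ∑ τ ∈ Finset.Ico 1 k, δ τ * ((φ s).ofLp ⬝ᵥ M *ᵥ (φ (z τ)).ofLp)) ((φ s).ofLp ⬝ᵥ M *ᵥ w.ofLp)
  have t5 := abs_add_le ((φ s).ofLp ⬝ᵥ M *ᵥ E)
    (∑ τ ∈ Finset.Ico 1 k, δ τ * ((φ s).ofLp ⬝ᵥ M *ᵥ (φ (z τ)).ofLp))
  linarith

end Regression

/-! ### Information along a run -/

section Info

variable {S A Ω : Type*} [MeasurableSpace S] [MeasurableSpace A] {H : ℕ}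
  {x : ℕ → ℕ → Ω → S} {act : ℕ → ℕ → Ω → A × A} {k h : ℕ}

theorem measurable_state_preInfo_of_lt {τ t : ℕ} (hτ : τ ∈ Set.Ico 1 k)
    (ht : t ∈ Set.Icc 1 (H + 1)) : Measurable[preInfo H x act k h] (x τ t) := by
  rw [measurable_iff_comap_le]
  refine le_trans ?_ (le_sup_left.trans le_sup_left)
  refine le_trans ?_ (le_iSup₂_of_le τ hτ le_rfl)
  exact le_sup_of_le_left (le_iSup₂_of_le t ht le_rfl)

theorem measurable_act_preInfo_of_lt {τ t : ℕ} (hτ : τ ∈ Set.Ico 1 k)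
    (ht : t ∈ Set.Icc 1 H) : Measurable[preInfo H x act k h] (act τ t) := by
  rw [measurable_iff_comap_le]
  refine le_trans ?_ (le_sup_left.trans le_sup_left)
  refine le_trans ?_ (le_iSup₂_of_le τ hτ le_rfl)
  exact le_sup_of_le_right (le_iSup₂_of_le t ht le_rfl)

theorem measurable_state_preInfo {t : ℕ} (ht : t ∈ Set.Icc 1 h) :
    Measurable[preInfo H x act k h] (x k t) := by
  rw [measurable_iff_comap_le]
  refine le_trans ?_ (le_sup_right.trans le_sup_left)
  exact le_iSup₂_of_le t ht le_rfl

theorem measurable_act_preInfo {t : ℕ} (ht : t ∈ Set.Ico 1 h) :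
    Measurable[preInfo H x act k h] (act k t) := by
  rw [measurable_iff_comap_le]
  refine le_trans ?_ le_sup_right
  exact le_iSup₂_of_le t ht le_rfl

theorem preInfo_le {m : MeasurableSpace Ω} {k' h' : ℕ}
    (h1 : ∀ τ ∈ Set.Ico 1 k', ∀ t ∈ Set.Icc 1 (H + 1), Measurable[m] (x τ t))
    (h2 : ∀ τ ∈ Set.Ico 1 k', ∀ t ∈ Set.Icc 1 H, Measurable[m] (act τ t))
    (h3 : ∀ t ∈ Set.Icc 1 h', Measurable[m] (x k' t))
    (h4 : ∀ t ∈ Set.Ico 1 h', Measurable[m] (act k' t)) : preInfo H x act k' h' ≤ m := by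
  refine sup_le (sup_le (iSup₂_le fun τ hτ => sup_le ?_ ?_) ?_) ?_
  · exact iSup₂_le fun t ht => (h1 τ hτ t ht).comap_le
  · exact iSup₂_le fun t ht => (h2 τ hτ t ht).comap_le
  · exact iSup₂_le fun t ht => (h3 t ht).comap_le
  · exact iSup₂_le fun t ht => (h4 t ht).comap_le

theorem preInfo_mono {h' : ℕ} (hh : h ≤ h') : preInfo H x act k h ≤ preInfo H x act k h' :=
  preInfo_le (fun _ hτ _ ht => measurable_state_preInfo_of_lt hτ ht)
    (fun _ hτ _ ht => measurable_act_preInfo_of_lt hτ ht)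
    (fun _ ht => measurable_state_preInfo ⟨ht.1, ht.2.trans hh⟩)
    (fun _ ht => measurable_act_preInfo ⟨ht.1, ht.2.trans_le hh⟩)

theorem preInfo_le_postInfo : preInfo H x act k h ≤ postInfo H x act k h := le_sup_left

theorem measurable_act_postInfo : Measurable[postInfo H x act k h] (act k h) := by
  rw [measurable_iff_comap_le]
  exact le_sup_right

theorem postInfo_le_preInfo_succ (hk : 1 ≤ k) (hh : h ∈ Finset.Icc 1 H) (h' : ℕ) :
    postInfo H x act k h ≤ preInfo H x act (k + 1) h' := by
  rw [Finset.mem_Icc] at hh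
  refine sup_le (preInfo_le ?_ ?_ ?_ ?_) ?_
  · exact fun τ hτ t ht => measurable_state_preInfo_of_lt ⟨hτ.1, hτ.2.trans (by omega)⟩ ht
  · exact fun τ hτ t ht => measurable_act_preInfo_of_lt ⟨hτ.1, hτ.2.trans (by omega)⟩ ht
  · exact fun t ht => measurable_state_preInfo_of_lt ⟨hk, by omega⟩ ⟨ht.1, by have := ht.2; omega⟩
  · exact fun t ht => measurable_act_preInfo_of_lt ⟨hk, by omega⟩ ⟨ht.1, by have := ht.2; omega⟩
  · exact (measurable_act_preInfo_of_lt ⟨hk, by omega⟩ ⟨hh.1, hh.2⟩).comap_le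

end Info

/-! ### Exponential steps for conditionally centered increments -/

section CenteredStep

theorem measurable_integral_kernel {Ω E : Type*} {m : MeasurableSpace Ω} [MeasurableSpace E]
    {κ : Kernel Ω E} (hκ : IsMarkovKernel κ) {F : Ω → E → ℝ}
    (hF : Measurable fun p : Ω × E => F p.1 p.2) : Measurable fun ω => ∫ y, F ω y ∂(κ ω) :=
  hF.stronglyMeasurable.integral_kernel_prod_right'.measurable

theorem measurable_centered {Ω E : Type*} {m : MeasurableSpace Ω} [MeasurableSpace E]
    {κ : Kernel Ω E} (hκ : IsMarkovKernel κ) {F : Ω → E → ℝ} {t : Ω → ℝ} (B : ℝ)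
    (hF : Measurable fun p : Ω × E => F p.1 p.2) (ht : Measurable t) :
    Measurable fun p : Ω × E =>
      t p.1 * (F p.1 p.2 - ∫ y, F p.1 y ∂(κ p.1)) - t p.1 ^ 2 * B ^ 2 / 2 := by
  have hfst : Measurable (Prod.fst : Ω × E → Ω) := measurable_fst
  have h1 := (measurable_integral_kernel hκ hF).comp hfst
  have h2 := ht.comp hfst
  exact (h2.mul (hF.sub h1)).sub (((h2.pow_const 2).mul_const _).div_const _)

theorem measurable_id_prodMk {Ω E : Type*} {m m' : MeasurableSpace Ω} [MeasurableSpace E]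
    (hle : m ≤ m') {X : Ω → E} (hX : Measurable[m'] X) :
    @Measurable _ _ m' (m.prod inferInstance) fun ω => (ω, X ω) :=
  Measurable.prod (measurable_id'' hle) hX

theorem measurable_comp_pair {Ω E : Type*} {m m' : MeasurableSpace Ω} [MeasurableSpace E]
    (hle : m ≤ m') {F : Ω × E → ℝ} (hF : @Measurable _ _ (m.prod inferInstance) _ F) {X : Ω → E}
    (hX : Measurable[m'] X) : Measurable[m'] fun ω => F (ω, X ω) :=
  hF.comp (measurable_id_prodMk hle hX)

theorem measurable_embed_state {Ω S E : Type*} {m m' : MeasurableSpace Ω} [MeasurableSpace S]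
    [MeasurableSpace E] (hle : m ≤ m') {X : Ω → S} (hX : Measurable[m'] X) :
    @Measurable _ _ (m'.prod inferInstance) (m.prod inferInstance)
      fun p : Ω × E => (p.1, X p.1, p.2) :=
  Measurable.prod ((measurable_id'' hle).comp (@measurable_fst Ω E m' _))
    ((hX.comp (@measurable_fst Ω E m' _)).prodMk (@measurable_snd Ω E m' _))

/-- Hoeffding's lemma, conditionally on `m`: centered increments with bounded range, scaled by an
`m`-measurable factor, make an exponential supermartingale step. -/
theorem lintegral_mul_exp_centered_le {Ω E : Type*} {m0 : MeasurableSpace Ω} [MeasurableSpace E]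
    (P : Measure Ω) [IsProbabilityMeasure P] {X : Ω → E} (hX : Measurable X)
    {m : MeasurableSpace Ω} (hm : m ≤ m0) {κ : @Kernel Ω E m _} (hκ : @IsMarkovKernel Ω E m _ κ)
    (hlaw : ∀ B, MeasurableSet B → P[Set.indicator (X ⁻¹' B) (fun _ => (1 : ℝ)) | m] =ᵐ[P]
      fun ω => (κ ω).real B) {F : Ω → E → ℝ} {t : Ω → ℝ} {B : ℝ}
    (hF : @Measurable _ _ (m.prod inferInstance) _ fun p : Ω × E => F p.1 p.2)
    (ht : Measurable[m] t) (hB : ∀ ω y, |F ω y| ≤ B) {W : Ω → ENNReal} (hW : Measurable[m] W) :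
    ∫⁻ ω, W ω * ENNReal.ofReal (Real.exp (t ω * (F ω (X ω) -
        ∫ y, F ω y ∂(κ ω)) - t ω ^ 2 * B ^ 2 / 2)) ∂P ≤ ∫⁻ ω, W ω ∂P := by
  refine lintegral_mul_exp_le P hX hm κ hlaw (measurable_centered hκ B hF ht) ?_ hW
  intro ω
  have : IsProbabilityMeasure (κ ω) := hκ.isProbabilityMeasure ω
  exact lintegral_exp_centered_le_one (κ ω)
    (hF.comp (@measurable_prodMk_left Ω E m _ ω)) (hB ω) (t ω)

theorem isMarkovKernel_comap {Ω E E' : Type*} {m : MeasurableSpace Ω} [MeasurableSpace E]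
    [MeasurableSpace E'] (κ : Kernel E' E) (hκ : IsMarkovKernel κ) {g : Ω → E'}
    (hg : Measurable g) : IsMarkovKernel (κ.comap g hg) := inferInstance

theorem exists_kernel_of_measurable_apply {Ω E : Type*} {m : MeasurableSpace Ω}
    [MeasurableSpace E] (f : Ω → Measure E) (hf : ∀ ω, IsProbabilityMeasure (f ω))
    (hm : ∀ B, MeasurableSet B → Measurable fun ω => f ω B) :
    ∃ κ : Kernel Ω E, IsMarkovKernel κ ∧ ∀ ω, κ ω = f ω :=
  ⟨⟨f, Measure.measurable_of_measurable_coe _ hm⟩, ⟨hf⟩, fun _ => rfl⟩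

end CenteredStep

/-! ### Conditional laws along a run -/

section RunLaws

variable {S A Ω : Type*} [MeasurableSpace S] [MeasurableSpace A]
  [m0 : MeasurableSpace Ω] {P : Measure Ω}
  {G : MarkovGame S A} {d : ℕ} {φ : S × A × A → EuclideanSpace ℝ (Fin d)} {β ε : ℝ} {K : ℕ}
  {N : ℕ → Set (S × A × A → ℝ)}
  {cce : (S × A × A → ℝ) → (S × A × A → ℝ) → StochKernel S (A × A)}
  {x : ℕ → ℕ → Ω → S} {act : ℕ → ℕ → Ω → A × A} {σ : ℕ → Ω → Policy S (A × A)}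

/-- A random kernel with finitely many values is jointly measurable as soon as the event of each
value is measurable; no σ-algebra on the space of kernels is needed. -/
theorem measurable_of_finite_range {Ω' S E : Type*} [MeasurableSpace Ω'] [MeasurableSpace S]
    [MeasurableSpace E] {f : Ω' → StochKernel S E} {F : Set (StochKernel S E)} (hF : F.Finite)
    (hf : ∀ ω, f ω ∈ F) (hm : ∀ κ, MeasurableSet {ω | f ω = κ}) {B : Set E}
    (hB : MeasurableSet B) : Measurable fun p : Ω' × S => (f p.1).1 p.2 B := by
  classical
  have heq : (fun p : Ω' × S => (f p.1).1 p.2 B) = fun p => ∑ κ ∈ hF.toFinset,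
      ({ω | f ω = κ}.indicator (fun _ => (1 : ENNReal)) p.1) * κ.1 p.2 B := by
    ext p
    rw [Finset.sum_eq_single (f p.1)]
    · simp
    · intro κ _ hκ
      rw [Set.indicator_of_notMem (fun h => hκ (by exact (show f p.1 = κ from h).symm)), zero_mul]
    · intro h
      exact absurd (hF.mem_toFinset.2 (hf p.1)) h
  rw [heq]
  refine Finset.measurable_sum _ fun κ _ => ?_
  exact ((measurable_const.indicator (hm κ)).comp measurable_fst).mul
    ((κ.1.measurable_coe hB).comp measurable_snd)

namespace IsOmniRun

variable (hrun : IsOmniRun P G φ β ε K N cce x act σ)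

include hrun

theorem preInfo_le_ambient (k h : ℕ) : preInfo G.horizon x act k h ≤ m0 :=
  preInfo_le (fun τ _ t _ => hrun.measurable_state τ t) (fun τ _ t _ => hrun.measurable_act τ t)
    (fun t _ => hrun.measurable_state k t) (fun t _ => hrun.measurable_act k t)

theorem postInfo_le_ambient (k h : ℕ) : postInfo G.horizon x act k h ≤ m0 :=
  sup_le (hrun.preInfo_le_ambient k h) (hrun.measurable_act k h).comap_le

/-- Exponential supermartingale step for a function of the next state. -/
theorem lintegral_mul_exp_state_le [IsProbabilityMeasure P] {k : ℕ} (hk : k ∈ Finset.Icc 1 K)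
    {h : ℕ} (hh : h ∈ Finset.Icc 1 G.horizon) {F : Ω → S → ℝ} {t : Ω → ℝ} {B : ℝ}
    (hF : @Measurable _ _ ((postInfo G.horizon x act k h).prod inferInstance) _
      fun p : Ω × S => F p.1 p.2)
    (ht : Measurable[postInfo G.horizon x act k h] t) (hB : ∀ ω y, |F ω y| ≤ B) :
    (∀ W : Ω → ENNReal, Measurable[postInfo G.horizon x act k h] W →
      ∫⁻ ω, W ω * ENNReal.ofReal (Real.exp (t ω * (F ω (x k (h + 1) ω) -
        ∫ y, F ω y ∂((G.trans h).1 (x k h ω, act k h ω))) - t ω ^ 2 * B ^ 2 / 2)) ∂P ≤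
        ∫⁻ ω, W ω ∂P) ∧
    (1 ≤ k → Measurable[postInfo G.horizon x act (k + 1) h] fun ω => t ω * (F ω (x k (h + 1) ω) -
        ∫ y, F ω y ∂((G.trans h).1 (x k h ω, act k h ω))) - t ω ^ 2 * B ^ 2 / 2) := by
  have hh' := Finset.mem_Icc.1 hh
  have hz : Measurable[postInfo G.horizon x act k h] fun ω => (x k h ω, act k h ω) :=
    ((measurable_state_preInfo ⟨hh'.1, le_rfl⟩).mono preInfo_le_postInfo le_rfl).prodMk
      measurable_act_postInfo
  have hκ := isMarkovKernel_comap (G.trans h).1 (G.trans h).2 hz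
  refine ⟨fun W hW => ?_, fun hk1 => ?_⟩
  · exact lintegral_mul_exp_centered_le P (hrun.measurable_state k (h + 1))
      (hrun.postInfo_le_ambient k h) hκ (hrun.state_law k hk h hh) hF ht hB hW
  · refine measurable_comp_pair ((postInfo_le_preInfo_succ hk1 hh h).trans preInfo_le_postInfo)
      (measurable_centered hκ B hF ht) ?_
    exact (measurable_state_preInfo_of_lt ⟨hk1, by omega⟩ ⟨by omega, by omega⟩).mono
        preInfo_le_postInfo le_rfl

variable [DiscreteMeasurableSpace A] [Finite A]

theorem measurable_policy_apply {k : ℕ} (hk : k ∈ Finset.Icc 1 K) (hN : (N k).Finite) {h : ℕ}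
    (hh : h ∈ Finset.Icc 1 G.horizon) (B : Set (A × A)) :
    @Measurable _ _ ((preInfo G.horizon x act k 1).prod inferInstance) _
      fun p : Ω × S => (σ k p.1 h).1 p.2 B := by
  refine @measurable_of_finite_range Ω S (A × A) (preInfo G.horizon x act k 1) _ _
    (fun ω => σ k ω h) (Set.image2 cce (N k) (N k)) (hN.image2 _ hN) ?_ ?_ B (.of_discrete)
  · intro ω
    obtain ⟨q, hq, q', hq', -, -, h3⟩ := hrun.policy_eq k hk h hh ω
    exact ⟨q, hq, q', hq', h3.symm⟩
  · exact hrun.policy_measurable k hk h hh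

theorem measurable_policy_singleton {k : ℕ} (hk : k ∈ Finset.Icc 1 K) (hN : (N k).Finite) {h : ℕ}
    (hh : h ∈ Finset.Icc 1 G.horizon) (ab : A × A) :
    @Measurable _ _ ((preInfo G.horizon x act k 1).prod inferInstance) _
      fun p : Ω × S => ((σ k p.1 h).1 p.2).real {ab} :=
  (hrun.measurable_policy_apply hk hN hh {ab}).ennreal_toReal

theorem measurable_vEst_run (hφ : Measurable φ) {k : ℕ} (hk : k ∈ Finset.Icc 1 K)
    (hN : (N k).Finite) (ρ : ℝ) {h : ℕ} (hh : 1 ≤ h) :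
    @Measurable _ _ ((preInfo G.horizon x act k 1).prod inferInstance) _
      fun p : Ω × S => vEst G φ β (fun τ t => x τ t p.1) (fun τ t => act τ t p.1) k ρ
        (σ k p.1) h p.2 := by
  refine @measurable_vEst_joint S A _ _ d φ G β Ω (preInfo G.horizon x act k 1) x act k ρ _ _ _
    hφ ?_ ?_ ?_ h hh
  · intro τ hτ t ht
    rw [Finset.mem_Ico] at hτ
    rw [Finset.mem_Icc] at ht
    exact measurable_state_preInfo_of_lt hτ ht
  · intro τ hτ t ht
    rw [Finset.mem_Ico] at hτ
    rw [Finset.mem_Icc] at ht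
    exact measurable_act_preInfo_of_lt hτ ht
  · exact fun h hh ab => hrun.measurable_policy_singleton hk hN hh ab

theorem measurable_qEst_run (hφ : Measurable φ) {k : ℕ} (hk : k ∈ Finset.Icc 1 K)
    (hN : (N k).Finite) (ρ : ℝ) {h : ℕ} (hh : h ∈ Finset.Icc 1 G.horizon) :
    @Measurable _ _ ((preInfo G.horizon x act k 1).prod inferInstance) _
      fun p : Ω × (S × A × A) => qEst G φ β (fun τ t => x τ t p.1) (fun τ t => act τ t p.1) k ρ
        (σ k p.1) h p.2 := by
  refine @measurable_qEst_joint S A _ _ d φ G β Ω (preInfo G.horizon x act k 1) x act k ρ _ _ _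
    hφ ?_ ?_ ?_ h hh
  · intro τ hτ t ht
    rw [Finset.mem_Ico] at hτ
    rw [Finset.mem_Icc] at ht
    exact measurable_state_preInfo_of_lt hτ ht
  · intro τ hτ t ht
    rw [Finset.mem_Ico] at hτ
    rw [Finset.mem_Icc] at ht
    exact measurable_act_preInfo_of_lt hτ ht
  · exact fun h hh ab => hrun.measurable_policy_singleton hk hN hh ab

variable [IsProbabilityMeasure P]

/-- The conditional law of the actions, from its values at single pairs of actions. -/
theorem condExp_act_mem {k : ℕ} (hk : k ∈ Finset.Icc 1 K) {h : ℕ}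
    (hh : h ∈ Finset.Icc 1 G.horizon) (B : Set (A × A)) :
    P[Set.indicator (act k h ⁻¹' B) (fun _ => (1 : ℝ)) | preInfo G.horizon x act k h]
      =ᵐ[P] fun ω => ((σ k ω h).1 (x k h ω)).real B := by
  classical
  have hB : B.Finite := Set.toFinite B
  have h1 : Set.indicator (act k h ⁻¹' B) (fun _ => (1 : ℝ)) =
      ∑ ab ∈ hB.toFinset, Set.indicator {ω | act k h ω = ab} (fun _ => (1 : ℝ)) := by
    ext ω
    rw [Finset.sum_apply]
    by_cases hω : act k h ω ∈ B
    · rw [Set.indicator_of_mem (by exact hω), Finset.sum_eq_single (act k h ω)]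
      · simp
      · intro ab _ hne
        exact Set.indicator_of_notMem (fun h => hne (by exact (show act k _ ω = ab from h).symm)) _
      · intro hn
        exact absurd (hB.mem_toFinset.2 hω) hn
    · rw [Set.indicator_of_notMem (by exact hω), Finset.sum_eq_zero]
      intro ab hab
      refine Set.indicator_of_notMem (fun h => hω ?_) _
      rw [show act k _ ω = ab from h]
      exact hB.mem_toFinset.1 hab
  rw [h1]
  have h2 := condExp_finsetSum (μ := P) (s := hB.toFinset)
    (f := fun ab => Set.indicator {ω | act k h ω = ab} (fun _ => (1 : ℝ)))
    (fun ab _ => (integrable_const (1 : ℝ)).indicator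
      (hrun.measurable_act k h (measurableSet_singleton ab))) (preInfo G.horizon x act k h)
  refine h2.trans ?_
  have h3 : ∀ᵐ ω ∂P, ∀ ab ∈ hB.toFinset,
      (P[Set.indicator {ω | act k h ω = ab} (fun _ => (1 : ℝ)) | preInfo G.horizon x act k h]) ω =
        ((σ k ω h).1 (x k h ω)).real {ab} :=
    (Filter.eventually_all_finset _).2 fun ab _ => hrun.act_law k hk h hh ab
  filter_upwards [h3] with ω hω
  rw [Finset.sum_apply, Finset.sum_congr rfl hω, sum_measureReal_singleton, Set.Finite.coe_toFinset]

/-- Exponential supermartingale step for a function of the actions. -/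
theorem lintegral_mul_exp_act_le {k : ℕ} (hk : k ∈ Finset.Icc 1 K) (hN : (N k).Finite) {h : ℕ}
    (hh : h ∈ Finset.Icc 1 G.horizon) {F : Ω → A × A → ℝ} (t : ℝ) {B : ℝ}
    (hF : @Measurable _ _ ((preInfo G.horizon x act k h).prod inferInstance) _
      fun p : Ω × (A × A) => F p.1 p.2)
    (hB : ∀ ω y, |F ω y| ≤ B) :
    (∀ W : Ω → ENNReal, Measurable[preInfo G.horizon x act k h] W →
      ∫⁻ ω, W ω * ENNReal.ofReal (Real.exp (t * (F ω (act k h ω) -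
        ∫ y, F ω y ∂((σ k ω h).1 (x k h ω))) - t ^ 2 * B ^ 2 / 2)) ∂P ≤
        ∫⁻ ω, W ω ∂P) ∧
    Measurable[preInfo G.horizon x act (k + 1) h] fun ω => t * (F ω (act k h ω) -
        ∫ y, F ω y ∂((σ k ω h).1 (x k h ω))) - t ^ 2 * B ^ 2 / 2 := by
  have hh' := Finset.mem_Icc.1 hh
  have hk1 := (Finset.mem_Icc.1 hk).1
  obtain ⟨κ, hκ, hκσ⟩ := exists_kernel_of_measurable_apply
    (m := preInfo G.horizon x act k h) (fun ω => (σ k ω h).1 (x k h ω)) (fun ω => inferInstance)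
    fun B _ => (hrun.measurable_policy_apply hk hN hh B).comp
      (measurable_id_prodMk (preInfo_mono hh'.1) (measurable_state_preInfo ⟨hh'.1, le_rfl⟩))
  simp_rw [← hκσ]
  refine ⟨fun W hW => ?_, ?_⟩
  · refine lintegral_mul_exp_centered_le P (hrun.measurable_act k h) (hrun.preInfo_le_ambient k h)
      hκ (fun B _ => ?_) hF (measurable_const (a := t)) hB hW
    simp_rw [hκσ]
    exact hrun.condExp_act_mem hk hh B
  · refine measurable_comp_pair (preInfo_le_postInfo.trans (postInfo_le_preInfo_succ hk1 hh h))
      (measurable_centered hκ B hF (measurable_const (a := t))) ?_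
    exact measurable_act_preInfo_of_lt ⟨hk1, by omega⟩ ⟨hh'.1, hh'.2⟩

end IsOmniRun
end RunLaws

/-! ### Regret decomposition -/

section Regret

variable {S A Ω : Type*} {d : ℕ} {φ : S × A × A → EuclideanSpace ℝ (Fin d)}

/-- Summing elliptical norms along a run. -/
theorem sum_ellNorm_le (hφ : ∀ s, ‖φ s‖ ≤ 1) (x : ℕ → ℕ → S) (act : ℕ → ℕ → A × A) (h K : ℕ) :
    ∑ k ∈ Finset.Icc 1 K, ellNorm φ x act k h (x k h, act k h) ≤
      √(K * (2 * (d * Real.log (1 + K)))) := by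
  apply Real.le_sqrt_of_sq_le
  refine (sq_sum_le_card_mul_sum_sq).trans ?_
  rw [Nat.card_Icc, Nat.add_sub_cancel]
  gcongr
  refine le_trans (le_of_eq ?_) (sum_gram_inv_quad_le φ (fun τ => (x τ h, act τ h)) hφ K)
  refine Finset.sum_congr rfl fun k _ => ?_
  unfold ellNorm
  rw [Real.sq_sqrt]
  exact (gram_inv_posSemidef φ _ k).quad_nonneg _

variable [MeasurableSpace S] [MeasurableSpace A] {G : MarkovGame S A} {β : ℝ}
  {x : ℕ → ℕ → Ω → S} {act : ℕ → ℕ → Ω → A × A} {σ : ℕ → Ω → Policy S (A × A)}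

/-- Width of the confidence interval of the value function in a run. -/
def vGap (G : MarkovGame S A) (φ : S × A × A → EuclideanSpace ℝ (Fin d)) (β : ℝ)
    (x : ℕ → ℕ → Ω → S) (act : ℕ → ℕ → Ω → A × A) (σ : ℕ → Ω → Policy S (A × A)) (k h : ℕ)
    (ω : Ω) (y : S) : ℝ :=
  vEst G φ β (fun τ t => x τ t ω) (fun τ t => act τ t ω) k 1 (σ k ω) h y -
    vEst G φ β (fun τ t => x τ t ω) (fun τ t => act τ t ω) k (-1) (σ k ω) h y

/-- Width of the confidence interval of the Q function in a run. -/
def qGap (G : MarkovGame S A) (φ : S × A × A → EuclideanSpace ℝ (Fin d)) (β : ℝ)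
    (x : ℕ → ℕ → Ω → S) (act : ℕ → ℕ → Ω → A × A) (σ : ℕ → Ω → Policy S (A × A)) (k h : ℕ)
    (ω : Ω) (s : S × A × A) : ℝ :=
  qEst G φ β (fun τ t => x τ t ω) (fun τ t => act τ t ω) k 1 (σ k ω) h s -
    qEst G φ β (fun τ t => x τ t ω) (fun τ t => act τ t ω) k (-1) (σ k ω) h s

variable [DiscreteMeasurableSpace A] [Finite A]

/-- Regret decomposition: on the event that the bonuses dominate, the width of the confidence
interval at the first step is a sum of action noise, next-state noise and bonuses. -/
theorem vGap_one_le (hφ : Measurable φ) (hβ0 : 0 ≤ β) {k : ℕ} {ω : Ω}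
    (hβ : BonusDominates G φ β (fun τ t => x τ t ω) (fun τ t => act τ t ω) k (σ k ω)) :
    vGap G φ β x act σ k 1 ω (x k 1 ω) ≤ ∑ h ∈ Finset.Icc 1 G.horizon,
      ((∫ ab, qGap G φ β x act σ k h ω (x k h ω, ab) ∂((σ k ω h).1 (x k h ω)) -
          qGap G φ β x act σ k h ω (x k h ω, act k h ω)) +
        (∫ y, vGap G φ β x act σ k (h + 1) ω y ∂((G.trans h).1 (x k h ω, act k h ω)) -
          vGap G φ β x act σ k (h + 1) ω (x k (h + 1) ω)) +
        4 * β * ellNorm φ (fun τ t => x τ t ω) (fun τ t => act τ t ω) k h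
          (x k h ω, act k h ω)) := by
  have key : ∀ n ≤ G.horizon, vGap G φ β x act σ k 1 ω (x k 1 ω) ≤
      ∑ h ∈ Finset.Icc 1 n,
      ((∫ ab, qGap G φ β x act σ k h ω (x k h ω, ab) ∂((σ k ω h).1 (x k h ω)) -
          qGap G φ β x act σ k h ω (x k h ω, act k h ω)) +
        (∫ y, vGap G φ β x act σ k (h + 1) ω y ∂((G.trans h).1 (x k h ω, act k h ω)) -
          vGap G φ β x act σ k (h + 1) ω (x k (h + 1) ω)) +
        4 * β * ellNorm φ (fun τ t => x τ t ω) (fun τ t => act τ t ω) k h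
          (x k h ω, act k h ω)) + vGap G φ β x act σ k (n + 1) ω (x k (n + 1) ω) := by
    intro n hn
    induction n with
    | zero => simp
    | succ n ih =>
      have h0 := ih (by omega)
      have hh : n + 1 ∈ Finset.Icc 1 G.horizon := by simp; omega
      rw [Finset.sum_Icc_succ_top (by omega)]
      have h1 : vGap G φ β x act σ k (n + 1) ω (x k (n + 1) ω) =
          ∫ ab, qGap G φ β x act σ k (n + 1) ω (x k (n + 1) ω, ab)
            ∂((σ k ω (n + 1)).1 (x k (n + 1) ω)) := by
        unfold vGap qGap
        rw [vEst_eq _ _ _ _ _ _ _ _ hh, vEst_eq _ _ _ _ _ _ _ _ hh,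
          integral_sub Integrable.of_finite Integrable.of_finite]
      have h2 := qEst_sub_le hφ hβ0 hβ hh (x k (n + 1) ω, act k (n + 1) ω)
      change qGap G φ β x act σ k (n + 1) ω (x k (n + 1) ω, act k (n + 1) ω) ≤
        ∫ y, vGap G φ β x act σ k (n + 1 + 1) ω y
          ∂((G.trans (n + 1)).1 (x k (n + 1) ω, act k (n + 1) ω)) + _ at h2
      linarith
  have h := key G.horizon le_rfl
  have h0 : vGap G φ β x act σ k (G.horizon + 1) ω (x k (G.horizon + 1) ω) = 0 := by
    unfold vGap
    rw [vEst_horizon_succ, vEst_horizon_succ, sub_zero]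
  rwa [h0, add_zero] at h

end Regret

/-! ### Deviation bounds along a run -/

section Deviation

variable {S A Ω : Type*} [MeasurableSpace S] [MeasurableSpace A] [m0 : MeasurableSpace Ω]
  {P : Measure Ω} [IsProbabilityMeasure P]
  {G : MarkovGame S A} {d : ℕ} {φ : S × A × A → EuclideanSpace ℝ (Fin d)} {β ε : ℝ} {K : ℕ}
  {N : ℕ → Set (S × A × A → ℝ)}
  {cce : (S × A × A → ℝ) → (S × A × A → ℝ) → StochKernel S (A × A)}
  {x : ℕ → ℕ → Ω → S} {act : ℕ → ℕ → Ω → A × A} {σ : ℕ → Ω → Policy S (A × A)}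

namespace IsOmniRun

variable (hrun : IsOmniRun P G φ β ε K N cce x act σ)

include hrun

/-- Deviation bound, in a fixed direction `u`, for the noise of a fixed value function. -/
theorem measure_noise_gt_le (hφ : Measurable φ) {h : ℕ} (hh : h ∈ Finset.Icc 1 G.horizon)
    {k : ℕ} (hk : k ≤ K + 1) {W : S → ℝ} (hW : Measurable W) {B : ℝ} (hB : ∀ y, |W y| ≤ B)
    (u : Fin d → ℝ) (Γ : ℝ) :
    P {ω | Γ < ∑ τ ∈ Finset.Ico 1 k, ((u ⬝ᵥ (φ (x τ h ω, act τ h ω)).ofLp) *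
        (W (x τ (h + 1) ω) - ∫ y, W y ∂((G.trans h).1 (x τ h ω, act τ h ω))) -
        B ^ 2 / 2 * (u ⬝ᵥ (φ (x τ h ω, act τ h ω)).ofLp) ^ 2)} ≤
      ENNReal.ofReal (Real.exp (-Γ)) := by
  have hh' := Finset.mem_Icc.1 hh
  have hstep : ∀ τ ∈ Finset.Ico 1 k, _ := fun τ hτ =>
    hrun.lintegral_mul_exp_state_le (k := τ) (by simp at hτ ⊢; omega) hh (F := fun _ => W)
      (t := fun ω => u ⬝ᵥ (φ (x τ h ω, act τ h ω)).ofLp) (B := B)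
      (hW.comp (@measurable_snd Ω S (postInfo G.horizon x act τ h) _))
      (by
        have hz : Measurable[postInfo G.horizon x act τ h] fun ω => (x τ h ω, act τ h ω) :=
          ((measurable_state_preInfo ⟨hh'.1, le_rfl⟩).mono preInfo_le_postInfo le_rfl).prodMk
            measurable_act_postInfo
        exact Finset.measurable_sum _ fun i _ =>
          measurable_const.mul ((measurable_feature_apply hφ i).comp hz))
      (fun _ => hB)
  have h1 := measure_sum_gt_le P (fun τ => postInfo G.horizon x act τ h)
    (fun τ => hrun.postInfo_le_ambient τ h)
    (fun τ hτ => (postInfo_le_preInfo_succ hτ hh h).trans preInfo_le_postInfo) _ k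
    (fun τ hτ => (hstep τ hτ).2 (Finset.mem_Ico.1 hτ).1) (fun τ hτ => (hstep τ hτ).1) Γ
  refine le_trans (le_of_eq ?_) h1
  congr 1
  ext ω
  simp only [Set.mem_ofPred_eq]
  refine iff_of_eq (congrArg (Γ < ·) (Finset.sum_congr rfl fun τ _ => ?_))
  ring

variable [DiscreteMeasurableSpace A] [Finite A]

/-- Azuma–Hoeffding bound for the next-state noise in the regret decomposition. -/
theorem measure_state_noise_gt_le (hφ : Measurable φ) (hN : ∀ k ∈ Finset.Icc 1 K, (N k).Finite)
    {h : ℕ} (hh : h ∈ Finset.Icc 1 G.horizon) (lam Γ : ℝ) :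
    P {ω | Γ < ∑ k ∈ Finset.Ico 1 (K + 1), (-lam * (vGap G φ β x act σ k (h + 1) ω (x k (h + 1) ω) -
        ∫ y, vGap G φ β x act σ k (h + 1) ω y ∂((G.trans h).1 (x k h ω, act k h ω))) -
        (-lam) ^ 2 * (2 * G.horizon) ^ 2 / 2)} ≤ ENNReal.ofReal (Real.exp (-Γ)) := by
  have hh' := Finset.mem_Icc.1 hh
  have hstep : ∀ k ∈ Finset.Ico 1 (K + 1), _ := fun k hk =>
    have hk' : k ∈ Finset.Icc 1 K := by simp at hk ⊢; omega
    hrun.lintegral_mul_exp_state_le hk' hh (F := fun ω => vGap G φ β x act σ k (h + 1) ω)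
      (t := fun ω => -lam) (B := 2 * G.horizon)
      (by
        have h1 := hrun.measurable_vEst_run hφ hk' (hN k hk') 1 (h := h + 1) (by omega)
        have h2 := hrun.measurable_vEst_run hφ hk' (hN k hk') (-1) (h := h + 1) (by omega)
        exact (h1.sub h2).mono
          (sup_le_sup (MeasurableSpace.comap_mono ((preInfo_mono hh'.1).trans preInfo_le_postInfo))
            le_rfl) le_rfl)
      measurable_const
      (fun ω y => by
        have hb := fun ρ => abs_vEst_le G φ β (fun τ t => x τ t ω) (fun τ t => act τ t ω) k
          (σ k ω) ρ (h := h + 1) (by simp; omega) y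
        have := abs_sub (vEst G φ β (fun τ t => x τ t ω) (fun τ t => act τ t ω) k 1 (σ k ω)
          (h + 1) y) (vEst G φ β (fun τ t => x τ t ω) (fun τ t => act τ t ω) k (-1) (σ k ω)
          (h + 1) y)
        unfold vGap
        linarith [hb 1, hb (-1)])
  exact measure_sum_gt_le P (fun τ => postInfo G.horizon x act τ h)
    (fun τ => hrun.postInfo_le_ambient τ h)
    (fun τ hτ => (postInfo_le_preInfo_succ hτ hh h).trans preInfo_le_postInfo) _ (K + 1)
    (fun τ hτ => (hstep τ hτ).2 (Finset.mem_Ico.1 hτ).1) (fun τ hτ => (hstep τ hτ).1) Γ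

/-- Azuma–Hoeffding bound for the action noise in the regret decomposition. -/
theorem measure_act_noise_gt_le (hφ : Measurable φ) (hN : ∀ k ∈ Finset.Icc 1 K, (N k).Finite)
    {h : ℕ} (hh : h ∈ Finset.Icc 1 G.horizon) (lam Γ : ℝ) :
    P {ω | Γ < ∑ k ∈ Finset.Ico 1 (K + 1), (-lam * (qGap G φ β x act σ k h ω (x k h ω, act k h ω) -
        ∫ ab, qGap G φ β x act σ k h ω (x k h ω, ab) ∂((σ k ω h).1 (x k h ω))) -
        (-lam) ^ 2 * (2 * G.horizon) ^ 2 / 2)} ≤ ENNReal.ofReal (Real.exp (-Γ)) := by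
  have hh' := Finset.mem_Icc.1 hh
  have hstep : ∀ k ∈ Finset.Ico 1 (K + 1), _ := fun k hk =>
    have hk' : k ∈ Finset.Icc 1 K := by simp at hk ⊢; omega
    hrun.lintegral_mul_exp_act_le hk' (hN k hk') hh
      (F := fun ω ab => qGap G φ β x act σ k h ω (x k h ω, ab)) (-lam) (B := 2 * G.horizon)
      (by
        have h1 := hrun.measurable_qEst_run hφ hk' (hN k hk') 1 hh
        have h2 := hrun.measurable_qEst_run hφ hk' (hN k hk') (-1) hh
        have hx : Measurable[preInfo G.horizon x act k h] (x k h) :=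
          measurable_state_preInfo ⟨hh'.1, le_rfl⟩
        have h3 := (h1.sub h2).comp (measurable_embed_state (E := A × A) (preInfo_mono hh'.1) hx)
        simp only [Function.comp_def] at h3
        exact h3)
      (fun ω ab => by
        have hb := fun ρ => abs_qEst_le G φ β (fun τ t => x τ t ω) (fun τ t => act τ t ω) k
          (σ k ω) ρ h (x k h ω, ab)
        have := abs_sub (qEst G φ β (fun τ t => x τ t ω) (fun τ t => act τ t ω) k 1 (σ k ω)
          h (x k h ω, ab)) (qEst G φ β (fun τ t => x τ t ω) (fun τ t => act τ t ω) k (-1) (σ k ω)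
          h (x k h ω, ab))
        unfold qGap
        linarith [hb 1, hb (-1)])
  exact measure_sum_gt_le P (fun τ => preInfo G.horizon x act τ h)
    (fun τ => hrun.preInfo_le_ambient τ h)
    (fun τ hτ => preInfo_le_postInfo.trans (postInfo_le_preInfo_succ hτ hh h)) _ (K + 1)
    (fun τ hτ => (hstep τ hτ).2) (fun τ hτ => (hstep τ hτ).1) Γ

end IsOmniRun

end Deviation

/-! ### The bonuses dominate the regression errors -/

section BonusDominates

variable {S A : Type*} [MeasurableSpace S] [MeasurableSpace A] {d : ℕ}
  {G : MarkovGame S A} {φ : S × A × A → EuclideanSpace ℝ (Fin d)} {β ε : ℝ}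
  {θ : ℕ → EuclideanSpace ℝ (Fin d)} {μ : ℕ → Fin d → SignedMeasure S}
  {N : Set (S × A × A → ℝ)}
  {cce : (S × A × A → ℝ) → (S × A × A → ℝ) → StochKernel S (A × A)}

/-- The value function obtained from the payoff `q₃` under the equilibrium rule of the game
`(q₁, q₂)`. These functions, for members of the net, approximate all value estimates. -/
def netValue (cce : (S × A × A → ℝ) → (S × A × A → ℝ) → StochKernel S (A × A))
    (q₁ q₂ q₃ : S × A × A → ℝ) (s : S) : ℝ :=
  ∫ ab, q₃ (s, ab) ∂((cce q₁ q₂).1 s)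

theorem measurable_netValue {q₁ q₂ q₃ : S × A × A → ℝ} (h : Measurable q₃) :
    Measurable (netValue cce q₁ q₂ q₃) :=
  h.stronglyMeasurable.integral_kernel_prod_right'.measurable

theorem abs_netValue_le {q₁ q₂ q₃ : S × A × A → ℝ} {B : ℝ} (h : ∀ s, |q₃ s| ≤ B) (s : S) :
    |netValue cce q₁ q₂ q₃ s| ≤ B :=
  abs_integral_le_of_abs_le' (fun _ => h _) _

theorem measurable_of_mem_qClass (hφ : Measurable φ) {H : ℝ} {k : ℕ} {q : S × A × A → ℝ}
    (hq : q ∈ qClass φ H β k) : Measurable q := by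
  obtain ⟨w, M, ρ, -, -, -, -, rfl⟩ := hq
  exact measurable_linBonus hφ H β ρ (fun _ => measurable_const) (fun _ _ => measurable_const)
    measurable_id

theorem abs_le_of_mem_qClass {S A : Type*} {d : ℕ} {φ : S × A × A → EuclideanSpace ℝ (Fin d)}
    {H β : ℝ} (hH : 0 ≤ H) {k : ℕ} {q : S × A × A → ℝ}
    (hq : q ∈ qClass φ H β k) (s : S × A × A) : |q s| ≤ H := by
  obtain ⟨w, M, ρ, -, -, -, -, rfl⟩ := hq
  exact abs_clip_le hH _

variable [DiscreteMeasurableSpace A] [Finite A]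

/-- If the noise of every net value function is controlled in every direction of a net, the
bonuses dominate all regression errors of the episode. -/
theorem bonusDominates_of_noise_le (hG : G.IsLinear φ θ μ) (hH : 1 ≤ G.horizon) {k K : ℕ}
    (hk : 1 ≤ k) (hkK : k ≤ K) (x : ℕ → ℕ → S) (act : ℕ → ℕ → A × A) (σ : Policy S (A × A))
    (hε : 0 ≤ ε)
    (hσ : ∀ h ∈ Finset.Icc 1 G.horizon, IsFindCCE N ε cce (qEst G φ β x act k 1 σ h)
      (qEst G φ β x act k (-1) σ h) (σ h))
    (hN : N ⊆ qClass φ G.horizon β k) (U : Set (Fin d → ℝ))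
    (hnet : ∀ v : Fin d → ℝ, (∀ i, |v i| ≤ K) →
      ∃ u ∈ U, ∀ i, |v i - u i| ≤ 1 / (4 * d * K * G.horizon)) {Γ R : ℝ}
    (hnoise : ∀ h ∈ Finset.Icc 1 G.horizon, ∀ q₁ ∈ N, ∀ q₂ ∈ N, ∀ q₃ ∈ N, ∀ u ∈ U,
      ∑ τ ∈ Finset.Ico 1 k, ((u ⬝ᵥ (φ (x τ h, act τ h)).ofLp) *
        (netValue cce q₁ q₂ q₃ (x τ (h + 1)) -
          ∫ y, netValue cce q₁ q₂ q₃ y ∂((G.trans h).1 (x τ h, act τ h))) -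
        (G.horizon : ℝ) ^ 2 / 2 * (u ⬝ᵥ (φ (x τ h, act τ h)).ofLp) ^ 2) ≤ Γ)
    (hR0 : 0 ≤ R) (hR : 6 * (G.horizon : ℝ) ^ 2 * (Γ + 1) ≤ R ^ 2)
    (hβ : R + 2 * ε * k + √d + 2 * d * G.horizon ≤ β) :
    BonusDominates G φ β x act k σ := by
  intro ρ hρ h hh s
  have hh' := Finset.mem_Icc.1 hh
  have hHr : (1 : ℝ) ≤ G.horizon := by exact_mod_cast hH
  have hVm := measurable_vEst G β ρ hG.measurable_feature x act k σ (h := h + 1) (by omega)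
  have hVb := abs_vEst_le G φ β x act k σ ρ (h := h + 1) (by simp; omega)
  suffices hW : ∃ W : S → ℝ, Measurable W ∧ (∀ y, |W y| ≤ G.horizon) ∧
      (∀ y, |vEst G φ β x act k ρ σ (h + 1) y - W y| ≤ ε) ∧
      (∑ τ ∈ Finset.Ico 1 k, (W (x τ (h + 1)) -
        ∫ y, W y ∂((G.trans h).1 (x τ h, act τ h))) • (φ (x τ h, act τ h)).ofLp)
      ⬝ᵥ (gram φ (fun τ => (x τ h, act τ h)) k)⁻¹ *ᵥ (∑ τ ∈ Finset.Ico 1 k,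
        (W (x τ (h + 1)) - ∫ y, W y ∂((G.trans h).1 (x τ h, act τ h))) •
          (φ (x τ h, act τ h)).ofLp) ≤ R ^ 2 by
    obtain ⟨W, hWm, hWb, hVW, hnoiseW⟩ := hW
    have h1 := abs_inner_ridge_sub_le hG hh (fun τ => (x τ h, act τ h)) (fun τ => x τ (h + 1)) hk
      hVm hWm hVb hWb hVW hε hR0 hnoiseW s
    exact h1.trans (mul_le_mul_of_nonneg_right hβ (Real.sqrt_nonneg _))
  rcases Nat.lt_or_ge h G.horizon with hlt | hge
  · have hh1 : h + 1 ∈ Finset.Icc 1 G.horizon := by simp; omega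
    obtain ⟨q, hq, q', hq', h1, h2, h3⟩ := hσ (h + 1) hh1
    obtain ⟨q₃, hq₃, hclose⟩ : ∃ q₃ ∈ N, ∀ s, |q₃ s - qEst G φ β x act k ρ σ (h + 1) s| ≤ ε := by
      rcases hρ with rfl | rfl
      · exact ⟨q, hq, h1⟩
      · exact ⟨q', hq', h2⟩
    have hqb := abs_le_of_mem_qClass (by positivity) (hN hq₃)
    refine ⟨netValue cce q q' q₃,
      measurable_netValue (measurable_of_mem_qClass hG.measurable_feature (hN hq₃)),
      abs_netValue_le hqb, fun y => ?_, ?_⟩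
    · rw [vEst_eq G φ β x act k σ ρ hh1, h3, netValue,
        ← integral_sub Integrable.of_finite Integrable.of_finite]
      refine abs_integral_le_of_abs_le' (fun ab => ?_) _
      rw [abs_sub_comm]
      exact hclose _
    · refine le_trans ?_ hR
      refine self_normalized_le_of_net φ (fun τ => (x τ h, act τ h)) hG.norm_feature_le hk hkK hHr
        (fun τ => netValue cce q q' q₃ (x τ (h + 1)) -
          ∫ y, netValue cce q q' q₃ y ∂((G.trans h).1 (x τ h, act τ h))) ?_ U hnet
        (hnoise h hh q hq q' hq' q₃ hq₃)
      intro τ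
      have h4 := abs_sub (netValue cce q q' q₃ (x τ (h + 1)))
        (∫ y, netValue cce q q' q₃ y ∂((G.trans h).1 (x τ h, act τ h)))
      have h5 := abs_integral_le_of_abs_le' (abs_netValue_le (cce := cce) (q₁ := q) (q₂ := q') hqb)
        ((G.trans h).1 (x τ h, act τ h))
      have h6 := abs_netValue_le (cce := cce) (q₁ := q) (q₂ := q') hqb (x τ (h + 1))
      linarith
  · -- at the last step the value estimate of the next step vanishes, and there is no noise
    have hhH : h = G.horizon := le_antisymm hh'.2 hge
    refine ⟨fun _ => 0, measurable_const, fun y => by simp, fun y => ?_, ?_⟩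
    · rw [hhH, vEst_horizon_succ]
      simpa using hε
    · simp only [integral_zero, sub_zero, zero_smul, Finset.sum_const_zero, Matrix.mulVec_zero,
        dotProduct_zero]
      positivity

end BonusDominates

/-! ### Union bounds -/

section UnionBound

theorem measure_biUnion_finset_le_ofReal {Ω I : Type*} [MeasurableSpace Ω] (P : Measure Ω)
    (s : Finset I) (f : I → Set Ω) {c C : ℝ} (hc : 0 ≤ c) (hC : (s.card : ℝ) ≤ C)
    (h : ∀ i ∈ s, P (f i) ≤ ENNReal.ofReal c) :
    P (⋃ i ∈ s, f i) ≤ ENNReal.ofReal (C * c) := by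
  refine (measure_biUnion_finset_le s f).trans ((Finset.sum_le_card_nsmul s _ _ h).trans ?_)
  rw [nsmul_eq_mul, ← ENNReal.ofReal_natCast, ← ENNReal.ofReal_mul (by positivity)]
  exact ENNReal.ofReal_le_ofReal (by gcongr)

end UnionBound

/-! ### The logarithmic factor -/

section Constants

/-- With `L = 2 d K H / p` and `ι = log L`, every polynomial quantity of the analysis is bounded by
a power of `L`; its logarithm is then a multiple of `ι`. -/
structure LogFactor (d H K : ℕ) (p L ι β : ℝ) : Prop where
  one_le_d : 1 ≤ d
  one_le_H : 1 ≤ H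
  one_le_K : 1 ≤ K
  p_pos : 0 < p
  p_lt_one : p < 1
  L_eq : L = 2 * d * (K * H : ℕ) / p
  iota_eq : ι = Real.log L
  beta_eq : β = 128 * d * H * √ι

namespace LogFactor

variable {d H K : ℕ} {p L ι β : ℝ} (h : LogFactor d H K p L ι β)

include h

theorem d_ge : (1 : ℝ) ≤ d := by exact_mod_cast h.one_le_d

theorem H_ge : (1 : ℝ) ≤ H := by exact_mod_cast h.one_le_H

theorem K_ge : (1 : ℝ) ≤ K := by exact_mod_cast h.one_le_K

theorem L_mul_p : L * p = 2 * d * (K * H) := by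
  rw [h.L_eq, div_mul_cancel₀ _ h.p_pos.ne']
  push_cast
  ring

theorem dKH_ge : (1 : ℝ) ≤ d * (K * H) := by
  have h1 := one_le_mul_of_one_le_of_one_le h.K_ge h.H_ge
  exact one_le_mul_of_one_le_of_one_le h.d_ge h1

theorem two_dKH_le : 2 * d * (K * H) ≤ L := by
  have h1 := h.L_mul_p
  have h2 := h.p_pos
  have h3 := h.p_lt_one
  have h4 : 0 ≤ L := by
    rw [h.L_eq]; positivity
  nlinarith

theorem two_le_L : 2 ≤ L := by
  have h1 := h.dKH_ge
  have h2 := h.two_dKH_le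
  linarith

theorem one_le_L : 1 ≤ L := by linarith [h.two_le_L]

theorem two_le_L_mul_p : 2 ≤ L * p := by
  rw [h.L_mul_p]
  linarith [h.dKH_ge]

theorem exp_iota : Real.exp ι = L := by
  rw [h.iota_eq, Real.exp_log (by linarith [h.two_le_L])]

theorem half_le_iota : 1 / 2 ≤ ι := by
  rw [h.iota_eq]
  have h1 := Real.log_le_log (by norm_num) h.two_le_L
  linarith [Real.log_two_gt_d9]

theorem iota_le : ι ≤ L := by
  have := Real.add_one_le_exp ι
  rw [h.exp_iota] at this
  linarith

theorem exp_neg_nat_mul_iota (n : ℕ) : Real.exp (-(n * ι)) = (L ^ n)⁻¹ := by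
  rw [Real.exp_neg, Real.exp_nat_mul, h.exp_iota]

theorem beta_pos : 0 < β := by
  have h1 := h.d_ge
  have h2 := h.H_ge
  have h3 : 0 < √ι := Real.sqrt_pos.2 (by linarith [h.half_le_iota])
  rw [h.beta_eq]
  positivity

theorem beta_le : β ≤ L ^ 9 := by
  have h1 : (128 : ℝ) ≤ L ^ 7 := by
    calc (128 : ℝ) = 2 ^ 7 := by norm_num
      _ ≤ L ^ 7 := by gcongr; exact h.two_le_L
  have h2 : (d * H : ℝ) ≤ L := by
    have h3 := h.two_dKH_le
    have h4 : (d * H : ℝ) ≤ d * (K * H) := by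
      gcongr
      exact le_mul_of_one_le_left (by linarith [h.H_ge]) h.K_ge
    linarith [h.dKH_ge]
  have h5 : √ι ≤ L := by
    rw [Real.sqrt_le_iff]
    refine ⟨by linarith [h.one_le_L], ?_⟩
    have := h.iota_le
    have := h.one_le_L
    nlinarith
  have hL := h.one_le_L
  calc β = 128 * (d * H) * √ι := by rw [h.beta_eq]; ring
    _ ≤ L ^ 7 * L * L := by gcongr
    _ = L ^ 9 := by ring

/-- The nets used by the rounding procedure have at most `L ^ (49 d²)` elements. -/
theorem exists_finset_net {S A : Type*} {φ : S × A × A → EuclideanSpace ℝ (Fin d)}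
    (hφ : ∀ s, ‖φ s‖ ≤ 1) {k : ℕ} (hkK : k ≤ K) {N : Set (S × A × A → ℝ)}
    (hN : IsMinSupCover (qClass φ H β k) (1 / (K * H)) N) :
    ∃ F : Finset (S × A × A → ℝ), ↑F = N ∧ (F.card : ℝ) ≤ L ^ (49 * d ^ 2) := by
  have hd := h.d_ge
  have hH := h.H_ge
  have hK := h.K_ge
  have hβ := h.beta_pos
  have hL := h.one_le_L
  have hL2 := h.two_le_L
  have hT : (0 : ℝ) < K * H := by positivity
  have hT1 : (1 : ℝ) ≤ K * H := one_le_mul_of_one_le_of_one_le hK hH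
  have hdT := h.two_dKH_le
  -- with these widths of the grid, `w` contributes `ε / 4` and `M` contributes `ε / 2`
  set η : ℝ := 1 / (8 * d * (K * H)) with hη
  set η' : ℝ := 1 / (8 * (K * H) ^ 2 * β ^ 2 * d ^ 2) with hη'
  have hη0 : 0 < η := by positivity
  have hη0' : 0 < η' := by positivity
  set m : ℕ := 16 * d ^ 2 * (K * H) ^ 2 with hm
  set m' : ℕ := ⌈β ^ 2 * √d / η'⌉₊ with hm'
  have hcard := encard_qClass_cover_le hφ hβ.le hN hη0 hη0' (m := m) (m' := m') ?_ ?_ ?_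
  · have hfin : N.Finite := Set.finite_of_encard_le_coe hcard
    refine ⟨hfin.toFinset, hfin.coe_toFinset, ?_⟩
    rw [hfin.encard_eq_coe_toFinset_card] at hcard
    have hcard' : hfin.toFinset.card ≤ 2 * ((2 * m + 1) ^ d * (2 * m' + 1) ^ (d * d)) := by
      exact_mod_cast hcard
    have hcard'' : (hfin.toFinset.card : ℝ) ≤ 2 * ((2 * m + 1) ^ d * (2 * m' + 1) ^ (d * d)) := by
      exact_mod_cast hcard'
    have b1 : (2 * m + 1 : ℝ) ≤ L ^ 6 := by
      have e1 : (2 * m + 1 : ℝ) = 8 * (2 * d * (K * H)) ^ 2 + 1 := by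
        rw [hm]; push_cast; ring
      rw [e1]
      have e2 : (2 * d * (K * H) : ℝ) ^ 2 ≤ L ^ 2 := by gcongr
      have e3 : (2 : ℝ) ^ 4 ≤ L ^ 4 := by gcongr
      have e4 : (1 : ℝ) ≤ L ^ 2 := one_le_pow₀ hL
      calc _ ≤ 8 * L ^ 2 + L ^ 2 := by linarith
        _ ≤ L ^ 4 * L ^ 2 := by nlinarith
        _ = L ^ 6 := by ring
    have b2 : (2 * m' + 1 : ℝ) ≤ L ^ 42 := by
      have e1 : (m' : ℝ) ≤ 8 * (K * H) ^ 2 * β ^ 4 * d ^ 3 + 1 := by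
        have e2 := (Nat.ceil_lt_add_one (by positivity : 0 ≤ β ^ 2 * √d / η')).le
        refine e2.trans ?_
        have e3 : √(d : ℝ) ≤ d := Real.sqrt_le_iff.2 ⟨by positivity, by nlinarith⟩
        have e4 : β ^ 2 * √d / η' = 8 * (K * H) ^ 2 * β ^ 4 * d ^ 2 * √d := by
          rw [hη']; field_simp
        rw [e4]
        have e5 : 8 * (K * H) ^ 2 * β ^ 4 * d ^ 2 * √(d : ℝ) ≤
            8 * (K * H) ^ 2 * β ^ 4 * d ^ 2 * d := by gcongr
        linarith
      have e2 : 8 * (K * H) ^ 2 * (d : ℝ) ^ 3 ≤ L ^ 3 := by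
        calc 8 * (K * H) ^ 2 * (d : ℝ) ^ 3 ≤ 8 * (K * H) ^ 2 * (d : ℝ) ^ 3 * (K * H) :=
              le_mul_of_one_le_right (by positivity) hT1
          _ = (2 * d * (K * H)) ^ 3 := by ring
          _ ≤ L ^ 3 := by gcongr
      have e3 : β ^ 4 ≤ (L ^ 9) ^ 4 := by
        have := h.beta_le
        gcongr
      have e4 : 8 * (K * H) ^ 2 * β ^ 4 * d ^ 3 ≤ L ^ 39 := by
        calc 8 * (K * H) ^ 2 * β ^ 4 * d ^ 3 = (8 * (K * H) ^ 2 * (d : ℝ) ^ 3) * β ^ 4 := by ring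
          _ ≤ L ^ 3 * (L ^ 9) ^ 4 := by gcongr
          _ = L ^ 39 := by ring
      have e5 : (1 : ℝ) ≤ L ^ 39 := one_le_pow₀ hL
      have e6 : (2 : ℝ) ^ 3 ≤ L ^ 3 := by gcongr
      calc (2 * m' + 1 : ℝ) ≤ 8 * L ^ 39 := by linarith
        _ ≤ L ^ 3 * L ^ 39 := by nlinarith
        _ = L ^ 42 := by ring
    calc (hfin.toFinset.card : ℝ) ≤ 2 * ((2 * m + 1) ^ d * (2 * m' + 1) ^ (d * d)) := hcard''
      _ ≤ L * ((L ^ 6) ^ d * (L ^ 42) ^ (d * d)) := by gcongr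
      _ = L ^ (1 + 6 * d + 42 * (d * d)) := by ring
      _ ≤ L ^ (49 * d ^ 2) := by
          refine pow_le_pow_right₀ hL ?_
          have := h.one_le_d
          nlinarith
  · have e1 : (d : ℝ) * (2 * η) = 1 / (4 * (K * H)) := by
      rw [hη]; field_simp; norm_num
    have e2 : (d : ℝ) ^ 2 * (2 * η') = (1 / (2 * (K * H) * β)) ^ 2 := by
      rw [hη']; field_simp; norm_num
    have e3 : β * (1 / (2 * (K * H) * β)) = 1 / (2 * (K * H)) := by
      field_simp
    rw [e1, e2, Real.sqrt_sq (by positivity), e3]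
    have e4 : 1 / (4 * ((K : ℝ) * H)) + 1 / (2 * (K * H)) = 3 / 4 * (1 / (K * H)) := by
      field_simp; norm_num
    rw [e4]
    have : 0 < 1 / ((K : ℝ) * H) := by positivity
    linarith
  · have e1 : √((d : ℝ) * k) ≤ d * K := by
      have hk' : (k : ℝ) ≤ K := by exact_mod_cast hkK
      rw [Real.sqrt_le_iff]
      refine ⟨by positivity, ?_⟩
      have e2 : (d * k : ℝ) ≤ d * K := by gcongr
      have e3 : (1 : ℝ) ≤ d * K := one_le_mul_of_one_le_of_one_le hd hK
      nlinarith
    have e2 : η * (m : ℕ) = 2 * d * (K * H) := by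
      rw [hη, hm]; push_cast; field_simp; norm_num
    rw [e2]
    calc 2 * (H : ℝ) * √(d * k) ≤ 2 * H * (d * K) := by gcongr
      _ = _ := by ring
  · have e1 := Nat.le_ceil (β ^ 2 * √d / η')
    rw [div_le_iff₀ hη0'] at e1
    rw [mul_comm η']
    exact e1

/-- A net of directions for the self-normalized bound. -/
theorem exists_direction_net : ∃ U : Finset (Fin d → ℝ), (U.card : ℝ) ≤ L ^ (5 * d ^ 2) ∧
    ∀ v : Fin d → ℝ, (∀ i, |v i| ≤ K) → ∃ u ∈ U, ∀ i, |v i - u i| ≤ 1 / (4 * d * K * H) := by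
  have hd := h.d_ge
  have hH := h.H_ge
  have hK := h.K_ge
  have hL := h.one_le_L
  have hL2 := h.two_le_L
  obtain ⟨U, hU, hnet⟩ := exists_box_net (I := Fin d) (R := K) (η := 1 / (4 * d * K * H))
    (by positivity) (m := 4 * d * (K * H) * K) (by
      push_cast
      apply le_of_eq
      field_simp)
  refine ⟨U, ?_, hnet⟩
  rw [Fintype.card_fin] at hU
  have hU' : (U.card : ℝ) ≤ (2 * (4 * d * (K * H) * K : ℕ) + 1) ^ d := by exact_mod_cast hU
  have h1 := h.two_dKH_le
  have hKL : (K : ℝ) ≤ L := by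
    have h3 : (K : ℝ) ≤ d * (K * H) := by
      calc (K : ℝ) ≤ K * H := le_mul_of_one_le_right (by positivity) hH
        _ ≤ d * (K * H) := le_mul_of_one_le_left (by positivity) hd
    linarith
  have h2 : (2 * (4 * d * (K * H) * K : ℕ) + 1 : ℝ) ≤ L ^ 5 := by
    push_cast
    have e2 : (2 : ℝ) ^ 3 ≤ L ^ 3 := by gcongr
    have e3 : (1 : ℝ) ≤ L ^ 2 := one_le_pow₀ hL
    calc (2 * (4 * d * (K * H) * K) + 1 : ℝ) = 4 * ((2 * d * (K * H)) * K) + 1 := by ring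
      _ ≤ 4 * (L * L) + L ^ 2 := by gcongr
      _ ≤ L ^ 3 * L ^ 2 := by nlinarith
      _ = L ^ 5 := by ring
  calc (U.card : ℝ) ≤ (2 * (4 * d * (K * H) * K : ℕ) + 1) ^ d := hU'
    _ ≤ (L ^ 5) ^ d := by gcongr
    _ = L ^ (5 * d) := by ring
    _ ≤ L ^ (5 * d ^ 2) := by
        refine pow_le_pow_right₀ hL ?_
        have := h.one_le_d
        nlinarith

theorem sqrt_two_mul_sqrt_iota_ge : 1 ≤ √2 * √ι := by
  rw [← Real.sqrt_mul (by norm_num), Real.one_le_sqrt]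
  linarith [h.half_le_iota]

/-- The bonus covers noise, rounding and regularization. -/
theorem sum_errors_le_beta {k : ℕ} (hkK : k ≤ K) :
    31 * d * H * √ι + 2 * (1 / (K * H)) * k + √d + 2 * d * H ≤ β := by
  have hd := h.d_ge
  have hH := h.H_ge
  have hK := h.K_ge
  have hk' : (k : ℝ) ≤ K := by exact_mod_cast hkK
  have e1 : 2 * (1 / ((K : ℝ) * H)) * k ≤ 2 := by
    have e2 : 2 * (1 / ((K : ℝ) * H)) * k = 2 * (k / (K * H)) := by ring
    rw [e2]
    have e3 : (k : ℝ) / (K * H) ≤ 1 := by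
      rw [div_le_one (by positivity)]
      exact hk'.trans (le_mul_of_one_le_right (by positivity) hH)
    linarith
  have e2 : √(d : ℝ) ≤ d := Real.sqrt_le_iff.2 ⟨by positivity, by nlinarith⟩
  have e3 : (d : ℝ) ≤ d * H := le_mul_of_one_le_right (by positivity) hH
  have e4 : (1 : ℝ) ≤ d * H := one_le_mul_of_one_le_of_one_le hd hH
  have e5 := h.sqrt_two_mul_sqrt_iota_ge
  have e6 : √(2 : ℝ) ≤ 3 / 2 := Real.sqrt_le_iff.2 ⟨by norm_num, by norm_num⟩
  have e7 : 1 ≤ 3 / 2 * √ι := e5.trans (by gcongr)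
  rw [h.beta_eq]
  have e8 : (d * H : ℝ) ≤ d * H * (3 / 2 * √ι) := le_mul_of_one_le_right (by positivity) e7
  nlinarith

theorem noise_le_sq :
    6 * (H : ℝ) ^ 2 * (((155 * d ^ 2 : ℕ) : ℝ) * ι + 1) ≤ (31 * d * H * √ι) ^ 2 := by
  have hd := h.d_ge
  have hι := h.half_le_iota
  have e1 : (31 * d * H * √ι) ^ 2 = 961 * (H : ℝ) ^ 2 * (d ^ 2 * ι) := by
    rw [mul_pow, Real.sq_sqrt (by linarith)]; ring
  rw [e1]
  push_cast
  have e2 : 1 / 2 ≤ (d : ℝ) ^ 2 * ι := by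
    have : (1 : ℝ) ≤ d ^ 2 := one_le_pow₀ hd
    nlinarith
  have e3 : (0 : ℝ) ≤ (H : ℝ) ^ 2 := by positivity
  nlinarith

theorem inv_sq_le : (L ^ 2)⁻¹ ≤ p / 4 := by
  have h1 := h.two_le_L_mul_p
  have hL := h.two_le_L
  rw [inv_le_iff_one_le_mul₀ (by positivity)]
  nlinarith

/-- Total failure probability of the self-normalized bounds. -/
theorem noise_failure_le :
    (K : ℝ) * (H * (L ^ (49 * d ^ 2) * (L ^ (49 * d ^ 2) * (L ^ (49 * d ^ 2) * (L ^ (5 * d ^ 2) *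
      Real.exp (-(((155 * d ^ 2 : ℕ) : ℝ) * ι))))))) ≤ p / 4 := by
  have hL := h.one_le_L
  have hL0 : 0 < L := by linarith
  have hd := h.d_ge
  have hKH : (K : ℝ) * H ≤ L := by
    have h1 := h.two_dKH_le
    have h2 : (K * H : ℝ) ≤ d * (K * H) := le_mul_of_one_le_left (by positivity) hd
    have := h.dKH_ge
    linarith
  rw [h.exp_neg_nat_mul_iota]
  refine le_trans ?_ h.inv_sq_le
  have e1 : L ^ (49 * d ^ 2) * (L ^ (49 * d ^ 2) * (L ^ (49 * d ^ 2) * (L ^ (5 * d ^ 2) *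
      (L ^ (155 * d ^ 2))⁻¹))) = (L ^ (3 * d ^ 2))⁻¹ := by
    rw [eq_comm, inv_eq_iff_eq_inv]
    field_simp
    ring
  rw [e1, ← mul_assoc]
  calc (K * H : ℝ) * (L ^ (3 * d ^ 2))⁻¹ ≤ L * (L ^ 3)⁻¹ := by
        gcongr
        have : 1 ≤ d ^ 2 := Nat.one_le_pow _ _ h.one_le_d
        omega
    _ = (L ^ 2)⁻¹ := by field_simp

theorem azuma_failure_le : (H : ℝ) * Real.exp (-((3 : ℕ) * ι)) ≤ p / 8 := by
  have hL := h.one_le_L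
  have hL0 : 0 < L := by linarith
  have hHL : 2 * (H : ℝ) ≤ L := by
    have h1 := h.two_dKH_le
    have h2 : (H : ℝ) ≤ d * (K * H) := by
      calc (H : ℝ) ≤ K * H := le_mul_of_one_le_left (by positivity) h.K_ge
        _ ≤ d * (K * H) := le_mul_of_one_le_left (by positivity) h.d_ge
    linarith
  rw [h.exp_neg_nat_mul_iota]
  have h1 : (H : ℝ) * (L ^ 3)⁻¹ ≤ (L / 2) * (L ^ 3)⁻¹ := by
    gcongr
    linarith
  have h2 : (L / 2) * (L ^ 3)⁻¹ = (L ^ 2)⁻¹ / 2 := by field_simp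
  linarith [h.inv_sq_le]

theorem log_one_add_le : Real.log (1 + K) ≤ ι := by
  rw [h.iota_eq]
  refine Real.log_le_log (by positivity) ?_
  have h1 := h.two_dKH_le
  have h2 : (K : ℝ) ≤ d * (K * H) := by
    calc (K : ℝ) ≤ K * H := le_mul_of_one_le_right (by positivity) h.H_ge
      _ ≤ d * (K * H) := le_mul_of_one_le_left (by positivity) h.d_ge
  linarith [h.K_ge]

theorem sqrt_target : √((d : ℝ) ^ 3 * H ^ 3 * (K * H : ℕ) * ι ^ 2) = d * H ^ 2 * ι * √(d * K) := by
  have hι := h.half_le_iota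
  have : (d : ℝ) ^ 3 * H ^ 3 * (K * H : ℕ) * ι ^ 2 = (d * H ^ 2 * ι) ^ 2 * (d * K) := by
    push_cast; ring
  rw [this, Real.sqrt_mul (by positivity), Real.sqrt_sq (by positivity)]

/-- The noise and the bonuses sum up to the order of the regret bound. -/
theorem sum_widths_le :
    H * (2 * (5 * H * √(K * ι)) + 4 * β * √(K * (2 * (d * ι)))) ≤
      900 * √((d : ℝ) ^ 3 * H ^ 3 * (K * H : ℕ) * ι ^ 2) := by
  have hd := h.d_ge
  have hH := h.H_ge
  have hK := h.K_ge
  have hι := h.half_le_iota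
  have hι0 : 0 ≤ ι := by linarith
  rw [h.sqrt_target, h.beta_eq]
  have e6 : √(2 : ℝ) ≤ 3 / 2 := Real.sqrt_le_iff.2 ⟨by norm_num, by norm_num⟩
  have e7 : √ι ≤ 3 / 2 * ι := by
    have e5 := h.sqrt_two_mul_sqrt_iota_ge
    have : √ι * 1 ≤ √ι * (3 / 2 * √ι) := by
      gcongr
      exact e5.trans (by gcongr)
    have e8 := Real.mul_self_sqrt hι0
    nlinarith
  have s1 : √((K : ℝ) * ι) = √K * √ι := Real.sqrt_mul (by positivity) _
  have s2 : √((K : ℝ) * (2 * (d * ι))) = √2 * √(d * K) * √ι := by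
    rw [← Real.sqrt_mul (by norm_num), ← Real.sqrt_mul (by positivity)]
    congr 1; ring
  have s3 : √(K : ℝ) ≤ √(d * K) := Real.sqrt_le_sqrt (le_mul_of_one_le_left (by positivity) hd)
  rw [s1, s2]
  have hX : 0 ≤ √((d : ℝ) * K) := Real.sqrt_nonneg _
  have t1 : (H : ℝ) * (2 * (5 * H * (√K * √ι))) ≤ 15 * (d * H ^ 2 * ι * √(d * K)) := by
    calc (H : ℝ) * (2 * (5 * H * (√K * √ι))) ≤ H * (2 * (5 * H * (√(d * K) * (3 / 2 * ι)))) := by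
          gcongr
      _ = 1 * (15 * (H ^ 2 * ι * √(d * K))) := by ring
      _ ≤ d * (15 * (H ^ 2 * ι * √(d * K))) := by gcongr
      _ = _ := by ring
  have t2 : (H : ℝ) * (4 * (128 * d * H * √ι) * (√2 * √(d * K) * √ι)) ≤
      768 * (d * H ^ 2 * ι * √(d * K)) := by
    calc (H : ℝ) * (4 * (128 * d * H * √ι) * (√2 * √(d * K) * √ι)) =
          512 * d * H ^ 2 * (√ι * √ι) * √(d * K) * √2 := by ring
      _ ≤ 512 * d * H ^ 2 * (√ι * √ι) * √(d * K) * (3 / 2) := by gcongr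
      _ = _ := by rw [Real.mul_self_sqrt hι0]; ring
  have t3 : 0 ≤ d * H ^ 2 * ι * √(d * K) := by positivity
  rw [mul_add]
  linarith

theorem half_le_target : 1 / 2 ≤ √((d : ℝ) ^ 3 * H ^ 3 * (K * H : ℕ) * ι ^ 2) := by
  rw [h.sqrt_target]
  have hd := h.d_ge
  have hι := h.half_le_iota
  have e1 : (1 : ℝ) ≤ √(d * K) := by
    rw [Real.one_le_sqrt]
    exact one_le_mul_of_one_le_of_one_le hd h.K_ge
  have e2 : (1 : ℝ) ≤ d * H ^ 2 := one_le_mul_of_one_le_of_one_le hd (one_le_pow₀ h.H_ge)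
  calc (1 / 2 : ℝ) ≤ ι := hι
    _ = 1 * ι * 1 := by ring
    _ ≤ d * H ^ 2 * ι * √(d * K) := by gcongr

/-- At this scale the level `3 ι` and the quadratic compensator `2 ι` together bound the noise sum
by `5 H √(K ι)`. -/
theorem noise_sum_le_of_scaled {s : ℝ}
    (hs : √(K * ι) / (K * H) * s - K * ((√(K * ι) / (K * H)) ^ 2 * (2 * H) ^ 2 / 2) ≤ 3 * ι) :
    s ≤ 5 * H * √(K * ι) := by
  have hK := h.K_ge
  have hH := h.H_ge
  have hι := h.half_le_iota
  set r := √(K * ι) with hr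
  have hr0 : 0 < r := Real.sqrt_pos.2 (by positivity)
  have hr2 : r * r = K * ι := Real.mul_self_sqrt (by positivity)
  have e1 : K * ((r / (K * H)) ^ 2 * (2 * H) ^ 2 / 2) = 2 * ι := by
    have : K * ((r / (K * H)) ^ 2 * (2 * H) ^ 2 / 2) = 2 * (r * r) / K := by
      field_simp
    rw [this, hr2]; field_simp
  rw [e1] at hs
  have e2 : r / (K * H) * s ≤ r / (K * H) * (5 * H * r) := by
    have : r / (K * H) * (5 * H * r) = 5 * (r * r) / K := by field_simp
    rw [this, hr2]
    have : 5 * ((K : ℝ) * ι) / K = 5 * ι := by field_simp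
    rw [this]; linarith
  exact le_of_mul_le_mul_left e2 (by positivity)

end LogFactor

end Constants

/-! ### The good event and the regret bound -/

section Main

variable {S A Ω : Type*} [MeasurableSpace S] [MeasurableSpace A] [DiscreteMeasurableSpace A]
  [Finite A] {G : MarkovGame S A} {d : ℕ} {φ : S × A × A → EuclideanSpace ℝ (Fin d)}
  {θ : ℕ → EuclideanSpace ℝ (Fin d)} {μ : ℕ → Fin d → SignedMeasure S} {K : ℕ}
  {p L ι β : ℝ} {N : ℕ → Set (S × A × A → ℝ)}
  {cce : (S × A × A → ℝ) → (S × A × A → ℝ) → StochKernel S (A × A)}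
  {x : ℕ → ℕ → Ω → S} {act : ℕ → ℕ → Ω → A × A} {σ : ℕ → Ω → Policy S (A × A)}

/-- The noise sums of step `h`, of the next states and of the actions, are below the level `3 ι`.
They are scaled by `√(K ι) / (K H)`, which has the order of the best scale in the Chernoff bound,
and compensated by the quadratic term of Hoeffding's lemma; the sign is that of (mean - observed
value). -/
def RegretNoiseLe (G : MarkovGame S A) (φ : S × A × A → EuclideanSpace ℝ (Fin d)) (β : ℝ) (K : ℕ)
    (x : ℕ → ℕ → Ω → S) (act : ℕ → ℕ → Ω → A × A) (σ : ℕ → Ω → Policy S (A × A)) (ι : ℝ) (h : ℕ)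
    (ω : Ω) : Prop :=
  (∑ k ∈ Finset.Ico 1 (K + 1),
      (-(√(K * ι) / (K * G.horizon)) * (vGap G φ β x act σ k (h + 1) ω (x k (h + 1) ω) -
        ∫ y, vGap G φ β x act σ k (h + 1) ω y ∂((G.trans h).1 (x k h ω, act k h ω))) -
        (-(√(K * ι) / (K * G.horizon))) ^ 2 * (2 * G.horizon) ^ 2 / 2) ≤ (3 : ℕ) * ι) ∧
  (∑ k ∈ Finset.Ico 1 (K + 1),
      (-(√(K * ι) / (K * G.horizon)) * (qGap G φ β x act σ k h ω (x k h ω, act k h ω) -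
        ∫ ab, qGap G φ β x act σ k h ω (x k h ω, ab) ∂((σ k ω h).1 (x k h ω))) -
        (-(√(K * ι) / (K * G.horizon))) ^ 2 * (2 * G.horizon) ^ 2 / 2) ≤ (3 : ℕ) * ι)

/-- On the good event the widths of the confidence intervals at the first step sum up to the
regret bound. -/
theorem sum_vGap_le (hL : LogFactor d G.horizon K p L ι β) (hG : G.IsLinear φ θ μ) {ω : Ω}
    (hβ : ∀ k ∈ Finset.Icc 1 K,
      BonusDominates G φ β (fun τ t => x τ t ω) (fun τ t => act τ t ω) k (σ k ω))
    (hnoise : ∀ h ∈ Finset.Icc 1 G.horizon, RegretNoiseLe G φ β K x act σ ι h ω) :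
    ∑ k ∈ Finset.Icc 1 K, vGap G φ β x act σ k 1 ω (x k 1 ω) ≤
      900 * √((d : ℝ) ^ 3 * G.horizon ^ 3 * (K * G.horizon : ℕ) * ι ^ 2) := by
  refine le_trans (Finset.sum_le_sum fun k hk =>
    vGap_one_le hG.measurable_feature hL.beta_pos.le (hβ k hk)) ?_
  rw [Finset.sum_comm]
  refine le_trans ?_ hL.sum_widths_le
  have hIco : Finset.Ico 1 (K + 1) = Finset.Icc 1 K := Finset.Ico_add_one_right_eq_Icc 1 K
  have hscale : ∀ f g : ℕ → ℝ,
      ∑ k ∈ Finset.Ico 1 (K + 1), (-(√(K * ι) / (K * G.horizon)) * (f k - g k) -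
        (-(√(K * ι) / (K * G.horizon))) ^ 2 * (2 * G.horizon) ^ 2 / 2) ≤ (3 : ℕ) * ι →
      ∑ k ∈ Finset.Icc 1 K, (g k - f k) ≤ 5 * G.horizon * √(K * ι) := by
    intro f g hfg
    refine hL.noise_sum_le_of_scaled (le_trans (le_of_eq ?_) hfg)
    generalize √(K * ι) / (K * G.horizon) = a
    symm
    rw [hIco, Finset.sum_sub_distrib, Finset.sum_const, Nat.card_Icc, Nat.add_sub_cancel,
      nsmul_eq_mul, neg_sq, Finset.mul_sum]
    congr 1
    exact Finset.sum_congr rfl fun k _ => by ring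
  calc _ ≤ ∑ h ∈ Finset.Icc 1 G.horizon,
        (2 * (5 * G.horizon * √(K * ι)) + 4 * β * √(K * (2 * (d * ι)))) := by
        refine Finset.sum_le_sum fun h hh => ?_
        rw [Finset.sum_add_distrib, Finset.sum_add_distrib, ← Finset.mul_sum]
        have h1 := hscale _ _ (hnoise h hh).1
        have h2 := hscale _ _ (hnoise h hh).2
        have h3 := sum_ellNorm_le hG.norm_feature_le (fun τ t => x τ t ω) (fun τ t => act τ t ω) h K
        have h4 : √(K * (2 * (d * Real.log (1 + K)))) ≤ √(K * (2 * (d * ι))) := by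
          have := hL.log_one_add_le
          gcongr
        have h5 := mul_le_mul_of_nonneg_left (h3.trans h4)
          (by linarith [hL.beta_pos] : 0 ≤ 4 * β)
        linarith
    _ = _ := by rw [Finset.sum_const, Nat.card_Icc, Nat.add_sub_cancel, nsmul_eq_mul]

variable [MeasurableSpace Ω] {P : Measure Ω} [IsProbabilityMeasure P]

/-- With high probability all bonuses dominate and all noise sums of the regret are small. -/
theorem exists_good_event (hL : LogFactor d G.horizon K p L ι β) (hG : G.IsLinear φ θ μ)
    (hN : ∀ k ∈ Finset.Icc 1 K,
      IsMinSupCover (qClass φ G.horizon β k) (1 / (K * G.horizon)) (N k))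
    (hrun : IsOmniRun P G φ β (1 / (K * G.horizon)) K N cce x act σ) :
    ∃ E : Set Ω, MeasurableSet E ∧ 1 - p ≤ P.real E ∧ ∀ ω ∈ E,
      (∀ k ∈ Finset.Icc 1 K,
        BonusDominates G φ β (fun τ t => x τ t ω) (fun τ t => act τ t ω) k (σ k ω)) ∧
      ∀ h ∈ Finset.Icc 1 G.horizon, RegretNoiseLe G φ β K x act σ ι h ω := by
  have hnets : ∀ k ∈ Finset.Icc 1 K, ∃ F : Finset (S × A × A → ℝ),
      ↑F = N k ∧ (F.card : ℝ) ≤ L ^ (49 * d ^ 2) := fun k hk =>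
    hL.exists_finset_net hG.norm_feature_le (Finset.mem_Icc.1 hk).2 (hN k hk)
  choose! F hF hFcard using hnets
  have hNfin : ∀ k ∈ Finset.Icc 1 K, (N k).Finite := fun k hk => by
    rw [← hF k hk]; exact (F k).finite_toSet
  obtain ⟨U, hUcard, hU⟩ := hL.exists_direction_net
  have hLpos : 0 ≤ L := by linarith [hL.one_le_L]
  set Γ : ℝ := ((155 * d ^ 2 : ℕ) : ℝ) * ι with hΓ
  set lam : ℝ := √(K * ι) / (K * G.horizon) with hlam
  let noise : ℕ → ℕ → (S × A × A → ℝ) → (S × A × A → ℝ) → (S × A × A → ℝ) → (Fin d → ℝ) → Ω → ℝ :=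
    fun k h q₁ q₂ q₃ u ω => ∑ τ ∈ Finset.Ico 1 k, ((u ⬝ᵥ (φ (x τ h ω, act τ h ω)).ofLp) *
        (netValue cce q₁ q₂ q₃ (x τ (h + 1) ω) -
          ∫ y, netValue cce q₁ q₂ q₃ y ∂((G.trans h).1 (x τ h ω, act τ h ω))) -
        (G.horizon : ℝ) ^ 2 / 2 * (u ⬝ᵥ (φ (x τ h ω, act τ h ω)).ofLp) ^ 2)
  let B₁ : Set Ω := ⋃ k ∈ Finset.Icc 1 K, ⋃ h ∈ Finset.Icc 1 G.horizon, ⋃ q₁ ∈ F k, ⋃ q₂ ∈ F k,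
    ⋃ q₃ ∈ F k, ⋃ u ∈ U, {ω | Γ < noise k h q₁ q₂ q₃ u ω}
  let B₂ : Set Ω := ⋃ h ∈ Finset.Icc 1 G.horizon, {ω | (3 : ℕ) * ι < ∑ k ∈ Finset.Ico 1 (K + 1),
      (-lam * (vGap G φ β x act σ k (h + 1) ω (x k (h + 1) ω) -
        ∫ y, vGap G φ β x act σ k (h + 1) ω y ∂((G.trans h).1 (x k h ω, act k h ω))) -
        (-lam) ^ 2 * (2 * G.horizon) ^ 2 / 2)}
  let B₃ : Set Ω := ⋃ h ∈ Finset.Icc 1 G.horizon, {ω | (3 : ℕ) * ι < ∑ k ∈ Finset.Ico 1 (K + 1),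
      (-lam * (qGap G φ β x act σ k h ω (x k h ω, act k h ω) -
        ∫ ab, qGap G φ β x act σ k h ω (x k h ω, ab) ∂((σ k ω h).1 (x k h ω))) -
        (-lam) ^ 2 * (2 * G.horizon) ^ 2 / 2)}
  have hB₁ : P B₁ ≤ ENNReal.ofReal (p / 4) := by
    refine le_trans ?_ (ENNReal.ofReal_le_ofReal hL.noise_failure_le)
    refine measure_biUnion_finset_le_ofReal P _ _ (by positivity) (by simp) fun k hk => ?_
    refine measure_biUnion_finset_le_ofReal P _ _ (by positivity) (by simp) fun h hh => ?_
    refine measure_biUnion_finset_le_ofReal P _ _ (by positivity) (hFcard k hk) fun q₁ _ => ?_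
    refine measure_biUnion_finset_le_ofReal P _ _ (by positivity) (hFcard k hk) fun q₂ _ => ?_
    refine measure_biUnion_finset_le_ofReal P _ _ (by positivity) (hFcard k hk) fun q₃ hq₃ => ?_
    refine measure_biUnion_finset_le_ofReal P _ _ (by positivity) hUcard fun u _ => ?_
    have hq : q₃ ∈ qClass φ G.horizon β k := (hN k hk).1.1 (by rw [← hF k hk]; exact hq₃)
    refine hrun.measure_noise_gt_le hG.measurable_feature hh ?_
      (measurable_netValue (measurable_of_mem_qClass hG.measurable_feature hq))
      (abs_netValue_le (abs_le_of_mem_qClass (by positivity) hq)) u Γ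
    rw [Finset.mem_Icc] at hk
    omega
  have hB₂ : P B₂ ≤ ENNReal.ofReal (p / 8) := by
    refine le_trans ?_ (ENNReal.ofReal_le_ofReal hL.azuma_failure_le)
    exact measure_biUnion_finset_le_ofReal P _ _ (by positivity) (by simp) fun h hh =>
      hrun.measure_state_noise_gt_le hG.measurable_feature hNfin hh lam _
  have hB₃ : P B₃ ≤ ENNReal.ofReal (p / 8) := by
    refine le_trans ?_ (ENNReal.ofReal_le_ofReal hL.azuma_failure_le)
    exact measure_biUnion_finset_le_ofReal P _ _ (by positivity) (by simp) fun h hh =>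
      hrun.measure_act_noise_gt_le hG.measurable_feature hNfin hh lam _
  have hp := hL.p_pos
  have hB : P (B₁ ∪ B₂ ∪ B₃) ≤ ENNReal.ofReal p := by
    refine (measure_union_le _ _).trans ((add_le_add (measure_union_le _ _) le_rfl).trans ?_)
    refine (add_le_add (add_le_add hB₁ hB₂) hB₃).trans ?_
    rw [← ENNReal.ofReal_add (by positivity) (by positivity),
      ← ENNReal.ofReal_add (by positivity) (by positivity)]
    exact ENNReal.ofReal_le_ofReal (by linarith)
  -- the bad set need not be measurable, hence its measurable hull
  refine ⟨(toMeasurable P (B₁ ∪ B₂ ∪ B₃))ᶜ, (measurableSet_toMeasurable _ _).compl, ?_, ?_⟩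
  · rw [probReal_compl_eq_one_sub (measurableSet_toMeasurable _ _), measureReal_def,
      measure_toMeasurable]
    have := ENNReal.toReal_mono ENNReal.ofReal_ne_top hB
    rw [ENNReal.toReal_ofReal hp.le] at this
    linarith
  · intro ω hω
    have hω' : ω ∉ B₁ ∪ B₂ ∪ B₃ := fun h => hω (subset_toMeasurable P _ h)
    simp only [Set.mem_union, not_or] at hω'
    obtain ⟨⟨h1, h2⟩, h3⟩ := hω'
    refine ⟨fun k hk => ?_, fun h hh => ⟨?_, ?_⟩⟩
    · have hk' := Finset.mem_Icc.1 hk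
      refine bonusDominates_of_noise_le hG hL.one_le_H hk'.1 hk'.2 (fun τ t => x τ t ω)
        (fun τ t => act τ t ω) (σ k ω) (by positivity)
        (fun h hh => hrun.policy_eq k hk h hh ω) (hN k hk).1.1 (U : Set (Fin d → ℝ))
        (fun v hv => hU v hv) (Γ := Γ) (R := 31 * d * G.horizon * √ι) ?_ (by positivity)
        hL.noise_le_sq (hL.sum_errors_le_beta hk'.2)
      intro h hh q₁ hq₁ q₂ hq₂ q₃ hq₃ u hu
      rw [← hF k hk] at hq₁ hq₂ hq₃
      by_contra hcon
      refine h1 ?_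
      simp only [B₁, Set.mem_iUnion]
      exact ⟨k, hk, h, hh, q₁, hq₁, q₂, hq₂, q₃, hq₃, u, hu, not_le.1 hcon⟩
    · by_contra hcon
      refine h2 ?_
      simp only [B₂, Set.mem_iUnion]
      exact ⟨h, hh, not_le.1 hcon⟩
    · by_contra hcon
      refine h3 ?_
      simp only [B₃, Set.mem_iUnion]
      exact ⟨h, hh, not_le.1 hcon⟩

end Main

end

theorem theorem1 :
    ∃ c C : ℝ, 0 < c ∧ 0 < C ∧
      ∀ (S A Ω : Type*) [MeasurableSpace S] [MeasurableSpace A] [DiscreteMeasurableSpace A]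
        [Finite A] [MeasurableSpace Ω] (P : Measure Ω) [IsProbabilityMeasure P]
        (G : MarkovGame S A) (d : ℕ) (φ : S × A × A → EuclideanSpace ℝ (Fin d))
        (θ : ℕ → EuclideanSpace ℝ (Fin d)) (μ : ℕ → Fin d → SignedMeasure S)
        (H K T : ℕ) (p ι β ε : ℝ) (N : ℕ → Set (S × A × A → ℝ))
        (cce : (S × A × A → ℝ) → (S × A × A → ℝ) → StochKernel S (A × A))
        (x : ℕ → ℕ → Ω → S) (act : ℕ → ℕ → Ω → A × A) (σ : ℕ → Ω → Policy S (A × A)),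
        H = G.horizon → 1 ≤ H → 1 ≤ K → T = K * H →
        G.IsLinear φ θ μ →
        0 < p → p < 1 →
        ι = Real.log (2 * d * T / p) →
        β = c * d * H * √ι →
        ε = 1 / (K * H) →
        (∀ k ∈ Finset.Icc 1 K, IsMinSupCover (qClass φ H β k) ε (N k)) →
        (∀ k ∈ Finset.Icc 1 K, IsCCERule (N k) cce) →
        IsOmniRun P G φ β ε K N cce x act σ →
        ∃ E : Set Ω, MeasurableSet E ∧ 1 - p ≤ P.real E ∧ ∀ ω ∈ E,
          (∀ k ∈ Finset.Icc 1 K,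
            G.valueBestFst (σ k ω).marginalSnd 1 (x k 1 ω) -
                G.valueBestSnd (σ k ω).marginalFst 1 (x k 1 ω) ≤
              vEst G φ β (fun τ t => x τ t ω) (fun τ t => act τ t ω) k 1 (σ k ω) 1 (x k 1 ω) -
                vEst G φ β (fun τ t => x τ t ω) (fun τ t => act τ t ω) k (-1) (σ k ω) 1
                  (x k 1 ω) + 8 / K) ∧
          (∑ k ∈ Finset.Icc 1 K,
              (vEst G φ β (fun τ t => x τ t ω) (fun τ t => act τ t ω) k 1 (σ k ω) 1 (x k 1 ω) -
                vEst G φ β (fun τ t => x τ t ω) (fun τ t => act τ t ω) k (-1) (σ k ω) 1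
                  (x k 1 ω)) ≤
            C * √(d ^ 3 * H ^ 3 * T * ι ^ 2)) ∧
          totalGap G K (fun k => x k 1 ω) (fun k => σ k ω) ≤
            C * √(d ^ 3 * H ^ 3 * T * ι ^ 2) := by
  -- `C` is the constant `900` of the widths plus `16` for the total rounding error `8`, which is at
  -- most `16` times the square root
  refine ⟨128, 1000, by norm_num, by norm_num, ?_⟩
  intro S A Ω _ _ _ _ _ P _ G d φ θ μ H K T p ι β ε N cce x act σ hH hH1 hK hT hG hp hp1 hι hβ hε
    hN hcce hrun
  subst hH hT hε
  obtain ⟨ω₀⟩ : Nonempty Ω := nonempty_of_isProbabilityMeasure P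
  have hd := hG.dim_pos hH1 (x 1 1 ω₀, act 1 1 ω₀)
  have hL : LogFactor d G.horizon K p (2 * d * (K * G.horizon : ℕ) / p) ι β :=
    ⟨hd, hH1, hK, hp, hp1, rfl, hι, hβ⟩
  obtain ⟨E, hE, hPE, hgood⟩ := exists_good_event hL hG hN hrun
  refine ⟨E, hE, hPE, fun ω hω => ?_⟩
  obtain ⟨hdom, hnoise⟩ := hgood ω hω
  have hKr := hL.K_ge
  have hHr := hL.H_ge
  have hgap : ∀ k ∈ Finset.Icc 1 K,
      G.valueBestFst (σ k ω).marginalSnd 1 (x k 1 ω) -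
        G.valueBestSnd (σ k ω).marginalFst 1 (x k 1 ω) ≤
      vGap G φ β x act σ k 1 ω (x k 1 ω) + 8 / K := by
    intro k hk
    refine (valueBest_sub_le hG.measurable_feature (hdom k hk) (by positivity) (hcce k hk)
      (fun h hh => hrun.policy_eq k hk h hh ω) (x k 1 ω)).trans ?_
    have h1 : 4 * (G.horizon : ℝ) * (1 / (K * G.horizon)) = 4 / K := by field_simp
    rw [h1]
    unfold vGap
    gcongr
    norm_num
  have hsum := sum_vGap_le hL hG hdom hnoise
  have htarget := hL.half_le_target
  refine ⟨hgap, ?_, ?_⟩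
  · refine le_trans hsum ?_
    gcongr
    norm_num
  · unfold totalGap
    refine (Finset.sum_le_sum hgap).trans ?_
    rw [Finset.sum_add_distrib, Finset.sum_const, Nat.card_Icc, Nat.add_sub_cancel, nsmul_eq_mul]
    have h1 : (K : ℝ) * (8 / K) = 8 := by field_simp
    rw [h1]
    linarith
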